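/- Let $(\rho,z,\phi)$ be cylindrical coordinates in $\mathbb{R}^3$, $r=\sqrt{\rho^2+z^2}$, $\sigma=\sqrt{r^2+1}$, $\cos\theta=z/r$, $\sin\theta=\rho/r$, and for functions of $(\rho,z)$ write $|\partial f|^2=f_{,\rho}^2+f_{,z}^2$. Define $$\mathcal{M}(v,Y)=\frac{1}{32\pi}\int_{\mathbb{R}^3}\left(|\partial v|^2+\rho^{-4}e^{-2v}|\partial Y|^2\right)d\mu,\qquad d\mu=\rho\,dz\,d\rho\,d\phi .$$ For $J\in\mathbb{R}$ put $\tilde r=r+\sqrt{|J|}$, $\Sigma=\tilde r^2+|J|\cos^2\theta$, and let $u_0=(v_0,Y_0)$ be the extreme Kerr data with angular momentum $J$: $$X_0=\frac{(\tilde r^2+|J|)^2-r^2|J|\sin^2\theta}{\Sigma}\,\sin^2\theta,\qquad v_0=\ln X_0-2\ln\rho,$$ $$Y_0=2J(\cos^3\theta-3\cos\theta)-\frac{2J|J|\cos\theta\sin^4\theta}{\Sigma}.$$ Let $\beta<-1/2$, $\rho_0>0$, and $\Omega_{\rho_0}=\{\rho>\rho_0\}\subset\mathbb{R}^3$. For an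 open set $\Omega\subset\mathbb{R}^3$ let $C^1_\beta(\Omega)$ be the space of $C^1$ functions $f$ in $\Omega$ with $$\|f\|_{C^1_\beta(\Omega)}=\sup_{\Omega}\left\{\sigma^{-\beta}|f|+\sigma^{-\beta+1}|\partial f|\right\}<\infty .$$ Let $\mathcal{B}$ be the space of pairs $\varphi=(\alpha,y)$ of functions on $\mathbb{R}^3$ depending only on $(\rho,z)$, such that $\alpha\in C^1_\beta(\mathbb{R}^3)$, $y$ is continuous on $\mathbb{R}^3$, $y=0$ in the cylinder $\{\rho\le\rho_0\}$, and $y\in C^1_\beta(\Omega_{\rho_0})$, with the norm $\|\varphi\|_{\mathcal{B}}=\|\alpha\|_{C^1_\beta(\mathbb{R}^3)}+\|y\|_{C^1_\beta(\Omega_{\rho_0})}$. Then $\varphi\mapsto\mathcal{M}(u_0+\varphi)$ is a well-defined real-valued functional on $\mathcal{B}$ (the integrand is integrable for every $\varphi\in\mathcal{B}$), and it has a strict local minimum at $\varphi=0$: there exists $\epsilon>0$ such that $$\mathcal{M}(u_0+\varphi)>\mathcal{M}(u_0)$$ for all $\varphi\in\mathcal{B}$ with $\|\varphi\|_{\mathcal{B}}<\epsilon$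 and $\varphi\neq0$. -/

import Mathlib

noncomputable section

namespace KerrMass

/-- Euclidean three-space, with Cartesian coordinates `(x 0, x 1, x 2)`. -/
abbrev E3 : Type := EuclideanSpace ℝ (Fin 3)

/-- The cylindrical radius, i.e. the distance to the axis. -/
def rho (x : E3) : ℝ := Real.sqrt (x 0 ^ 2 + x 1 ^ 2)

/-- The cylindrical height. -/
def zed (x : E3) : ℝ := x 2

/-- The spherical radius `r = √(ρ² + z²)`. -/
def rad (x : E3) : ℝ := Real.sqrt (rho x ^ 2 + zed x ^ 2)

/-- The weight `σ = √(r² + 1)`. -/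
def sigma (x : E3) : ℝ := Real.sqrt (rad x ^ 2 + 1)

/-- `f` depends only on the cylindrical coordinates `ρ` and `z`. -/
def Axisymmetric (f : E3 → ℝ) : Prop :=
  ∀ x x' : E3, rho x = rho x' → zed x = zed x' → f x = f x'

/-- The coordinate vector field `∂/∂ρ` (it is `0` on the axis, where the `ρ`-derivative of a
differentiable axisymmetric function vanishes). -/
def eRho (x : E3) : E3 := !₂[x 0 / rho x, x 1 / rho x, 0]

/-- The coordinate vector field `∂/∂z`. -/
def eZed : E3 := !₂[0, 0, 1]

/-- The partial derivative with respect to `ρ`. -/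
def dRho (f : E3 → ℝ) (x : E3) : ℝ := fderiv ℝ f x (eRho x)

/-- The partial derivative with respect to `z`. -/
def dZed (f : E3 → ℝ) (x : E3) : ℝ := fderiv ℝ f x eZed

/-- `|∂f|² = (∂_ρ f)² + (∂_z f)²`. -/
def partialSq (f : E3 → ℝ) (x : E3) : ℝ := dRho f x ^ 2 + dZed f x ^ 2

/-- The integrand `|∂v|² + ρ⁻⁴ e^{-2v} |∂Y|²` of the mass functional, for `u = (v, Y)`. -/
def massDensity (u : (E3 → ℝ) × (E3 → ℝ)) (x : E3) : ℝ :=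
  partialSq u.1 x + rho x ^ (-4 : ℤ) * Real.exp (-2 * u.1 x) * partialSq u.2 x

/-- The mass functional `M(v, Y)`, integrated against Lebesgue measure on `ℝ³`. -/
def mass (u : (E3 → ℝ) × (E3 → ℝ)) : ℝ :=
  1 / (32 * Real.pi) * ∫ x : E3, massDensity u x

/-! The extreme Kerr data with angular momentum `J`. Values on the axis, a null set, play no
role. -/

/-- `cos θ = z / r`. -/
def cosTheta (x : E3) : ℝ := zed x / rad x

/-- `sin θ = ρ / r`. -/
def sinTheta (x : E3) : ℝ := rho x / rad x

/-- The Boyer-Lindquist radius `r + √|J|`. -/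
def rBL (J : ℝ) (x : E3) : ℝ := rad x + Real.sqrt |J|

/-- `Σ = (r + √|J|)² + |J| cos² θ`. -/
def kerrSigma (J : ℝ) (x : E3) : ℝ := rBL J x ^ 2 + |J| * cosTheta x ^ 2

/-- The squared norm `X₀` of the axial Killing field of extreme Kerr. -/
def kerrX (J : ℝ) (x : E3) : ℝ :=
  ((rBL J x ^ 2 + |J|) ^ 2 - rad x ^ 2 * |J| * sinTheta x ^ 2) / kerrSigma J x * sinTheta x ^ 2

/-- `v₀ = ln X₀ - 2 ln ρ`. -/
def kerrV (J : ℝ) (x : E3) : ℝ := Real.log (kerrX J x) - 2 * Real.log (rho x)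

/-- The twist potential `Y₀` of extreme Kerr. It is odd in `J`. -/
def kerrY (J : ℝ) (x : E3) : ℝ :=
  2 * J * (cosTheta x ^ 3 - 3 * cosTheta x)
    - 2 * J * |J| * cosTheta x * sinTheta x ^ 4 / kerrSigma J x

/-- The extreme Kerr data `u₀ = (v₀, Y₀)`. -/
def kerrData (J : ℝ) : (E3 → ℝ) × (E3 → ℝ) := (kerrV J, kerrY J)

/-! The space of perturbations. -/

/-- The quantity `σ^{-β} |f| + σ^{-β+1} |∂f|`. -/
def weightedC1 (β : ℝ) (f : E3 → ℝ) (x : E3) : ℝ :=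
  sigma x ^ (-β) * |f x| + sigma x ^ (-β + 1) * Real.sqrt (partialSq f x)

/-- The weighted norm of `C¹_β(Ω)`. -/
def c1Norm (β : ℝ) (Ω : Set E3) (f : E3 → ℝ) : ℝ := ⨆ x : Ω, weightedC1 β f x

/-- `f` is of class `C¹` in the open set `Ω` and its weighted norm is finite. -/
def MemC1 (β : ℝ) (Ω : Set E3) (f : E3 → ℝ) : Prop :=
  ContDiffOn ℝ 1 f Ω ∧ BddAbove (weightedC1 β f '' Ω)

/-- The closed solid cylinder `ρ ≤ ρ₀` around the axis. -/
def cylinder (ρ₀ : ℝ) : Set E3 := {x | rho x ≤ ρ₀}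

/-- The space `B` of perturbations `φ = (α, y)`: both functions depend on `ρ, z` only,
`α ∈ C¹_β(ℝ³)`, and `y` is a continuous function on `ℝ³` that vanishes in the cylinder `ρ ≤ ρ₀`
and belongs to `C¹_β` of its complement. -/
def perturbations (β ρ₀ : ℝ) : Set ((E3 → ℝ) × (E3 → ℝ)) :=
  {φ | Axisymmetric φ.1 ∧ Axisymmetric φ.2 ∧ MemC1 β Set.univ φ.1 ∧
    Continuous φ.2 ∧ (∀ x ∈ cylinder ρ₀, φ.2 x = 0) ∧ MemC1 β (cylinder ρ₀)ᶜ φ.2}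

/-- The norm of `B`. -/
def bNorm (β ρ₀ : ℝ) (φ : (E3 → ℝ) × (E3 → ℝ)) : ℝ :=
  c1Norm β Set.univ φ.1 + c1Norm β (cylinder ρ₀)ᶜ φ.2

end KerrMass

end

noncomputable section
namespace KerrMass

open Real Set MeasureTheory Topology Filter

/-! Put `X = ρ² e^v`. Up to the singular contribution of `log ρ`, the mass density is the energy
density of the map `(X, Y)` into the upper half plane with metric `(dX² + dY²) / X²`, and extreme
Kerr satisfies the Euler equations `Δv₀ = -X₀⁻² |∇Y₀|²` and `div (X₀⁻² ∇Y₀) = 0` (`fieldDiv_gradV`,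
`fieldDiv_fluxY`). Since the target has negative curvature, the energy is convex along geodesics, so
a critical point is a minimum. No smallness of the perturbation is needed: the minimum is global
within the space of perturbations.

Convexity is used in an integrated, pointwise form. At each point join the value of `u₀` to that of
`u₀ + φ` by the hyperbolic geodesic, of length `d`. The change of the energy density, minus the
first variation in the direction of the initial velocity, is an explicit sum of squares and is at
least `|∂d|²` where `d > 0` (`geodesic_identity`, `energyExcess_ge`). In terms of `α` and `w = y /
X₀` one has `cosh d = cosh α + e^{-α} w² / 2`, and the velocity involves the factor `F = d / sinh
d`, treated as a function of `cosh d`.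

The first variation is a sum of three divergences (`massDensity_sub_eq`). The vertical velocity is
split as `α + G`, with `G` the `vertExcess`. The function `α` need not vanish on the axis, where `∇
log ρ` is singular, so it is paired with `∇v₀` only, which is regular away from the origin. Where `y
= 0` the geodesic is vertical and `G = 0`; hence `G` vanishes in the cylinder and may be paired with
`∇ log ρ` as well. The remaining divergence contains the horizontal velocity, which vanishes with
`y` too. Because `G` is quadratic in `y`, it decays like `σ^{2β}`, and `β < -1/2` suffices for the
flux along `∇ log ρ`, which does not decay in the `z` direction.

All three divergences integrate to zero in the limit of logarithmic cutoffs at the origin and at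
infinity (`tendsto_integral_logCut`), so the mass difference is the limit of cut-off integrals of
the nonnegative `massExcess`. If it were not positive, `massExcess` would vanish almost everywhere;
then `cosh d` is constant on vertical lines, tends to `1` at their ends, and so `d = 0` and `φ = 0`
(`eq_zero_of_massExcess_ae_eq_zero`). -/

/-! ### The function `d / sinh d` of `cosh d` -/

/-- The smooth function `F` on `[1, ∞)` with `F (cosh d) = d / sinh d`, extended by `1`. -/
def arcoshDivSinh (C : ℝ) : ℝ := if C ≤ 1 then 1 else arcosh C / √(C ^ 2 - 1)

lemma arcoshDivSinh_one : arcoshDivSinh 1 = 1 := by simp [arcoshDivSinh]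

lemma sinh_le_mul_cosh {d : ℝ} (hd : 0 ≤ d) : sinh d ≤ d * cosh d := by
  have hmono : MonotoneOn (fun t => t * cosh t - sinh t) (Ici 0) := by
    apply monotoneOn_of_deriv_nonneg (convex_Ici 0)
    · fun_prop
    · fun_prop
    · intro t ht
      have ht : 0 < t := by simpa using ht
      have : HasDerivAt (fun t => t * cosh t - sinh t) (1 * cosh t + t * sinh t - cosh t) t :=
        ((hasDerivAt_id t).mul (hasDerivAt_cosh t)).sub (hasDerivAt_sinh t)
      rw [this.deriv]
      have := mul_nonneg ht.le (sinh_nonneg_iff.2 ht.le)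
      linarith
  have := hmono (mem_Ici.2 le_rfl) (mem_Ici.2 hd) hd
  simp at this
  linarith

lemma arcoshDivSinh_of_one_lt {C : ℝ} (hC : 1 < C) :
    arcoshDivSinh C = arcosh C / √(C ^ 2 - 1) := by simp [arcoshDivSinh, hC]

/-- With `C = cosh d` these are `d coth d ≥ 1` and `d / sinh d ≤ 1`, that is, `tanh d ≤ d ≤ sinh d`.
-/
lemma arcoshDivSinh_mem {C : ℝ} (hC : 1 ≤ C) :
    1 ≤ arcoshDivSinh C * C ∧ arcoshDivSinh C ≤ 1 := by
  rcases hC.eq_or_lt with rfl | hC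
  · simp [arcoshDivSinh_one]
  have hpos := arcosh_pos hC
  rw [arcoshDivSinh_of_one_lt hC, ← sinh_arcosh hC.le]
  have hs : 0 < sinh (arcosh C) := sinh_pos_iff.2 hpos
  constructor
  · have := sinh_le_mul_cosh hpos.le
    rw [cosh_arcosh hC.le] at this
    rw [div_mul_eq_mul_div, le_div_iff₀ hs]
    linarith
  · rw [div_le_one hs]
    exact self_le_sinh_iff.2 hpos.le

lemma arcoshDivSinh_pos {C : ℝ} (hC : 1 ≤ C) : 0 < arcoshDivSinh C := by
  have := (arcoshDivSinh_mem hC).1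
  by_contra h
  nlinarith [not_lt.1 h]

/-- The nonnegativity behind the convexity of the hyperbolic distance. -/
lemma arcoshDivSinh_convexity {C : ℝ} (hC : 1 ≤ C) :
    0 ≤ 2 * arcoshDivSinh C * C - 1 - arcoshDivSinh C ^ 2 := by
  have := arcoshDivSinh_mem hC
  have := arcoshDivSinh_pos hC
  nlinarith

lemma arcoshDivSinh_cosh_mul_sinh (a : ℝ) : arcoshDivSinh (cosh a) * sinh a = a := by
  wlog ha : 0 ≤ a generalizing a
  · have := this (-a) (by linarith)
    simp only [cosh_neg, sinh_neg] at this
    linarith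
  rcases ha.eq_or_lt with rfl | ha
  · simp
  rw [arcoshDivSinh_of_one_lt (one_lt_cosh.2 ha.ne'), ← sinh_arcosh (one_le_cosh a),
    arcosh_cosh ha.le, div_mul_cancel₀ _ (sinh_pos_iff.2 ha).ne']

lemma hasDerivAt_arcoshDivSinh {C : ℝ} (hC : 1 < C) :
    HasDerivAt arcoshDivSinh ((1 - arcoshDivSinh C * C) / (C ^ 2 - 1)) C := by
  have hpos : 0 < C ^ 2 - 1 := by nlinarith
  have hs : 0 < √(C ^ 2 - 1) := sqrt_pos.2 hpos
  have h1 : HasDerivAt (fun C : ℝ => C ^ 2 - 1) (2 * C) C := by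
    simpa using (hasDerivAt_pow 2 C).sub_const 1
  have h := (hasDerivAt_arcosh (mem_Ioi.2 hC)).div (h1.sqrt hpos.ne') hs.ne'
  have heq : arcoshDivSinh =ᶠ[nhds C] fun C => arcosh C / √(C ^ 2 - 1) := by
    filter_upwards [lt_mem_nhds hC] with t ht using arcoshDivSinh_of_one_lt ht
  refine (h.congr_of_eventuallyEq heq).congr_deriv ?_
  rw [arcoshDivSinh_of_one_lt hC]
  have hsq := sq_sqrt hpos.le
  set s := √(C ^ 2 - 1)
  rw [← hsq]
  field_simp

lemma abs_sub_arcoshDivSinh_le_of_lt {C C' : ℝ} (hC : 1 < C) (hC' : 1 < C') :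
    |arcoshDivSinh C' - arcoshDivSinh C| ≤ |C' - C| := by
  have := (convex_Ioi (1 : ℝ)).norm_image_sub_le_of_norm_hasDerivWithin_le (C := 1)
    (fun t ht => (hasDerivAt_arcoshDivSinh (mem_Ioi.1 ht)).hasDerivWithinAt) ?_
    (mem_Ioi.2 hC) (mem_Ioi.2 hC')
  · simpa using this
  · intro t ht
    have ht : 1 < t := ht
    have hm := arcoshDivSinh_mem ht.le
    have hp : 0 < t ^ 2 - 1 := by nlinarith
    rw [norm_eq_abs, abs_div, abs_of_pos hp, div_le_one hp, abs_le]
    constructor <;> nlinarith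

lemma abs_sub_arcoshDivSinh_le {C C' : ℝ} (hC : 1 ≤ C) (hC' : 1 ≤ C') :
    |arcoshDivSinh C' - arcoshDivSinh C| ≤ |C' - C| := by
  have key : ∀ t, 1 < t → |arcoshDivSinh t - 1| ≤ |t - 1| := by
    intro t ht
    have hm := arcoshDivSinh_mem ht.le
    have hp := arcoshDivSinh_pos ht.le
    rw [abs_of_pos (by linarith : 0 < t - 1), abs_le]
    constructor <;> nlinarith
  rcases hC.eq_or_lt with rfl | hC <;> rcases hC'.eq_or_lt with rfl | hC'
  · simp
  · simpa [arcoshDivSinh_one] using key _ hC'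
  · rw [abs_sub_comm, abs_sub_comm 1 C]
    simpa [arcoshDivSinh_one] using key _ hC
  · exact abs_sub_arcoshDivSinh_le_of_lt hC hC'

/-- The extension by `1` below `C = 1` is composition with `max · 1`, so the bound on `[1, ∞)` is
inherited. -/
lemma lipschitzWith_arcoshDivSinh : LipschitzWith 1 arcoshDivSinh := by
  refine LipschitzWith.of_dist_le_mul fun C C' => ?_
  have h : ∀ t, arcoshDivSinh t = arcoshDivSinh (max t 1) := by
    intro t
    rcases le_total t 1 with ht | ht
    · rw [max_eq_right ht, arcoshDivSinh_one]; simp [arcoshDivSinh, ht]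
    · rw [max_eq_left ht]
  rw [dist_eq, dist_eq, h C, h C']
  refine (abs_sub_arcoshDivSinh_le (le_max_right _ _) (le_max_right _ _)).trans ?_
  simpa using abs_max_sub_max_le_abs C C' 1

/-! ### The geodesic inequality in the upper half plane -/

/-- `cosh` of the hyperbolic distance of two points in the upper half plane with logarithmic
height difference `a` and horizontal difference `w`, scaled by the height of the first point. -/
def coshDist (a w : ℝ) : ℝ := cosh a + exp (-a) * w ^ 2 / 2

/-- The vertical component of `sinh d` times the unit vector pointing from the first point to the
second. -/
def vertDir (a w : ℝ) : ℝ := sinh a + exp (-a) * w ^ 2 / 2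

lemma one_le_coshDist (a w : ℝ) : 1 ≤ coshDist a w := by
  have := one_le_cosh a
  have := exp_pos (-a)
  unfold coshDist
  have : 0 ≤ exp (-a) * w ^ 2 / 2 := by positivity
  linarith

lemma coshDist_sq_sub_one (a w : ℝ) :
    coshDist a w ^ 2 - 1 = vertDir a w ^ 2 + (exp (-a) * w) ^ 2 := by
  have h : exp a * exp (-a) = 1 := by rw [← exp_add]; simp
  simp only [coshDist, vertDir, cosh_eq, sinh_eq]
  linear_combination h

lemma coshDist_eq_one {a w : ℝ} (h : coshDist a w = 1) : a = 0 ∧ w = 0 := by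
  have h1 := one_le_cosh a
  have h2 := exp_pos (-a)
  unfold coshDist at h
  have h3 : 0 ≤ exp (-a) * w ^ 2 / 2 := by positivity
  constructor
  · by_contra ha
    have := one_lt_cosh.2 ha
    linarith
  · have : exp (-a) * w ^ 2 = 0 := by linarith
    rcases mul_eq_zero.1 this with h | h
    · exact absurd h h2.ne'
    · simpa using h

/-- The vertical component of the initial velocity of the geodesic, minus the logarithmic height
difference. -/
def vertExcess (a w : ℝ) : ℝ := arcoshDivSinh (coshDist a w) * vertDir a w - a

/-- Two points at the same horizontal position are joined by a vertical geodesic, whose logarithmic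
height has constant speed. This confines `vertExcess` to the support of `y`. -/
lemma vertExcess_zero_right (a : ℝ) : vertExcess a 0 = 0 := by
  simp [vertExcess, coshDist, vertDir, arcoshDivSinh_cosh_mul_sinh]

lemma abs_vertDir_le (a w : ℝ) : |vertDir a w| ≤ coshDist a w := by
  apply abs_le_of_sq_le_sq _ (by linarith [one_le_coshDist a w])
  have := coshDist_sq_sub_one a w
  nlinarith [sq_nonneg (exp (-a) * w)]

/-- The bound is quadratic in `w`: the difference to the vertical case `w = 0` is controlled by the
Lipschitz bound for `F`, and `coshDist a w - cosh a` is itself `e^{-a} w² / 2`. The resulting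
doubled decay rate is needed for the flux along `∇ log ρ`. -/
lemma abs_vertExcess_le (a w : ℝ) :
    |vertExcess a w| ≤ exp (-a) * w ^ 2 / 2 * (1 + coshDist a w) := by
  have h0 : 0 ≤ exp (-a) * w ^ 2 / 2 := by have := exp_pos (-a); positivity
  have hd : vertExcess a w = (arcoshDivSinh (coshDist a w) - arcoshDivSinh (cosh a)) * vertDir a w
      + arcoshDivSinh (cosh a) * (exp (-a) * w ^ 2 / 2) := by
    have := arcoshDivSinh_cosh_mul_sinh a
    simp only [vertExcess, vertDir]
    linear_combination this
  have h1 : |arcoshDivSinh (coshDist a w) - arcoshDivSinh (cosh a)| ≤ exp (-a) * w ^ 2 / 2 := by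
    refine (abs_sub_arcoshDivSinh_le (one_le_cosh a) (one_le_coshDist a w)).trans ?_
    simp only [coshDist, add_sub_cancel_left]
    rw [abs_of_nonneg h0]
  have h2 := (arcoshDivSinh_mem (one_le_cosh a)).2
  have h3 := (arcoshDivSinh_pos (one_le_cosh a)).le
  rw [hd]
  refine (abs_add_le _ _).trans ?_
  rw [abs_mul, abs_mul, abs_of_nonneg h3, abs_of_nonneg h0]
  have := mul_le_mul h1 (abs_vertDir_le a w) (abs_nonneg _) h0
  nlinarith

/-- The derivative of `arcoshDivSinh ∘ C` for a function `C ≥ 1`; at a minimum `C = 1` it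
vanishes. -/
lemma hasFDerivAt_arcoshDivSinh_comp {E : Type*} [NormedAddCommGroup E] [NormedSpace ℝ E]
    {C : E → ℝ} {C' : E →L[ℝ] ℝ} {x : E} (h : HasFDerivAt C C' x) (hC : ∀ y, 1 ≤ C y) :
    HasFDerivAt (fun y => arcoshDivSinh (C y))
      (((1 - arcoshDivSinh (C x) * C x) / (C x ^ 2 - 1)) • C') x := by
  rcases (hC x).eq_or_lt with h1 | h1
  -- At `C x = 1` the slope reads `0 / 0 = 0`, and the extended `F` has a corner. The chain rule
  -- survives because `C` is minimal there: its derivative vanishes, and the Lipschitz bound makes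
  -- the increment of `F ∘ C` negligible.
  · have hmin : IsLocalMin C x := by
      filter_upwards with y
      rw [← h1]; exact hC y
    have h0 : C' = 0 := hmin.hasFDerivAt_eq_zero h
    subst h0
    rw [smul_zero]
    rw [hasFDerivAt_iff_isLittleO] at h ⊢
    refine Asymptotics.IsLittleO.of_norm_left ?_
    refine Asymptotics.IsBigO.trans_isLittleO ?_ h
    refine Asymptotics.IsBigO.of_bound 1 (Filter.Eventually.of_forall fun y => ?_)
    simpa using abs_sub_arcoshDivSinh_le (hC x) (hC y)
  · exact (hasDerivAt_arcoshDivSinh h1).comp_hasFDerivAt x h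

/-- The rate of change of `coshDist` under a change `c` of the logarithmic height difference and
`f - a * w` of the scaled horizontal difference. -/
def coshDistRate (α w a c f : ℝ) : ℝ :=
  sinh α * c - exp (-α) * c * w ^ 2 / 2 + exp (-α) * w * (f - a * w)

/-- The rate of change of `vertDir`. -/
def vertDirRate (α w a c f : ℝ) : ℝ :=
  cosh α * c - exp (-α) * c * w ^ 2 / 2 + exp (-α) * w * (f - a * w)

/-- The derivative of `arcoshDivSinh` at `coshDist α w`. -/
def arcoshDivSinhSlope (α w : ℝ) : ℝ :=
  (1 - arcoshDivSinh (coshDist α w) * coshDist α w) / (coshDist α w ^ 2 - 1)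

/-- The rate of change of `vertExcess`. -/
def vertExcessRate (α w a c f : ℝ) : ℝ :=
  arcoshDivSinhSlope α w * coshDistRate α w a c f * vertDir α w
    + arcoshDivSinh (coshDist α w) * vertDirRate α w a c f - c

/-- The rate of change of the horizontal component of the initial velocity of the geodesic when the
scale is parallel transported. -/
def horizVelRate (α w a c f : ℝ) : ℝ :=
  arcoshDivSinhSlope α w * coshDistRate α w a c f * (exp (-α) * w)
    + arcoshDivSinh (coshDist α w) * (exp (-α) * (f - c * w))

/-- The second order part of the energy of a map into the upper half plane, after subtraction of
the first variation in the direction of the geodesics. -/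
def energyExcess (α w a b c f : ℝ) : ℝ :=
  c ^ 2 + exp (-α) ^ 2 * (b + f) ^ 2 - b ^ 2 + 2 * b ^ 2 * (α + vertExcess α w)
    - 2 * a * vertExcessRate α w a c f - 2 * b * horizVelRate α w a c f

/-- Here `e = e^{-α}`, `F = d / sinh d` and `k` is the slope of `F`. The left side is `sinh² d`
times the energy excess in one direction. On the right, the first square is the squared derivative
of `cosh d`; the second compares the components of the derivatives of the two maps normal to the
geodesic, at its two ends; the last term carries the convexity factor `2 d coth d - 1 - F²`. -/
lemma geodesic_identity {e w F k a b c f : ℝ} (he : e ≠ 0)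
    (hk : k * (((e⁻¹ + e) / 2 + e * w ^ 2 / 2) ^ 2 - 1)
      = 1 - F * ((e⁻¹ + e) / 2 + e * w ^ 2 / 2)) :
    (((e⁻¹ + e) / 2 + e * w ^ 2 / 2) ^ 2 - 1) *
      (c ^ 2 + e ^ 2 * (b + f) ^ 2 - b ^ 2
        + 2 * b ^ 2 * (F * ((e⁻¹ - e) / 2 + e * w ^ 2 / 2))
        - 2 * a * (k * ((e⁻¹ - e) / 2 * c - e * c * w ^ 2 / 2 + e * w * (f - a * w))
            * ((e⁻¹ - e) / 2 + e * w ^ 2 / 2)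
          + F * ((e⁻¹ + e) / 2 * c - e * c * w ^ 2 / 2 + e * w * (f - a * w)) - c)
        - 2 * b * (k * ((e⁻¹ - e) / 2 * c - e * c * w ^ 2 / 2 + e * w * (f - a * w)) * (e * w)
          + F * (e * (f - c * w))))
    = ((e⁻¹ - e) / 2 * c - e * c * w ^ 2 / 2 + e * w * (f - a * w)) ^ 2
      + (e * (b + f) * ((e⁻¹ - e) / 2 - e * w ^ 2 / 2) - (a + c) * w
          - F * (b * ((e⁻¹ - e) / 2 + e * w ^ 2 / 2) - a * (e * w))) ^ 2
      + (2 * F * ((e⁻¹ + e) / 2 + e * w ^ 2 / 2) - 1 - F ^ 2)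
          * (b * ((e⁻¹ - e) / 2 + e * w ^ 2 / 2) - a * (e * w)) ^ 2 := by
  -- The coefficient collects what multiplies `k` in the bracket, so that `hk` trades `k * sinh² d`
  -- for `1 - F * cosh d`. What is left is a rational identity in `e`.
  linear_combination (norm := skip)
    (-(2 * a * ((e⁻¹ - e) / 2 * c - e * c * w ^ 2 / 2 + e * w * (f - a * w))
            * ((e⁻¹ - e) / 2 + e * w ^ 2 / 2))
      - 2 * b * ((e⁻¹ - e) / 2 * c - e * c * w ^ 2 / 2 + e * w * (f - a * w)) * (e * w)) * hk
  field_simp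
  ring

/-- For `d > 0` one divides the geodesic identity by `sinh² d`, all three terms on its right being
nonnegative. For `d = 0` the two points coincide, the excess is `c² + f²` and the rate of `cosh d`
is zero. -/
lemma energyExcess_ge (α w a b c f : ℝ) :
    0 ≤ energyExcess α w a b c f ∧
    coshDistRate α w a c f ^ 2 ≤ (coshDist α w ^ 2 - 1) * energyExcess α w a b c f := by
  rcases (one_le_coshDist α w).eq_or_lt with h1 | h1
  · obtain ⟨rfl, rfl⟩ := coshDist_eq_one h1.symm
    have : energyExcess 0 0 a b c f = c ^ 2 + f ^ 2 := by
      simp only [energyExcess, vertExcess_zero_right, vertExcessRate, horizVelRate, coshDistRate,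
        vertDirRate, vertDir, ← h1, arcoshDivSinh_one]
      simp
      ring
    rw [this, ← h1]
    simp [coshDistRate]
    positivity
  have hp : 0 < coshDist α w ^ 2 - 1 := by nlinarith
  have hk : arcoshDivSinhSlope α w * (coshDist α w ^ 2 - 1)
      = 1 - arcoshDivSinh (coshDist α w) * coshDist α w := div_mul_cancel₀ _ hp.ne'
  have hF := arcoshDivSinh_convexity h1.le
  have hcosh : cosh α = ((exp (-α))⁻¹ + exp (-α)) / 2 := by rw [cosh_eq, exp_neg, inv_inv]
  have hsinh : sinh α = ((exp (-α))⁻¹ - exp (-α)) / 2 := by rw [sinh_eq, exp_neg, inv_inv]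
  have key : (coshDist α w ^ 2 - 1) * energyExcess α w a b c f = coshDistRate α w a c f ^ 2
      + (exp (-α) * (b + f) * (sinh α - exp (-α) * w ^ 2 / 2) - (a + c) * w
        - arcoshDivSinh (coshDist α w) * (b * vertDir α w - a * (exp (-α) * w))) ^ 2
      + (2 * arcoshDivSinh (coshDist α w) * coshDist α w - 1 - arcoshDivSinh (coshDist α w) ^ 2)
        * (b * vertDir α w - a * (exp (-α) * w)) ^ 2 := by
    generalize hFF : arcoshDivSinh (coshDist α w) = F at hk hF
    generalize hkk : arcoshDivSinhSlope α w = k at hk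
    simp only [coshDist, hcosh] at hk
    have := geodesic_identity (a := a) (b := b) (c := c) (f := f) (exp_pos (-α)).ne' hk
    simp only [energyExcess, vertExcess, vertExcessRate, horizVelRate, hFF, hkk]
    simp only [coshDist, coshDistRate, vertDirRate, vertDir, hcosh, hsinh]
    linear_combination this
  have h2 : coshDistRate α w a c f ^ 2 ≤ (coshDist α w ^ 2 - 1) * energyExcess α w a b c f := by
    rw [key]
    have := mul_nonneg hF (sq_nonneg (b * vertDir α w - a * (exp (-α) * w)))
    nlinarith [sq_nonneg (exp (-α) * (b + f) * (sinh α - exp (-α) * w ^ 2 / 2) - (a + c) * w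
        - arcoshDivSinh (coshDist α w) * (b * vertDir α w - a * (exp (-α) * w)))]
  refine ⟨?_, h2⟩
  have := (sq_nonneg _).trans h2
  exact nonneg_of_mul_nonneg_right this hp

/-! ### Locally Lipschitz functions -/

section LocallyLipschitz

set_option linter.unusedSectionVars false

variable {E : Type*} [NormedAddCommGroup E] [NormedSpace ℝ E]

/-- A pointwise version of `LocallyLipschitz`. -/
def LipschitzNear (f : E → ℝ) (x : E) : Prop := ∃ K, ∃ t ∈ 𝓝 x, LipschitzOnWith K f t

lemma LipschitzNear.congr {f g : E → ℝ} {x : E} (hf : LipschitzNear f x) (h : g =ᶠ[𝓝 x] f) :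
    LipschitzNear g x := by
  obtain ⟨K, t, ht, hK⟩ := hf
  refine ⟨K, t ∩ {y | g y = f y}, Filter.inter_mem ht h, fun y hy z hz => ?_⟩
  rw [hy.2, hz.2]
  exact hK hy.1 hz.1

lemma LipschitzNear.of_eventually_eq_zero {g : E → ℝ} {x : E} (h : ∀ᶠ y in 𝓝 x, g y = 0) :
    LipschitzNear g x :=
  LipschitzNear.congr (f := fun _ => 0) ⟨0, univ, Filter.univ_mem, (LipschitzWith.const 0).lipschitzOnWith⟩ h

lemma _root_.ContDiffAt.lipschitzNear {f : E → ℝ} {x : E} (hf : ContDiffAt ℝ 1 f x) :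
    LipschitzNear f x := hf.exists_lipschitzOnWith

lemma LipschitzNear.mul {f g : E → ℝ} {x : E} (hf : LipschitzNear f x) (hg : LipschitzNear g x) :
    LipschitzNear (fun y => f y * g y) x := by
  obtain ⟨K, t, ht, hK⟩ := hf
  obtain ⟨K', t', ht', hK'⟩ := hg
  have hm : LocallyLipschitz (fun p : ℝ × ℝ => p.1 * p.2) :=
    ContDiff.locallyLipschitz (𝕂 := ℝ) (by fun_prop)
  obtain ⟨M, s, hs, hM⟩ := hm (f x, g x)
  have hc : ContinuousAt (fun y => (f y, g y)) x :=
    (hK.continuousOn.continuousAt ht).prodMk (hK'.continuousOn.continuousAt ht')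
  refine ⟨M * max K K', t ∩ t' ∩ (fun y => (f y, g y)) ⁻¹' s,
    Filter.inter_mem (Filter.inter_mem ht ht') (hc hs), ?_⟩
  exact hM.comp ((hK.mono fun y hy => hy.1.1).prodMk (hK'.mono fun y hy => hy.1.2))
    fun y hy => hy.2

lemma _root_.LocallyLipschitz.mul_real {f g : E → ℝ} (hf : LocallyLipschitz f)
    (hg : LocallyLipschitz g) : LocallyLipschitz (fun y => f y * g y) :=
  fun x => LipschitzNear.mul (hf x) (hg x)

/-- The factor `f` may be singular outside `U`: there the product is locally zero. -/
lemma LipschitzNear.mul_of_tsupport_subset {f g : E → ℝ} {U : Set E} (hU : IsOpen U)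
    (hg : LocallyLipschitz g) (hf : ContDiffOn ℝ 1 f U) (hs : tsupport g ⊆ U) :
    LocallyLipschitz (fun y => g y * f y) := by
  intro x
  by_cases hx : x ∈ tsupport g
  · exact LipschitzNear.mul (hg x) (hf.contDiffAt (hU.mem_nhds (hs hx))).lipschitzNear
  · refine LipschitzNear.of_eventually_eq_zero ?_
    filter_upwards [notMem_tsupport_iff_eventuallyEq.1 hx] with y hy
    simp [hy]

/-- On a ball reaching one unit beyond the support, compactness gives a Lipschitz constant. A point
outside this ball is at distance at least `1` from the support, so there the sup bound serves as a
Lipschitz constant. -/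
lemma exists_lipschitzWith_of_hasCompactSupport [ProperSpace E] {f : E → ℝ}
    (hf : LocallyLipschitz f) (hs : HasCompactSupport f) : ∃ K, LipschitzWith K f := by
  obtain ⟨R, hR⟩ := hs.isCompact.isBounded.subset_closedBall 0
  obtain ⟨K, hK⟩ := LocallyLipschitzOn.exists_lipschitzOnWith_of_compact
    (isCompact_closedBall (0 : E) (R + 1)) hf.locallyLipschitzOn
  obtain ⟨M, hM⟩ := hs.exists_bound_of_continuous hf.continuous
  have hM0 : 0 ≤ M := (norm_nonneg _).trans (hM 0)
  have hz : ∀ x, R < ‖x‖ → f x = 0 := by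
    intro x hx
    by_contra h
    have := hR (subset_tsupport f h)
    simp at this
    linarith
  refine ⟨K + M.toNNReal, LipschitzWith.of_dist_le_mul fun x y => ?_⟩
  have hd : 0 ≤ dist x y := dist_nonneg
  have hKd : 0 ≤ (K : ℝ) * dist x y := by positivity
  have hMd : 0 ≤ M * dist x y := by positivity
  have key : ∀ x y, R + 1 < ‖y‖ → dist (f x) (f y) ≤ M * dist x y := by
    intro x y hy
    rw [hz y (by linarith), dist_zero_right]
    rcases lt_or_ge R ‖x‖ with hx | hx
    · rw [hz x hx]; simp; positivity
    · have : 1 ≤ dist x y := by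
        have := norm_sub_norm_le y x
        rw [dist_comm, dist_eq_norm]; linarith
      nlinarith [hM x]
  push_cast
  rw [Real.coe_toNNReal M hM0, add_mul]
  rcases lt_or_ge (R + 1) ‖y‖ with hy | hy
  · linarith [key x y hy]
  rcases lt_or_ge (R + 1) ‖x‖ with hx | hx
  · have := key y x hx
    rw [dist_comm, dist_comm y x] at this
    linarith
  have := hK.dist_le_mul x (by simpa using hx) y (by simpa using hy)
  linarith

/-- A continuous function whose derivative is bounded off its zero set is Lipschitz. -/
lemma lipschitzWith_of_fderiv_bound_off_zeros {h : E → ℝ} {L : ℝ} (hL : 0 ≤ L)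
    (hc : Continuous h)
    (hd : ∀ x, h x ≠ 0 → DifferentiableAt ℝ h x ∧ ‖fderiv ℝ h x‖ ≤ L) :
    LipschitzWith L.toNNReal h := by
  have key : ∀ x y : E, (∀ t ∈ Ioo (0 : ℝ) 1, h (x + t • (y - x)) ≠ 0) →
      |h y - h x| ≤ L * ‖y - x‖ := by
    intro x y hne
    have hder : ∀ t ∈ Ioo (0 : ℝ) 1, HasDerivAt (fun t : ℝ => h (x + t • (y - x)))
        (fderiv ℝ h (x + t • (y - x)) (y - x)) t := by
      intro t ht
      have h1 : HasDerivAt (fun t : ℝ => x + t • (y - x)) (y - x) t := by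
        simpa using ((hasDerivAt_id t).smul_const (y - x)).const_add x
      exact (hd _ (hne t ht)).1.hasFDerivAt.comp_hasDerivAt t h1
    obtain ⟨t, ht, hslope⟩ := exists_hasDerivAt_eq_slope (fun t : ℝ => h (x + t • (y - x)))
      (fun t => fderiv ℝ h (x + t • (y - x)) (y - x)) zero_lt_one
      (by fun_prop) hder
    have hs : h y - h x = fderiv ℝ h (x + t • (y - x)) (y - x) := by
      rw [hslope]; simp
    rw [hs, ← norm_eq_abs]
    exact (ContinuousLinearMap.le_opNorm _ _).trans
      (mul_le_mul_of_nonneg_right (hd _ (hne t ht)).2 (norm_nonneg _))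
  have key0 : ∀ x p : E, h p = 0 → |h x| ≤ L * ‖p - x‖ := by
    intro x p hp
    have hcont : Continuous fun t : ℝ => h (x + t • (p - x)) := by fun_prop
    have hcomp : IsCompact (Icc (0 : ℝ) 1 ∩ {t | h (x + t • (p - x)) = 0}) :=
      isCompact_Icc.inter_right (isClosed_eq hcont continuous_const)
    -- `T` is the parameter of the first zero on the segment from `x` to `p`; before it the mean
    -- value estimate `key` applies.
    obtain ⟨T, ⟨hT, hT0⟩, hmin⟩ := hcomp.exists_isLeast ⟨1, by simp, by simp [hp]⟩
    rcases hT.1.eq_or_lt with h | hTp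
    · subst h
      have : h x = 0 := by simpa using hT0
      rw [this, abs_zero]
      positivity
    have := key x (x + T • (p - x)) ?_
    · rw [hT0] at this
      simp only [zero_sub, abs_neg, add_sub_cancel_left, norm_smul, norm_eq_abs,
        abs_of_nonneg hT.1] at this
      refine this.trans ?_
      have h1 := hT.2
      gcongr
      exact mul_le_of_le_one_left (norm_nonneg _) h1
    · intro t ht h0
      rw [add_sub_cancel_left, smul_smul] at h0
      have h2 : T ≤ t * T := hmin
        ⟨⟨mul_nonneg ht.1.le hT.1, mul_le_one₀ ht.2.le hT.1 hT.2⟩, h0⟩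
      nlinarith [ht.2]
  refine LipschitzWith.of_dist_le_mul fun x y => ?_
  rw [Real.coe_toNNReal L hL, dist_eq_norm', dist_eq_norm', norm_eq_abs]
  by_cases hz : ∀ t ∈ Ioo (0 : ℝ) 1, h (x + t • (y - x)) ≠ 0
  · exact key x y hz
  push Not at hz
  obtain ⟨t, ht, h0⟩ := hz
  have h1 := key0 x _ h0
  have h2 := key0 y _ h0
  have e1 : x + t • (y - x) - x = t • (y - x) := by abel
  have e2 : x + t • (y - x) - y = -((1 - t) • (y - x)) := by module
  rw [e1, norm_smul, norm_eq_abs, abs_of_pos ht.1] at h1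
  rw [e2, norm_neg, norm_smul, norm_eq_abs, abs_of_pos (sub_pos.2 ht.2)] at h2
  calc |h y - h x| ≤ |h y| + |h x| := abs_sub _ _
    _ ≤ L * ((1 - t) * ‖y - x‖) + L * (t * ‖y - x‖) := add_le_add h2 h1
    _ = L * ‖y - x‖ := by ring

lemma hasCompactSupport_fderiv_apply {k : E → ℝ} (hs : HasCompactSupport k) (v : E) :
    HasCompactSupport (fun x => fderiv ℝ k x v) :=
  (hs.fderiv (𝕜 := ℝ)).comp_left (g := fun L : E →L[ℝ] ℝ => L v) (by simp)

variable [FiniteDimensional ℝ E] [MeasurableSpace E] [BorelSpace E] {μ : Measure E}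
  [μ.IsAddHaarMeasure]

/-- The integral of a directional derivative of a compactly supported Lipschitz function
vanishes. -/
lemma integral_fderiv_eq_zero_of_locallyLipschitz {k : E → ℝ} (hk : LocallyLipschitz k)
    (hs : HasCompactSupport k) (v : E) :
    Integrable (fun x => fderiv ℝ k x v) μ ∧ ∫ x, fderiv ℝ k x v ∂μ = 0 := by
  have : ProperSpace E := FiniteDimensional.proper_real E
  obtain ⟨K, hK⟩ := exists_lipschitzWith_of_hasCompactSupport hk hs
  constructor
  · have hcs := hasCompactSupport_fderiv_apply hs v
    have hon : IntegrableOn (fun x => fderiv ℝ k x v) (tsupport fun x => fderiv ℝ k x v) μ := by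
      refine Measure.integrableOn_of_bounded (M := K * ‖v‖) hcs.isCompact.measure_lt_top.ne
        (measurable_fderiv_apply_const ℝ k v).aestronglyMeasurable (ae_of_all _ fun x => ?_)
      exact (ContinuousLinearMap.le_opNorm _ _).trans
        (mul_le_mul_of_nonneg_right (norm_fderiv_le_of_lipschitz ℝ hK) (norm_nonneg _))
    exact (integrableOn_iff_integrable_of_support_subset (subset_tsupport _)).1 hon
  -- Integration by parts against the constant function `1`; the direction `-v` absorbs the sign in
  -- that formula.
  · have h := LipschitzWith.integral_lineDeriv_mul_eq (μ := μ) (LipschitzWith.const (α := E) (1 : ℝ))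
      hK hs (-v)
    have h0 : ∀ x, lineDeriv ℝ (fun _ : E => (1 : ℝ)) x (-v) = 0 := fun x => by simp [lineDeriv]
    simp only [neg_neg, mul_one, h0] at h
    rw [← integral_congr_ae (f := fun x => lineDeriv ℝ k x v)]
    · simpa using h.symm
    · filter_upwards [hK.ae_differentiableAt (μ := μ)] with x hx
      exact hx.lineDeriv_eq_fderiv

end LocallyLipschitz

/-! ### Geometry of the cylindrical coordinates -/

lemma norm_sq_eq (x : E3) : ‖x‖ ^ 2 = x 0 ^ 2 + x 1 ^ 2 + x 2 ^ 2 := by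
  rw [EuclideanSpace.norm_sq_eq, Fin.sum_univ_three]; simp

lemma rho_sq (x : E3) : rho x ^ 2 = x 0 ^ 2 + x 1 ^ 2 := sq_sqrt (by positivity)

lemma rho_nonneg (x : E3) : 0 ≤ rho x := sqrt_nonneg _

lemma rho_sq_eq (x : E3) : rho x ^ 2 = ‖x‖ ^ 2 - x 2 ^ 2 := by
  rw [rho_sq, norm_sq_eq]; ring

lemma rad_eq (x : E3) : rad x = ‖x‖ := by
  rw [rad, rho_sq, zed, ← norm_sq_eq, sqrt_sq (norm_nonneg x)]

lemma rho_le_norm (x : E3) : rho x ≤ ‖x‖ :=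
  abs_le_of_sq_le_sq' (by rw [rho_sq_eq]; nlinarith [sq_nonneg (x 2)]) (norm_nonneg x) |>.2

lemma abs_zed_le_norm (x : E3) : |x 2| ≤ ‖x‖ :=
  abs_le_of_sq_le_sq (by nlinarith [rho_sq_eq x, sq_nonneg (rho x)]) (norm_nonneg x)

lemma norm_pos_of_rho_pos {x : E3} (h : 0 < rho x) : 0 < ‖x‖ := h.trans_le (rho_le_norm x)

lemma continuous_rho : Continuous rho := by unfold rho; fun_prop

lemma sigma_sq (x : E3) : sigma x ^ 2 = ‖x‖ ^ 2 + 1 := by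
  rw [sigma, rad_eq, sq_sqrt (by positivity)]

lemma sigma_pos (x : E3) : 0 < sigma x := sqrt_pos.2 (by positivity)

lemma one_le_sigma (x : E3) : 1 ≤ sigma x := by
  have := sigma_sq x
  nlinarith [sigma_pos x, sq_nonneg ‖x‖]

lemma norm_le_sigma (x : E3) : ‖x‖ ≤ sigma x :=
  (abs_le_of_sq_le_sq' (by rw [sigma_sq]; linarith) (sigma_pos x).le).2

lemma eq_smul_eRho_add (x : E3) : x = rho x • eRho x + x 2 • eZed := by
  rcases (rho_nonneg x).eq_or_lt with h | h
  · have h0 := rho_sq x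
    rw [← h] at h0
    have h1 : x 0 = 0 := by nlinarith [sq_nonneg (x 0), sq_nonneg (x 1)]
    have h2 : x 1 = 0 := by nlinarith [sq_nonneg (x 0), sq_nonneg (x 1)]
    ext i; fin_cases i <;> simp [eRho, eZed, h1, h2]
  · ext i; fin_cases i <;> simp [eRho, eZed] <;> field_simp

lemma fderiv_self_eq (g : E3 → ℝ) (x : E3) :
    fderiv ℝ g x x = rho x * dRho g x + x 2 * dZed g x := by
  have h := congrArg (fderiv ℝ g x) (eq_smul_eRho_add x)
  rwa [map_add, map_smul, map_smul] at h

lemma inner_eRho {x : E3} (hx : 0 < rho x) : inner ℝ x (eRho x) = rho x := by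
  have h := rho_sq x
  rw [PiLp.inner_apply, Fin.sum_univ_three]
  simp only [eRho, RCLike.inner_apply, conj_trivial]
  simp
  field_simp
  linarith

lemma inner_eZed (x : E3) : inner ℝ x eZed = x 2 := by
  rw [PiLp.inner_apply, Fin.sum_univ_three]
  simp [eZed]

/-! ### The divergence theorem for fields in the span of `x` and `∂/∂z` -/

/-- The divergence of the field `P x + Q ∂/∂z`. -/
def fieldDiv (P Q : E3 → ℝ) (x : E3) : ℝ := fderiv ℝ P x x + 3 * P x + fderiv ℝ Q x eZed

lemma sum_single_eq (x : E3) : ∑ i, x i • EuclideanSpace.single i (1 : ℝ) = x := by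
  ext j
  simp [Pi.single_apply]

/-- The gradient of a smooth function of `r` and `z` lies in the span of `x` and `∂/∂z`, which
avoids the frame vector `∂/∂ρ`, discontinuous on the axis. Each `g P xᵢ` and `g Q` is Lipschitz with
compact support, so its directional derivatives integrate to zero; the product rule holds almost
everywhere by Rademacher's theorem. -/
lemma integral_field_eq_zero {g P Q : E3 → ℝ} {U : Set E3} (hU : IsOpen U)
    (hg : LocallyLipschitz g) (hs : HasCompactSupport g) (hsU : tsupport g ⊆ U)
    (hP : ContDiffOn ℝ 1 P U) (hQ : ContDiffOn ℝ 1 Q U) :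
    Integrable (fun x => P x * fderiv ℝ g x x + Q x * fderiv ℝ g x eZed + g x * fieldDiv P Q x) ∧
      ∫ x, (P x * fderiv ℝ g x x + Q x * fderiv ℝ g x eZed + g x * fieldDiv P Q x) = 0 := by
  have hPx : ∀ i : Fin 3, ContDiffOn ℝ 1 (fun x : E3 => P x * x i) U := fun i => by fun_prop
  have h1 : ∀ i : Fin 3, LocallyLipschitz (fun x : E3 => g x * (P x * x i)) := fun i =>
    LipschitzNear.mul_of_tsupport_subset hU hg (hPx i) hsU
  have h2 : LocallyLipschitz (fun x : E3 => g x * Q x) :=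
    LipschitzNear.mul_of_tsupport_subset hU hg hQ hsU
  have h3 := fun i : Fin 3 => integral_fderiv_eq_zero_of_locallyLipschitz (μ := volume) (h1 i)
    (hs.mul_right (f' := fun x : E3 => P x * x i)) (EuclideanSpace.single i (1 : ℝ))
  have h4 := integral_fderiv_eq_zero_of_locallyLipschitz (μ := volume) h2
    (hs.mul_right (f' := Q)) eZed
  obtain ⟨K, hK⟩ := exists_lipschitzWith_of_hasCompactSupport hg hs
  have hae : (fun x => P x * fderiv ℝ g x x + Q x * fderiv ℝ g x eZed + g x * fieldDiv P Q x)
      =ᵐ[volume] fun x => ∑ i : Fin 3, fderiv ℝ (fun x : E3 => g x * (P x * x i)) x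
          (EuclideanSpace.single i (1 : ℝ)) + fderiv ℝ (fun x : E3 => g x * Q x) x eZed := by
    filter_upwards [hK.ae_differentiableAt (μ := volume)] with x hx
    by_cases hxs : x ∈ tsupport g
    · have hxU := hU.mem_nhds (hsU hxs)
      have hP' := ((hP.contDiffAt hxU).differentiableAt (by simp)).hasFDerivAt
      have hQ' := ((hQ.contDiffAt hxU).differentiableAt (by simp)).hasFDerivAt
      have hx' := hx.hasFDerivAt
      have hi : ∀ i : Fin 3, fderiv ℝ (fun x : E3 => g x * (P x * x i)) x
          (EuclideanSpace.single i (1 : ℝ)) = g x * P x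
            + g x * fderiv ℝ P x (x i • EuclideanSpace.single i (1 : ℝ))
            + P x * fderiv ℝ g x (x i • EuclideanSpace.single i (1 : ℝ)) := by
        intro i
        have hxi : HasFDerivAt (fun x : E3 => x i) (EuclideanSpace.proj i : E3 →L[ℝ] ℝ) x :=
          (EuclideanSpace.proj i : E3 →L[ℝ] ℝ).hasFDerivAt
        rw [(hx'.fun_mul (hP'.fun_mul hxi)).fderiv]
        simp
        ring
      have hq : fderiv ℝ (fun x : E3 => g x * Q x) x eZed
          = g x * fderiv ℝ Q x eZed + Q x * fderiv ℝ g x eZed := by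
        rw [(hx'.fun_mul hQ').fderiv]
        simp
      have e1 : ∀ L : E3 →L[ℝ] ℝ, L x = ∑ i, L (x i • EuclideanSpace.single i (1 : ℝ)) := by
        intro L
        rw [← map_sum, sum_single_eq]
      rw [hq, Finset.sum_congr rfl fun i _ => hi i, fieldDiv, e1 (fderiv ℝ P x),
        e1 (fderiv ℝ g x)]
      simp only [Fin.sum_univ_three]
      ring
    · have h0 := notMem_tsupport_iff_eventuallyEq.1 hxs
      have hz : ∀ f : E3 → ℝ, fderiv ℝ (fun x : E3 => g x * f x) x = 0 := by
        intro f
        have : (fun x : E3 => g x * f x) =ᶠ[𝓝 x] fun _ => 0 := by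
          filter_upwards [h0] with y hy
          simp [hy]
        rw [this.fderiv_eq]; simp
      have hgz : fderiv ℝ g x = 0 := by rw [h0.fderiv_eq]; simp
      rw [hz Q, hgz, h0.self_of_nhds, Finset.sum_congr rfl fun i _ => by rw [hz]]
      simp
  have hint : Integrable (fun x => ∑ i : Fin 3, fderiv ℝ (fun x : E3 => g x * (P x * x i)) x
      (EuclideanSpace.single i (1 : ℝ))) := integrable_finsetSum _ fun i _ => (h3 i).1
  refine ⟨(hint.add h4.1).congr hae.symm, ?_⟩
  rw [integral_congr_ae hae, integral_add hint h4.1, h4.2,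
    integral_finsetSum _ fun i _ => (h3 i).1, Finset.sum_congr rfl fun i _ => (h3 i).2]
  simp

/-! ### Null sets -/

lemma ae_rho_pos : ∀ᵐ x : E3, 0 < rho x := by
  let s : Submodule ℝ E3 := LinearMap.ker (EuclideanSpace.proj (0 : Fin 3) : E3 →L[ℝ] ℝ).toLinearMap
  have hs : s ≠ ⊤ := by
    intro h
    have : (!₂[1, 0, 0] : E3) ∈ s := h ▸ Submodule.mem_top
    simp [s] at this
  have h0 := Measure.addHaar_submodule (volume : Measure E3) s hs
  have : ∀ᵐ x : E3, x ∉ (s : Set E3) := measure_eq_zero_iff_ae_notMem.1 h0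
  filter_upwards [this] with x hx
  have hx0 : x 0 ≠ 0 := by simpa [s] using hx
  exact sqrt_pos.2 (by positivity)

lemma rho_smul (t : ℝ) (ht : 0 ≤ t) (x : E3) : rho (t • x) = t * rho x := by
  rw [rho, rho, ← sqrt_sq ht, ← sqrt_mul (by positivity), sqrt_sq ht]
  congr 1
  simp
  ring

lemma rho_eq_norm_map (x : E3) : rho x = ‖(!₂[x 0, x 1] : EuclideanSpace ℝ (Fin 2))‖ := by
  rw [EuclideanSpace.norm_eq, Fin.sum_univ_two]
  simp [rho]

lemma convex_cylinder (ρ₀ : ℝ) : Convex ℝ (cylinder ρ₀) := by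
  intro x hx y hy a b ha hb hab
  simp only [cylinder, mem_ofPred_eq] at *
  have hsplit : (!₂[(a • x + b • y) 0, (a • x + b • y) 1] : EuclideanSpace ℝ (Fin 2))
      = a • !₂[x 0, x 1] + b • !₂[y 0, y 1] := by
    ext i; fin_cases i <;> simp
  rw [rho_eq_norm_map] at hx hy ⊢
  rw [hsplit]
  refine (norm_add_le _ _).trans ?_
  rw [norm_smul, norm_smul, norm_eq_abs, norm_eq_abs, abs_of_nonneg ha, abs_of_nonneg hb]
  calc _ ≤ a * ρ₀ + b * ρ₀ := by gcongr
    _ = ρ₀ := by rw [← add_mul, hab, one_mul]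

/-- The surface `ρ = ρ₀` lies in the frontier of a convex set, which is null: scaling by any `t > 1`
leaves the cylinder. -/
lemma ae_rho_ne {ρ₀ : ℝ} (hρ₀ : 0 < ρ₀) : ∀ᵐ x : E3, rho x ≠ ρ₀ := by
  have h0 := (convex_cylinder ρ₀).addHaar_frontier (volume : Measure E3)
  have := measure_eq_zero_iff_ae_notMem.1 h0
  filter_upwards [this] with x hx hxe
  refine hx ⟨subset_closure hxe.le, fun hint => ?_⟩
  have hc : Filter.Tendsto (fun t : ℝ => t • x) (𝓝[>] 1) (𝓝 x) := by
    have : Continuous fun t : ℝ => t • x := by fun_prop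
    simpa using (this.tendsto 1).mono_left nhdsWithin_le_nhds
  obtain ⟨t, ht1, ht2⟩ := ((hc.eventually (isOpen_interior.mem_nhds hint)).and self_mem_nhdsWithin).exists
  have h2 : t • x ∈ cylinder ρ₀ := interior_subset (show t • x ∈ interior (cylinder ρ₀) from ht1)
  change rho (t • x) ≤ ρ₀ at h2
  have ht2 : 1 < t := ht2
  rw [rho_smul t (by linarith), hxe] at h2
  nlinarith

lemma isClosed_cylinder (ρ₀ : ℝ) : IsClosed (cylinder ρ₀) :=
  isClosed_le continuous_rho continuous_const

/-! ### Integrable functions -/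

lemma integrable_rpow_sigma {γ : ℝ} (hγ : γ < -3) : Integrable (fun x : E3 => sigma x ^ γ) := by
  have h := integrable_rpow_neg_one_add_norm_sq (E := E3) (μ := volume) (r := -γ)
    (by simp; linarith)
  refine h.congr (ae_of_all _ fun x => ?_)
  simp only [neg_neg]
  rw [sigma, rad_eq, add_comm, sqrt_eq_rpow, ← rpow_mul (by positivity)]
  ring_nf

/-- In polar coordinates the Jacobian `r²` cancels the singular factor, leaving a one-dimensional
integral that converges for `γ < -1`. -/
lemma integrable_norm_sq_inv_mul_rpow_sigma {γ : ℝ} (hγ : γ < -1) :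
    Integrable (fun x : E3 => (‖x‖ ^ 2)⁻¹ * sigma x ^ γ) := by
  have h := integrable_rpow_neg_one_add_norm_sq (E := ℝ) (μ := volume) (r := -γ)
    (by simp; linarith)
  have h2 := (integrable_fun_norm_addHaar (E := E3) (volume : Measure E3)
    (f := fun r : ℝ => (r ^ 2)⁻¹ * (1 + r ^ 2) ^ (γ / 2))).2 ?_
  · refine h2.congr (ae_of_all _ fun x => ?_)
    simp only
    rw [sigma, rad_eq, add_comm, sqrt_eq_rpow, ← rpow_mul (by positivity)]
    ring_nf
  · refine h.integrableOn.congr_fun (fun r hr => ?_) measurableSet_Ioi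
    have hr : 0 < r := hr
    simp
    field_simp

lemma integrable_prod_inv_one_add_sq :
    Integrable (fun x : E3 => (1 + x 0 ^ 2)⁻¹ * (1 + x 1 ^ 2)⁻¹ * (1 + x 2 ^ 2)⁻¹) := by
  have h : Integrable (fun x : Fin 3 → ℝ => ∏ i, (1 + x i ^ 2)⁻¹) (volume) :=
    Integrable.fintype_prod (fun _ => integrable_inv_one_add_sq)
  have h2 := (EuclideanSpace.volume_preserving_symm_measurableEquiv_toLp (Fin 3)).integrable_comp_emb
    (MeasurableEquiv.measurableEmbedding _) (g := fun x : Fin 3 → ℝ => ∏ i, (1 + x i ^ 2)⁻¹)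
  refine (h2.2 h).congr (ae_of_all _ fun x => ?_)
  simp [Fin.prod_univ_three]
  ring

/-! ### Rational functions of `r` and `z` describing extreme Kerr -/

/-- The numerator of `X₀ / ρ²`, in terms of `m = √|J|`. -/
def kerrNum (m r z : ℝ) : ℝ := ((r + m) ^ 2 + m ^ 2) ^ 2 - m ^ 2 * (r ^ 2 - z ^ 2)

/-- The denominator of `X₀ / ρ²`. -/
def kerrDen (m r z : ℝ) : ℝ := r ^ 2 * (r + m) ^ 2 + m ^ 2 * z ^ 2

/-- The polynomial governing the angular derivative of `Y₀`. -/
def kerrAng (m r z : ℝ) : ℝ :=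
  r ^ 2 * (3 * (r + m) ^ 4 + (r + m) ^ 2 * m ^ 2) + m ^ 2 * ((r + m) ^ 2 - m ^ 2) * z ^ 2

/-- The coefficient of `x` in `∇v₀`. -/
def gradVx (m r z : ℝ) : ℝ :=
  ((4 * (r + m) * ((r + m) ^ 2 + m ^ 2) - 2 * m ^ 2 * r) / kerrNum m r z
    - 2 * r * (r + m) * (2 * r + m) / kerrDen m r z) / r

/-- The coefficient of `∂/∂z` in `∇v₀`. -/
def gradVz (m r z : ℝ) : ℝ := 2 * m ^ 2 * z / kerrNum m r z - 2 * m ^ 2 * z / kerrDen m r z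

/-- The coefficient of `∂/∂z` in `X₀⁻² ∇Y₀`. -/
def fluxYz (J m r z : ℝ) : ℝ := -2 * J * kerrAng m r z / (r * (r ^ 2 - z ^ 2) * kerrNum m r z ^ 2)

/-- The coefficient of `x` in `X₀⁻² ∇Y₀`. -/
def fluxYx (J m r z : ℝ) : ℝ :=
  4 * J * m ^ 2 * (r + m) * z / (r ^ 2 * kerrNum m r z ^ 2) - fluxYz J m r z * (z / r ^ 2)

/-- The square norm of `X₀⁻¹ ∇Y₀`. -/
def twistSq (m r z : ℝ) : ℝ :=
  4 * m ^ 4 * (r ^ 2 - z ^ 2) *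
    (4 * m ^ 4 * (r + m) ^ 2 * z ^ 2 * (r ^ 2 - z ^ 2) * r ^ 2 + kerrAng m r z ^ 2)
    / (r ^ 4 * kerrDen m r z ^ 2 * kerrNum m r z ^ 2)

section Positivity
variable {m r z : ℝ}

lemma kerrNum_ge (hm : 0 ≤ m) (hr : 0 ≤ r) : (r + m) ^ 4 ≤ kerrNum m r z := by
  unfold kerrNum
  nlinarith [sq_nonneg (m * z), mul_nonneg (mul_nonneg hm hr) (sq_nonneg m), sq_nonneg (m * m),
    mul_nonneg (mul_nonneg hm hr) (sq_nonneg r), sq_nonneg (m * r), sq_nonneg (r * r)]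

lemma kerrDen_ge : r ^ 2 * (r + m) ^ 2 ≤ kerrDen m r z := by
  unfold kerrDen
  nlinarith [sq_nonneg (m * z)]

lemma kerrNum_pos (hm : 0 ≤ m) (hr : 0 < r) : 0 < kerrNum m r z :=
  (by positivity : 0 < (r + m) ^ 4).trans_le (kerrNum_ge hm hr.le)

lemma kerrDen_pos (hm : 0 ≤ m) (hr : 0 < r) : 0 < kerrDen m r z :=
  (by positivity : 0 < r ^ 2 * (r + m) ^ 2).trans_le kerrDen_ge

end Positivity

/-! ### Derivatives along curves -/

section Curves
variable {m J t r' z' : ℝ} {r z : ℝ → ℝ}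

/-- Derivatives are taken along an arbitrary curve in the `(r, z)` plane so that one computation
serves both directions `x` and `∂/∂z` occurring in the divergence. -/
lemma hasDerivAt_kerrNum (hr : HasDerivAt r r' t) (hz : HasDerivAt z z' t) :
    HasDerivAt (fun s => kerrNum m (r s) (z s))
      ((4 * (r t + m) * ((r t + m) ^ 2 + m ^ 2) - 2 * m ^ 2 * r t) * r'
        + 2 * m ^ 2 * z t * z') t := by
  refine (((((hr.add_const m).fun_pow 2).add_const (m ^ 2)).fun_pow 2).fun_sub
    (((hr.fun_pow 2).fun_sub (hz.fun_pow 2)).const_mul (m ^ 2))).congr_deriv ?_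
  push_cast
  ring

lemma hasDerivAt_kerrDen (hr : HasDerivAt r r' t) (hz : HasDerivAt z z' t) :
    HasDerivAt (fun s => kerrDen m (r s) (z s))
      (2 * r t * (r t + m) * (2 * r t + m) * r' + 2 * m ^ 2 * z t * z') t := by
  refine (((hr.fun_pow 2).fun_mul ((hr.add_const m).fun_pow 2)).fun_add
    ((hz.fun_pow 2).const_mul (m ^ 2))).congr_deriv ?_
  push_cast
  ring

lemma hasDerivAt_kerrAng (hr : HasDerivAt r r' t) (hz : HasDerivAt z z' t) :
    HasDerivAt (fun s => kerrAng m (r s) (z s))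
      ((2 * r t * (3 * (r t + m) ^ 4 + (r t + m) ^ 2 * m ^ 2)
        + r t ^ 2 * (12 * (r t + m) ^ 3 + 2 * (r t + m) * m ^ 2)
        + m ^ 2 * (2 * (r t + m)) * z t ^ 2) * r'
        + 2 * m ^ 2 * ((r t + m) ^ 2 - m ^ 2) * z t * z') t := by
  have hR := hr.add_const m
  refine (((hr.fun_pow 2).fun_mul (((hR.fun_pow 4).const_mul 3).fun_add
    ((hR.fun_pow 2).mul_const (m ^ 2)))).fun_add
    ((((hR.fun_pow 2).sub_const (m ^ 2)).const_mul (m ^ 2)).fun_mul (hz.fun_pow 2))).congr_deriv ?_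
  push_cast
  ring

lemma hasDerivAt_gradVx (hr : HasDerivAt r r' t) (hz : HasDerivAt z z' t) (h0 : r t ≠ 0)
    (hN : kerrNum m (r t) (z t) ≠ 0) (hD : kerrDen m (r t) (z t) ≠ 0) :
    HasDerivAt (fun s => gradVx m (r s) (z s))
      (((((12 * (r t + m) ^ 2 + 2 * m ^ 2) * r') * kerrNum m (r t) (z t)
          - (4 * (r t + m) * ((r t + m) ^ 2 + m ^ 2) - 2 * m ^ 2 * r t)
            * ((4 * (r t + m) * ((r t + m) ^ 2 + m ^ 2) - 2 * m ^ 2 * r t) * r'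
              + 2 * m ^ 2 * z t * z')) / kerrNum m (r t) (z t) ^ 2
        - (((12 * r t ^ 2 + 12 * r t * m + 2 * m ^ 2) * r') * kerrDen m (r t) (z t)
          - 2 * r t * (r t + m) * (2 * r t + m)
            * (2 * r t * (r t + m) * (2 * r t + m) * r' + 2 * m ^ 2 * z t * z'))
            / kerrDen m (r t) (z t) ^ 2) / r t - gradVx m (r t) (z t) * r' / r t) t := by
  have hR := hr.add_const m
  have h1 : HasDerivAt (fun s => 4 * (r s + m) * ((r s + m) ^ 2 + m ^ 2) - 2 * m ^ 2 * r s)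
      ((12 * (r t + m) ^ 2 + 2 * m ^ 2) * r') t := by
    refine (((hR.const_mul 4).fun_mul ((hR.fun_pow 2).add_const (m ^ 2))).fun_sub
      (hr.const_mul (2 * m ^ 2))).congr_deriv ?_
    push_cast
    ring
  have h2 : HasDerivAt (fun s => 2 * r s * (r s + m) * (2 * r s + m))
      ((12 * r t ^ 2 + 12 * r t * m + 2 * m ^ 2) * r') t := by
    refine (((hr.const_mul 2).fun_mul hR).fun_mul ((hr.const_mul 2).add_const m)).congr_deriv ?_
    ring
  refine (((h1.fun_div (hasDerivAt_kerrNum hr hz) hN).fun_sub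
    (h2.fun_div (hasDerivAt_kerrDen hr hz) hD)).fun_div hr h0).congr_deriv ?_
  simp only [gradVx]
  field_simp

lemma hasDerivAt_gradVz (hr : HasDerivAt r r' t) (hz : HasDerivAt z z' t)
    (hN : kerrNum m (r t) (z t) ≠ 0) (hD : kerrDen m (r t) (z t) ≠ 0) :
    HasDerivAt (fun s => gradVz m (r s) (z s))
      ((2 * m ^ 2 * z' * kerrNum m (r t) (z t) - 2 * m ^ 2 * z t
          * ((4 * (r t + m) * ((r t + m) ^ 2 + m ^ 2) - 2 * m ^ 2 * r t) * r'
            + 2 * m ^ 2 * z t * z')) / kerrNum m (r t) (z t) ^ 2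
        - (2 * m ^ 2 * z' * kerrDen m (r t) (z t) - 2 * m ^ 2 * z t
          * (2 * r t * (r t + m) * (2 * r t + m) * r' + 2 * m ^ 2 * z t * z'))
          / kerrDen m (r t) (z t) ^ 2) t :=
  ((hz.const_mul (2 * m ^ 2)).fun_div (hasDerivAt_kerrNum hr hz) hN).fun_sub
    ((hz.const_mul (2 * m ^ 2)).fun_div (hasDerivAt_kerrDen hr hz) hD)

lemma hasDerivAt_fluxYz (hr : HasDerivAt r r' t) (hz : HasDerivAt z z' t) (h0 : r t ≠ 0)
    (hq : r t ^ 2 - z t ^ 2 ≠ 0) (hN : kerrNum m (r t) (z t) ≠ 0) :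
    HasDerivAt (fun s => fluxYz J m (r s) (z s))
      (-2 * J * ((2 * r t * (3 * (r t + m) ^ 4 + (r t + m) ^ 2 * m ^ 2)
        + r t ^ 2 * (12 * (r t + m) ^ 3 + 2 * (r t + m) * m ^ 2)
        + m ^ 2 * (2 * (r t + m)) * z t ^ 2) * r'
        + 2 * m ^ 2 * ((r t + m) ^ 2 - m ^ 2) * z t * z')
          / (r t * (r t ^ 2 - z t ^ 2) * kerrNum m (r t) (z t) ^ 2)
        - fluxYz J m (r t) (z t) * (r' / r t + (2 * r t * r' - 2 * z t * z') / (r t ^ 2 - z t ^ 2)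
          + 2 * ((4 * (r t + m) * ((r t + m) ^ 2 + m ^ 2) - 2 * m ^ 2 * r t) * r'
            + 2 * m ^ 2 * z t * z') / kerrNum m (r t) (z t))) t := by
  refine (((hasDerivAt_kerrAng hr hz).const_mul (-2 * J)).fun_div
    ((hr.fun_mul ((hr.fun_pow 2).fun_sub (hz.fun_pow 2))).fun_mul
      ((hasDerivAt_kerrNum (m := m) hr hz).fun_pow 2))
    (mul_ne_zero (mul_ne_zero h0 hq) (pow_ne_zero 2 hN))).congr_deriv ?_
  simp only [fluxYz]
  generalize kerrNum m (r t) (z t) = N at hN ⊢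
  generalize kerrAng m (r t) (z t) = K
  generalize hQ : r t ^ 2 - z t ^ 2 = q at hq ⊢
  field_simp
  ring

lemma hasDerivAt_fluxYx (hr : HasDerivAt r r' t) (hz : HasDerivAt z z' t) (h0 : r t ≠ 0)
    (hN : kerrNum m (r t) (z t) ≠ 0) {d : ℝ}
    (hd : HasDerivAt (fun s => fluxYz J m (r s) (z s)) d t) :
    HasDerivAt (fun s => fluxYx J m (r s) (z s))
      (4 * J * m ^ 2 * (r' * z t + (r t + m) * z') / (r t ^ 2 * kerrNum m (r t) (z t) ^ 2)
        - 4 * J * m ^ 2 * (r t + m) * z t / (r t ^ 2 * kerrNum m (r t) (z t) ^ 2)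
          * (2 * r' / r t + 2 * ((4 * (r t + m) * ((r t + m) ^ 2 + m ^ 2) - 2 * m ^ 2 * r t) * r'
            + 2 * m ^ 2 * z t * z') / kerrNum m (r t) (z t))
        - d * (z t / r t ^ 2)
        - fluxYz J m (r t) (z t) * (z' / r t ^ 2 - 2 * z t * r' / r t ^ 3)) t := by
  refine (((((hr.add_const m).const_mul (4 * J * m ^ 2)).fun_mul hz).fun_div
    ((hr.fun_pow 2).fun_mul ((hasDerivAt_kerrNum (m := m) hr hz).fun_pow 2))
    (mul_ne_zero (pow_ne_zero 2 h0) (pow_ne_zero 2 hN))).fun_sub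
      (hd.fun_mul (hz.fun_div (hr.fun_pow 2) (pow_ne_zero 2 h0)))).congr_deriv ?_
  generalize kerrNum m (r t) (z t) = N at hN ⊢
  field_simp
  ring

end Curves

/-! ### The field equations of extreme Kerr -/

lemma hasDerivAt_norm_line {x : E3} (hx : x ≠ 0) (v : E3) :
    HasDerivAt (fun t : ℝ => ‖x + t • v‖) (inner ℝ x v / ‖x‖) 0 := by
  have h1 : HasDerivAt (fun t : ℝ => x + t • v) v 0 := by
    simpa using ((hasDerivAt_id (0 : ℝ)).smul_const v).const_add x
  have h2 := h1.norm_sq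
  have hx' : 0 < ‖x‖ := norm_pos_iff.2 hx
  have h3 := h2.sqrt (by simp [hx])
  simp only [zero_smul, add_zero, sqrt_sq (norm_nonneg _)] at h3
  refine h3.congr_deriv ?_
  field_simp

lemma hasDerivAt_coord_line (x v : E3) (i : Fin 3) :
    HasDerivAt (fun t : ℝ => (x + t • v) i) (v i) 0 := by
  simpa using ((hasDerivAt_id (0 : ℝ)).mul_const (v i)).const_add (x i)

lemma fderiv_eq_of_hasDerivAt_line {f : E3 → ℝ} {x v : E3} {d : ℝ} (hf : DifferentiableAt ℝ f x)
    (hd : HasDerivAt (fun t : ℝ => f (x + t • v)) d 0) : fderiv ℝ f x v = d := by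
  rw [← hf.lineDeriv_eq_fderiv]
  exact hd.deriv

section Smooth
variable {m J : ℝ}

lemma contDiffAt_kerrNum {x : E3} (hx : x ≠ 0) :
    ContDiffAt ℝ 1 (fun x : E3 => kerrNum m ‖x‖ (x 2)) x := by
  have := contDiffAt_norm ℝ (n := 1) hx
  unfold kerrNum
  fun_prop

lemma contDiffAt_kerrDen {x : E3} (hx : x ≠ 0) :
    ContDiffAt ℝ 1 (fun x : E3 => kerrDen m ‖x‖ (x 2)) x := by
  have := contDiffAt_norm ℝ (n := 1) hx
  unfold kerrDen
  fun_prop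

lemma contDiffAt_kerrAng {x : E3} (hx : x ≠ 0) :
    ContDiffAt ℝ 1 (fun x : E3 => kerrAng m ‖x‖ (x 2)) x := by
  have := contDiffAt_norm ℝ (n := 1) hx
  unfold kerrAng
  fun_prop

lemma contDiffAt_gradVx (hm : 0 ≤ m) {x : E3} (hx : x ≠ 0) :
    ContDiffAt ℝ 1 (fun x : E3 => gradVx m ‖x‖ (x 2)) x := by
  have h := contDiffAt_norm ℝ (n := 1) hx
  have hr : 0 < ‖x‖ := norm_pos_iff.2 hx
  have hN := (kerrNum_pos (z := x 2) hm hr).ne'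
  have hD := (kerrDen_pos (z := x 2) hm hr).ne'
  unfold gradVx
  refine ContDiffAt.div (ContDiffAt.sub (ContDiffAt.div ?_ (contDiffAt_kerrNum hx) hN)
    (ContDiffAt.div ?_ (contDiffAt_kerrDen hx) hD)) h hr.ne'
  · fun_prop
  · fun_prop

lemma contDiffAt_gradVz (hm : 0 ≤ m) {x : E3} (hx : x ≠ 0) :
    ContDiffAt ℝ 1 (fun x : E3 => gradVz m ‖x‖ (x 2)) x := by
  have hr : 0 < ‖x‖ := norm_pos_iff.2 hx
  have hN := (kerrNum_pos (z := x 2) hm hr).ne'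
  have hD := (kerrDen_pos (z := x 2) hm hr).ne'
  unfold gradVz
  refine ContDiffAt.sub (ContDiffAt.div ?_ (contDiffAt_kerrNum hx) hN)
    (ContDiffAt.div ?_ (contDiffAt_kerrDen hx) hD)
  · fun_prop
  · fun_prop

lemma ne_zero_of_rho_pos {x : E3} (hx : 0 < rho x) : x ≠ 0 := norm_pos_iff.1 (norm_pos_of_rho_pos hx)

lemma norm_sq_sub_pos {x : E3} (hx : 0 < rho x) : 0 < ‖x‖ ^ 2 - x 2 ^ 2 := by
  rw [← rho_sq_eq]; positivity

lemma contDiffAt_fluxYz (hm : 0 ≤ m) {x : E3} (hx : 0 < rho x) :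
    ContDiffAt ℝ 1 (fun x : E3 => fluxYz J m ‖x‖ (x 2)) x := by
  have hx0 := ne_zero_of_rho_pos hx
  have h := contDiffAt_norm ℝ (n := 1) hx0
  have hr : 0 < ‖x‖ := norm_pos_iff.2 hx0
  have hN := (kerrNum_pos (z := x 2) hm hr).ne'
  have hq := (norm_sq_sub_pos hx).ne'
  have hNc := contDiffAt_kerrNum (m := m) hx0
  have hKc := contDiffAt_kerrAng (m := m) hx0
  unfold fluxYz
  exact ContDiffAt.div (by fun_prop) (by fun_prop)
    (mul_ne_zero (mul_ne_zero hr.ne' hq) (pow_ne_zero 2 hN))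

lemma contDiffAt_fluxYx (hm : 0 ≤ m) {x : E3} (hx : 0 < rho x) :
    ContDiffAt ℝ 1 (fun x : E3 => fluxYx J m ‖x‖ (x 2)) x := by
  have hx0 := ne_zero_of_rho_pos hx
  have h := contDiffAt_norm ℝ (n := 1) hx0
  have hr : 0 < ‖x‖ := norm_pos_iff.2 hx0
  have hN := (kerrNum_pos (z := x 2) hm hr).ne'
  have hNc := contDiffAt_kerrNum (m := m) hx0
  have hz := contDiffAt_fluxYz (J := J) hm hx
  unfold fluxYx
  refine ContDiffAt.sub (ContDiffAt.div (by fun_prop) (by fun_prop)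
    (mul_ne_zero (pow_ne_zero 2 hr.ne') (pow_ne_zero 2 hN))) (hz.mul ?_)
  exact ContDiffAt.div (by fun_prop) (by fun_prop) (pow_ne_zero 2 hr.ne')

lemma contDiffAt_rho_sq_inv {x : E3} (hx : 0 < rho x) :
    ContDiffAt ℝ 1 (fun x : E3 => 1 / (‖x‖ ^ 2 - x 2 ^ 2)) x := by
  have h := contDiffAt_norm ℝ (n := 1) (ne_zero_of_rho_pos hx)
  have h1 : ContDiffAt ℝ 1 (fun x : E3 => ‖x‖ ^ 2 - x 2 ^ 2) x := by fun_prop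
  exact contDiffAt_const.div h1 (norm_sq_sub_pos hx).ne'

lemma contDiffAt_zed_div_rho_sq {x : E3} (hx : 0 < rho x) :
    ContDiffAt ℝ 1 (fun x : E3 => -(x 2 / (‖x‖ ^ 2 - x 2 ^ 2))) x := by
  have h := contDiffAt_norm ℝ (n := 1) (ne_zero_of_rho_pos hx)
  have h1 : ContDiffAt ℝ 1 (fun x : E3 => ‖x‖ ^ 2 - x 2 ^ 2) x := by fun_prop
  have hz : ContDiffAt ℝ 1 (fun x : E3 => x 2) x := by fun_prop
  exact (hz.div h1 (norm_sq_sub_pos hx).ne').neg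

end Smooth

section FieldEquations
variable {m J : ℝ}

lemma inner_self_div_norm {x : E3} (hx : x ≠ 0) : inner ℝ x x / ‖x‖ = ‖x‖ := by
  have : ‖x‖ ≠ 0 := norm_ne_zero_iff.2 hx
  rw [real_inner_self_eq_norm_sq]
  field_simp

/-- `Δ v₀ = - X₀⁻² |∇Y₀|²`. -/
lemma fieldDiv_gradV (hm : 0 ≤ m) {x : E3} (hx : x ≠ 0) :
    fieldDiv (fun x => gradVx m ‖x‖ (x 2)) (fun x => gradVz m ‖x‖ (x 2)) x
      = -twistSq m ‖x‖ (x 2) := by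
  have hr : 0 < ‖x‖ := norm_pos_iff.2 hx
  have hN := (kerrNum_pos (z := x 2) hm hr).ne'
  have hD := (kerrDen_pos (z := x 2) hm hr).ne'
  have e1 := fderiv_eq_of_hasDerivAt_line ((contDiffAt_gradVx hm hx).differentiableAt (by simp))
    (hasDerivAt_gradVx (m := m) (hasDerivAt_norm_line hx x) (hasDerivAt_coord_line x x 2)
      (by simpa using hr.ne') (by simpa using hN) (by simpa using hD))
  have e2 := fderiv_eq_of_hasDerivAt_line ((contDiffAt_gradVz hm hx).differentiableAt (by simp))
    (hasDerivAt_gradVz (m := m) (hasDerivAt_norm_line hx eZed) (hasDerivAt_coord_line x eZed 2)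
      (by simpa using hN) (by simpa using hD))
  rw [fieldDiv, e1, e2, inner_self_div_norm hx, inner_eZed]
  have e3 : eZed 2 = 1 := by simp [eZed]
  simp only [zero_smul, add_zero, e3]
  generalize ‖x‖ = r at *
  generalize x 2 = z at *
  clear e1 e2 e3 hx
  simp only [gradVx, twistSq]
  have hr0 := hr.ne'
  rw [← sub_eq_zero]
  field_simp
  simp only [kerrNum, kerrDen, kerrAng]
  ring

/-- `div (X₀⁻² ∇Y₀) = 0`. -/
lemma fieldDiv_fluxY (hm : 0 ≤ m) {x : E3} (hx : 0 < rho x) :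
    fieldDiv (fun x => fluxYx J m ‖x‖ (x 2)) (fun x => fluxYz J m ‖x‖ (x 2)) x = 0 := by
  have hx0 := ne_zero_of_rho_pos hx
  have hr : 0 < ‖x‖ := norm_pos_iff.2 hx0
  have hN := (kerrNum_pos (z := x 2) hm hr).ne'
  have hq := (norm_sq_sub_pos hx).ne'
  have d1 := hasDerivAt_fluxYz (J := J) (m := m) (hasDerivAt_norm_line hx0 x)
    (hasDerivAt_coord_line x x 2)
      (by simpa using hr.ne') (by simpa using hq) (by simpa using hN)
  have e1 := fderiv_eq_of_hasDerivAt_line ((contDiffAt_fluxYx (J := J) hm hx).differentiableAt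
    (by simp)) (hasDerivAt_fluxYx (m := m) (hasDerivAt_norm_line hx0 x)
      (hasDerivAt_coord_line x x 2) (by simpa using hr.ne') (by simpa using hN) d1)
  have e2 := fderiv_eq_of_hasDerivAt_line ((contDiffAt_fluxYz (J := J) hm hx).differentiableAt
    (by simp)) (hasDerivAt_fluxYz (J := J) (m := m) (hasDerivAt_norm_line hx0 eZed)
      (hasDerivAt_coord_line x eZed 2)
      (by simpa using hr.ne') (by simpa using hq) (by simpa using hN))
  rw [fieldDiv, e1, e2, inner_self_div_norm hx0, inner_eZed]
  have e3 : eZed 2 = 1 := by simp [eZed]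
  simp only [zero_smul, add_zero, e3]
  generalize ‖x‖ = r at *
  generalize x 2 = z at *
  clear e1 e2 e3 hx hx0 d1
  simp only [fluxYx, fluxYz]
  have hr0 := hr.ne'
  field_simp
  simp only [kerrNum, kerrAng]
  ring

/-- `Δ log ρ = 0` off the axis. -/
lemma fieldDiv_log_rho {x : E3} (hx : 0 < rho x) :
    fieldDiv (fun x => 1 / (‖x‖ ^ 2 - x 2 ^ 2)) (fun x => -(x 2 / (‖x‖ ^ 2 - x 2 ^ 2))) x = 0 := by
  have hx0 := ne_zero_of_rho_pos hx
  have hr : 0 < ‖x‖ := norm_pos_iff.2 hx0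
  have hq := (norm_sq_sub_pos hx).ne'
  have e1 := fderiv_eq_of_hasDerivAt_line (v := x)
    ((contDiffAt_rho_sq_inv hx).differentiableAt (by simp))
    ((hasDerivAt_const _ _).fun_div (((hasDerivAt_norm_line hx0 x).fun_pow 2).fun_sub
      ((hasDerivAt_coord_line x x 2).fun_pow 2)) (by simpa using hq))
  have e2 := fderiv_eq_of_hasDerivAt_line (v := eZed)
    ((contDiffAt_zed_div_rho_sq hx).differentiableAt (by simp))
    ((hasDerivAt_coord_line x eZed 2).fun_div (((hasDerivAt_norm_line hx0 eZed).fun_pow 2).fun_sub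
      ((hasDerivAt_coord_line x eZed 2).fun_pow 2)) (by simpa using hq)).fun_neg
  rw [fieldDiv, e1, e2, inner_self_div_norm hx0, inner_eZed]
  have e3 : eZed 2 = 1 := by simp [eZed]
  simp only [zero_smul, add_zero, e3]
  field_simp
  push_cast
  ring

end FieldEquations

/-! ### The extreme Kerr data in terms of `r` and `z` -/

section Data
variable {J : ℝ}

lemma sqrt_abs_sq (J : ℝ) : √|J| ^ 2 = |J| := sq_sqrt (abs_nonneg J)

lemma sqrt_abs_pow_four (J : ℝ) : √|J| ^ 4 = J ^ 2 := by
  rw [show √|J| ^ 4 = (√|J| ^ 2) ^ 2 by ring, sqrt_abs_sq, sq_abs]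

lemma kerrSigma_eq {x : E3} (hx : x ≠ 0) :
    kerrSigma J x = kerrDen √|J| ‖x‖ (x 2) / ‖x‖ ^ 2 := by
  have hr : ‖x‖ ≠ 0 := norm_ne_zero_iff.2 hx
  simp only [kerrSigma, rBL, cosTheta, zed, rad_eq, kerrDen]
  rw [sqrt_abs_sq]
  field_simp

lemma kerrX_eq {x : E3} (hx : x ≠ 0) :
    kerrX J x = kerrNum √|J| ‖x‖ (x 2) * rho x ^ 2 / kerrDen √|J| ‖x‖ (x 2) := by
  have hr : 0 < ‖x‖ := norm_pos_iff.2 hx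
  have hD := (kerrDen_pos (z := x 2) (sqrt_nonneg |J|) hr).ne'
  rw [kerrX, kerrSigma_eq hx]
  simp only [rBL, sinTheta, rad_eq, kerrNum]
  rw [sqrt_abs_sq, ← rho_sq_eq]
  field_simp

lemma kerrX_ge {x : E3} (hx : x ≠ 0) : rho x ^ 2 ≤ kerrX J x := by
  have hr : 0 < ‖x‖ := norm_pos_iff.2 hx
  have hm := sqrt_nonneg |J|
  have hD := kerrDen_pos (z := x 2) hm hr
  rw [kerrX_eq hx, le_div_iff₀ hD, mul_comm]
  refine mul_le_mul_of_nonneg_right ?_ (sq_nonneg _)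
  generalize √|J| = m at *
  have h1 : 0 ≤ ‖x‖ ^ 2 - x 2 ^ 2 := by rw [← rho_sq_eq]; positivity
  unfold kerrNum kerrDen
  generalize ‖x‖ = r at *
  have h2 : m ^ 2 * x 2 ^ 2 ≤ m ^ 2 * r ^ 2 :=
    mul_le_mul_of_nonneg_left (by linarith) (sq_nonneg m)
  have h3 : 0 ≤ m ^ 2 * x 2 ^ 2 := by positivity
  -- The worst case takes `z = 0` in the numerator and `|z| = r` in the denominator; the difference
  -- then expands with nonnegative coefficients only.
  have h4 : 0 ≤ ((r + m) ^ 2 + m ^ 2) ^ 2 - m ^ 2 * r ^ 2 - (r ^ 2 * (r + m) ^ 2 + m ^ 2 * r ^ 2) := by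
    ring_nf; positivity
  linarith

lemma kerrX_pos {x : E3} (hx : 0 < rho x) : 0 < kerrX J x :=
  (by positivity : 0 < rho x ^ 2).trans_le (kerrX_ge (ne_zero_of_rho_pos hx))

lemma kerrV_eq {x : E3} (hx : 0 < rho x) :
    kerrV J x = log (kerrNum √|J| ‖x‖ (x 2)) - log (kerrDen √|J| ‖x‖ (x 2)) := by
  have hr := norm_pos_of_rho_pos hx
  have hN := kerrNum_pos (z := x 2) (sqrt_nonneg |J|) hr
  have hD := kerrDen_pos (z := x 2) (sqrt_nonneg |J|) hr
  rw [kerrV, kerrX_eq (ne_zero_of_rho_pos hx), log_div (by positivity) hD.ne',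
    log_mul hN.ne' (by positivity), log_pow]
  push_cast
  ring

lemma isOpen_rho_pos : IsOpen {x : E3 | 0 < rho x} := isOpen_lt continuous_const continuous_rho

lemma contDiffAt_log_form (J : ℝ) {x : E3} (hx : x ≠ 0) : ContDiffAt ℝ 1
    (fun x : E3 => log (kerrNum √|J| ‖x‖ (x 2)) - log (kerrDen √|J| ‖x‖ (x 2))) x := by
  have hr : 0 < ‖x‖ := norm_pos_iff.2 hx
  have hN := kerrNum_pos (z := x 2) (sqrt_nonneg |J|) hr
  have hD := kerrDen_pos (z := x 2) (sqrt_nonneg |J|) hr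
  exact ((contDiffAt_kerrNum hx).log hN.ne').sub ((contDiffAt_kerrDen hx).log hD.ne')

lemma kerrV_eventuallyEq {x : E3} (hx : 0 < rho x) : kerrV J =ᶠ[𝓝 x]
    fun x => log (kerrNum √|J| ‖x‖ (x 2)) - log (kerrDen √|J| ‖x‖ (x 2)) := by
  filter_upwards [isOpen_rho_pos.mem_nhds hx] with y hy using kerrV_eq hy

lemma contDiffAt_kerrV {x : E3} (hx : 0 < rho x) : ContDiffAt ℝ 1 (kerrV J) x :=
  (contDiffAt_log_form J (ne_zero_of_rho_pos hx)).congr_of_eventuallyEq (kerrV_eventuallyEq hx)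

lemma fderiv_kerrV {x : E3} (hx : 0 < rho x) (v : E3) :
    fderiv ℝ (kerrV J) x v
      = gradVx √|J| ‖x‖ (x 2) * inner ℝ x v + gradVz √|J| ‖x‖ (x 2) * v 2 := by
  have hx0 := ne_zero_of_rho_pos hx
  have hr := norm_pos_of_rho_pos hx
  have hN := kerrNum_pos (z := x 2) (sqrt_nonneg |J|) hr
  have hD := kerrDen_pos (z := x 2) (sqrt_nonneg |J|) hr
  rw [(kerrV_eventuallyEq hx).fderiv_eq]
  have hn := hasDerivAt_norm_line hx0 v
  have hz := hasDerivAt_coord_line x v 2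
  rw [fderiv_eq_of_hasDerivAt_line ((contDiffAt_log_form J hx0).differentiableAt (by simp))
    (((hasDerivAt_kerrNum hn hz).log (by simpa using hN.ne')).fun_sub
      ((hasDerivAt_kerrDen hn hz).log (by simpa using hD.ne')))]
  simp only [zero_smul, add_zero, gradVx, gradVz]
  field_simp
  ring

/-- The expression of `Y₀` in terms of `r` and `z`. -/
def kerrYrz (J m r z : ℝ) : ℝ :=
  2 * J * (z ^ 3 / r ^ 3 - 3 * (z / r)) - 2 * J * m ^ 2 * z * (r ^ 2 - z ^ 2) ^ 2
    / (r ^ 3 * kerrDen m r z)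

lemma kerrY_eq {x : E3} (hx : x ≠ 0) : kerrY J x = kerrYrz J √|J| ‖x‖ (x 2) := by
  have hr : 0 < ‖x‖ := norm_pos_iff.2 hx
  have hD := (kerrDen_pos (z := x 2) (sqrt_nonneg |J|) hr).ne'
  rw [kerrY, kerrSigma_eq hx, kerrYrz]
  simp only [cosTheta, sinTheta, zed, rad_eq]
  rw [sqrt_abs_sq, ← rho_sq_eq]
  field_simp

/-- The derivative is stated in the factored form `X₀²` times the flux that enters the conservation
law. The numerator polynomial cancels between the two factors, which is why it can stay an atom in
the final computation. -/
lemma hasDerivAt_kerrYrz {J m t r' z' : ℝ} {r z : ℝ → ℝ} (hr : HasDerivAt r r' t)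
    (hz : HasDerivAt z z' t) (h0 : r t ≠ 0) (hN : kerrNum m (r t) (z t) ≠ 0)
    (hD : kerrDen m (r t) (z t) ≠ 0) (hq : r t ^ 2 - z t ^ 2 ≠ 0) :
    HasDerivAt (fun s => kerrYrz J m (r s) (z s))
      ((kerrNum m (r t) (z t) * (r t ^ 2 - z t ^ 2) / kerrDen m (r t) (z t)) ^ 2 *
        (fluxYx J m (r t) (z t) * (r t * r') + fluxYz J m (r t) (z t) * z')) t := by
  refine (((((hz.fun_pow 3).fun_div (hr.fun_pow 3) (pow_ne_zero 3 h0)).fun_sub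
    ((hz.fun_div hr h0).const_mul 3)).const_mul (2 * J)).fun_sub
    (((hz.const_mul (2 * J * m ^ 2)).fun_mul (((hr.fun_pow 2).fun_sub (hz.fun_pow 2)).fun_pow 2)).fun_div
      ((hr.fun_pow 3).fun_mul (hasDerivAt_kerrDen (m := m) hr hz))
      (mul_ne_zero (pow_ne_zero 3 h0) hD))).congr_deriv ?_
  push_cast
  simp only [fluxYx, fluxYz]
  generalize r t = r at *
  generalize z t = z at *
  generalize kerrNum m r z = N at *
  rw [← sub_eq_zero]
  field_simp
  simp only [kerrDen, kerrAng]
  ring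

lemma contDiffAt_kerrYrz (J : ℝ) {x : E3} (hx : x ≠ 0) :
    ContDiffAt ℝ 1 (fun x : E3 => kerrYrz J √|J| ‖x‖ (x 2)) x := by
  have h := contDiffAt_norm ℝ (n := 1) hx
  have hr : 0 < ‖x‖ := norm_pos_iff.2 hx
  have hD := (kerrDen_pos (z := x 2) (sqrt_nonneg |J|) hr).ne'
  have hDc := contDiffAt_kerrDen (m := √|J|) hx
  have hz : ContDiffAt ℝ 1 (fun x : E3 => x 2) x := by fun_prop
  unfold kerrYrz
  have h1 := hz.div h hr.ne'
  have h2 := (hz.pow 3).div (h.pow 3) (pow_ne_zero 3 hr.ne')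
  refine ContDiffAt.sub (contDiffAt_const.mul (h2.sub (contDiffAt_const.mul h1)))
    (ContDiffAt.div ?_ ((h.pow 3).mul hDc) (mul_ne_zero (pow_ne_zero 3 hr.ne') hD))
  exact ((contDiffAt_const.mul hz).mul (((h.pow 2).sub (hz.pow 2)).pow 2))

lemma kerrY_eventuallyEq {x : E3} (hx : 0 < rho x) : kerrY J =ᶠ[𝓝 x]
    fun x => kerrYrz J √|J| ‖x‖ (x 2) := by
  filter_upwards [isOpen_rho_pos.mem_nhds hx] with y hy using kerrY_eq (ne_zero_of_rho_pos hy)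

lemma contDiffAt_kerrY {x : E3} (hx : 0 < rho x) : ContDiffAt ℝ 1 (kerrY J) x :=
  (contDiffAt_kerrYrz J (ne_zero_of_rho_pos hx)).congr_of_eventuallyEq (kerrY_eventuallyEq hx)

lemma fderiv_kerrY {x : E3} (hx : 0 < rho x) (v : E3) :
    fderiv ℝ (kerrY J) x v = kerrX J x ^ 2 *
      (fluxYx J √|J| ‖x‖ (x 2) * inner ℝ x v + fluxYz J √|J| ‖x‖ (x 2) * v 2) := by
  have hx0 := ne_zero_of_rho_pos hx
  have hr := norm_pos_of_rho_pos hx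
  have hN := kerrNum_pos (z := x 2) (sqrt_nonneg |J|) hr
  have hD := kerrDen_pos (z := x 2) (sqrt_nonneg |J|) hr
  rw [(kerrY_eventuallyEq hx).fderiv_eq]
  rw [fderiv_eq_of_hasDerivAt_line ((contDiffAt_kerrYrz J hx0).differentiableAt (by simp))
    (hasDerivAt_kerrYrz (hasDerivAt_norm_line hx0 v) (hasDerivAt_coord_line x v 2)
      (by simpa using hr.ne') (by simpa using hN.ne') (by simpa using hD.ne')
      (by simpa using (norm_sq_sub_pos hx).ne'))]
  simp only [zero_smul, add_zero]
  rw [kerrX_eq hx0, rho_sq_eq, mul_div_cancel₀ _ hr.ne']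

lemma eRho_two (x : E3) : eRho x 2 = 0 := by simp [eRho]

lemma eZed_two : eZed 2 = 1 := by simp [eZed]

lemma dRho_kerrV {x : E3} (hx : 0 < rho x) :
    dRho (kerrV J) x = gradVx √|J| ‖x‖ (x 2) * rho x := by
  rw [dRho, fderiv_kerrV hx, inner_eRho hx, eRho_two]; ring

lemma dZed_kerrV {x : E3} (hx : 0 < rho x) :
    dZed (kerrV J) x = gradVx √|J| ‖x‖ (x 2) * x 2 + gradVz √|J| ‖x‖ (x 2) := by
  rw [dZed, fderiv_kerrV hx, inner_eZed, eZed_two]; ring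

lemma dRho_kerrY {x : E3} (hx : 0 < rho x) :
    dRho (kerrY J) x = kerrX J x ^ 2 * (fluxYx J √|J| ‖x‖ (x 2) * rho x) := by
  rw [dRho, fderiv_kerrY hx, inner_eRho hx, eRho_two]; ring

lemma dZed_kerrY {x : E3} (hx : 0 < rho x) :
    dZed (kerrY J) x
      = kerrX J x ^ 2 * (fluxYx J √|J| ‖x‖ (x 2) * x 2 + fluxYz J √|J| ‖x‖ (x 2)) := by
  rw [dZed, fderiv_kerrY hx, inner_eZed, eZed_two]; ring

/-- `|∂Y₀|² = X₀² b²`. -/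
lemma partialSq_kerrY {x : E3} (hx : 0 < rho x) :
    partialSq (kerrY J) x = kerrX J x ^ 2 * twistSq √|J| ‖x‖ (x 2) := by
  have hr := norm_pos_of_rho_pos hx
  have hx0 := ne_zero_of_rho_pos hx
  have hN := (kerrNum_pos (z := x 2) (sqrt_nonneg |J|) hr).ne'
  have hD := (kerrDen_pos (z := x 2) (sqrt_nonneg |J|) hr).ne'
  have hq := (norm_sq_sub_pos hx).ne'
  have hJ := sqrt_abs_pow_four J
  have key : kerrX J x ^ 2 * (fluxYx J √|J| ‖x‖ (x 2) ^ 2 * rho x ^ 2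
      + (fluxYx J √|J| ‖x‖ (x 2) * x 2 + fluxYz J √|J| ‖x‖ (x 2)) ^ 2)
      = twistSq √|J| ‖x‖ (x 2) := by
    rw [kerrX_eq hx0, rho_sq_eq]
    simp only [fluxYx, fluxYz, twistSq]
    have h4 : (4 : ℝ) * √|J| ^ 4 = 4 * J ^ 2 := by rw [hJ]
    generalize √|J| = m at *
    generalize ‖x‖ = r at *
    generalize x 2 = z at *
    generalize kerrNum m r z = N at *
    generalize kerrDen m r z = D at *
    generalize kerrAng m r z = K at *
    have : 4 * m ^ 4 * (r ^ 2 - z ^ 2) *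
      (4 * m ^ 4 * (r + m) ^ 2 * z ^ 2 * (r ^ 2 - z ^ 2) * r ^ 2 + K ^ 2)
        = 4 * J ^ 2 * (r ^ 2 - z ^ 2) *
      (4 * m ^ 4 * (r + m) ^ 2 * z ^ 2 * (r ^ 2 - z ^ 2) * r ^ 2 + K ^ 2) := by rw [h4]
    rw [this]
    field_simp
    ring
  rw [partialSq, dRho_kerrY hx, dZed_kerrY hx, ← key]
  ring

end Data

/-! ### Decay of the extreme Kerr data -/

section Bounds
variable {m r z : ℝ}

/-- For `m = 0` the two products cancel, so the difference carries a factor `m`. This improves the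
decay of `∇v₀` at infinity from `r⁻¹` to `r⁻²`. -/
lemma abs_gradV_numerator_le (hm : 0 ≤ m) (hr : 0 ≤ r) (hz : z ^ 2 ≤ r ^ 2) :
    |(4 * (r + m) * ((r + m) ^ 2 + m ^ 2) - 2 * m ^ 2 * r) * kerrDen m r z
      - 2 * r * (r + m) * (2 * r + m) * kerrNum m r z| ≤ 200 * (m * r * (r + m) ^ 5) := by
  have hW : (4 * (r + m) * ((r + m) ^ 2 + m ^ 2) - 2 * m ^ 2 * r) * kerrDen m r z
      - 2 * r * (r + m) * (2 * r + m) * kerrNum m r z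
      = ((4 * (r + m) * ((r + m) ^ 2 + m ^ 2) - 2 * m ^ 2 * r) * (r ^ 2 * (r + m) ^ 2)
        - 2 * r * (r + m) * (2 * r + m) * (((r + m) ^ 2 + m ^ 2) ^ 2 - m ^ 2 * r ^ 2))
      + m ^ 2 * z ^ 2 * ((4 * (r + m) * ((r + m) ^ 2 + m ^ 2) - 2 * m ^ 2 * r)
        - 2 * r * (r + m) * (2 * r + m)) := by
    unfold kerrNum kerrDen; ring
  have h0 : |(4 * (r + m) * ((r + m) ^ 2 + m ^ 2) - 2 * m ^ 2 * r) * (r ^ 2 * (r + m) ^ 2)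
        - 2 * r * (r + m) * (2 * r + m) * (((r + m) ^ 2 + m ^ 2) ^ 2 - m ^ 2 * r ^ 2)|
      ≤ 100 * (m * r * (r + m) ^ 5) := by
    rw [abs_le]
    constructor
    · rw [← sub_nonneg]; ring_nf; positivity
    · rw [← sub_nonneg]; ring_nf; positivity
  have h1 : |(4 * (r + m) * ((r + m) ^ 2 + m ^ 2) - 2 * m ^ 2 * r)
        - 2 * r * (r + m) * (2 * r + m)| ≤ 20 * (r + m) ^ 3 := by
    rw [abs_le]
    constructor
    · rw [← sub_nonneg]; ring_nf; positivity
    · rw [← sub_nonneg]; ring_nf; positivity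
  have h2 : m ^ 2 * z ^ 2 ≤ m ^ 2 * r ^ 2 := mul_le_mul_of_nonneg_left hz (sq_nonneg m)
  have h3 : m ^ 2 * r ^ 2 * (20 * (r + m) ^ 3) ≤ 100 * (m * r * (r + m) ^ 5) := by
    rw [← sub_nonneg]; ring_nf; positivity
  rw [hW]
  refine (abs_add_le _ _).trans ?_
  rw [abs_mul (m ^ 2 * z ^ 2), abs_of_nonneg (by positivity : 0 ≤ m ^ 2 * z ^ 2)]
  have := mul_le_mul h2 h1 (abs_nonneg _) (by positivity)
  linarith

lemma abs_gradVx_mul_le (hm : 0 ≤ m) (hr : 0 < r) (hz : z ^ 2 ≤ r ^ 2) :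
    |gradVx m r z| * r ≤ 200 * (m / (r * (r + m))) := by
  have hN := kerrNum_pos (z := z) hm hr
  have hD := kerrDen_pos (z := z) hm hr
  have hN' := kerrNum_ge (z := z) hm hr.le
  have hD' := kerrDen_ge (m := m) (r := r) (z := z)
  have hW := abs_gradV_numerator_le hm hr.le hz
  have e : gradVx m r z * r = ((4 * (r + m) * ((r + m) ^ 2 + m ^ 2) - 2 * m ^ 2 * r) * kerrDen m r z
      - 2 * r * (r + m) * (2 * r + m) * kerrNum m r z) / (kerrNum m r z * kerrDen m r z) := by
    unfold gradVx
    field_simp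
  rw [show |gradVx m r z| * r = |gradVx m r z * r| by rw [abs_mul, abs_of_pos hr], e, abs_div,
    abs_of_pos (mul_pos hN hD), div_le_iff₀ (mul_pos hN hD)]
  refine hW.trans ?_
  have h5 : (r + m) ^ 4 * (r ^ 2 * (r + m) ^ 2) ≤ kerrNum m r z * kerrDen m r z :=
    mul_le_mul hN' hD' (by positivity) hN.le
  have h6 : 200 * (m * r * (r + m) ^ 5)
      = 200 * (m / (r * (r + m))) * ((r + m) ^ 4 * (r ^ 2 * (r + m) ^ 2)) := by
    field_simp
  rw [h6]
  gcongr

lemma abs_gradVz_le (hm : 0 ≤ m) (hr : 0 < r) (hz : z ^ 2 ≤ r ^ 2) :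
    |gradVz m r z| ≤ 4 * (m / (r * (r + m))) := by
  have hN := kerrNum_pos (z := z) hm hr
  have hD := kerrDen_pos (z := z) hm hr
  have hN' := kerrNum_ge (z := z) hm hr.le
  have hD' := kerrDen_ge (m := m) (r := r) (z := z)
  have hz' : |z| ≤ r := abs_le_of_sq_le_sq hz hr.le
  have h0 : |2 * m ^ 2 * z| ≤ 2 * m ^ 2 * r := by
    rw [abs_mul, abs_of_nonneg (by positivity : 0 ≤ 2 * m ^ 2)]; gcongr
  have h1 : |2 * m ^ 2 * z / kerrNum m r z| ≤ 2 * (m / (r * (r + m))) := by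
    rw [abs_div, abs_of_pos hN, div_le_iff₀ hN]
    have : 2 * m ^ 2 * r ≤ 2 * (m / (r * (r + m))) * (r + m) ^ 4 := by
      rw [show 2 * (m / (r * (r + m))) * (r + m) ^ 4 = 2 * (m * (r + m) ^ 3) / r by field_simp,
        le_div_iff₀ hr, ← sub_nonneg]
      ring_nf; positivity
    refine (h0.trans this).trans ?_
    gcongr
  have h2 : |2 * m ^ 2 * z / kerrDen m r z| ≤ 2 * (m / (r * (r + m))) := by
    rw [abs_div, abs_of_pos hD, div_le_iff₀ hD]
    have : 2 * m ^ 2 * r ≤ 2 * (m / (r * (r + m))) * (r ^ 2 * (r + m) ^ 2) := by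
      rw [show 2 * (m / (r * (r + m))) * (r ^ 2 * (r + m) ^ 2) = 2 * (m * r * (r + m)) by
        field_simp, ← sub_nonneg]
      ring_nf; positivity
    refine (h0.trans this).trans ?_
    gcongr
  unfold gradVz
  refine (abs_sub _ _).trans ?_
  linarith

lemma twistSq_le (hm : 0 ≤ m) (hr : 0 < r) (hz : z ^ 2 ≤ r ^ 2) :
    twistSq m r z ≤ 200 * (m / (r * (r + m))) ^ 2 := by
  have hN := kerrNum_pos (z := z) hm hr
  have hD := kerrDen_pos (z := z) hm hr
  have hN' := kerrNum_ge (z := z) hm hr.le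
  have hD' := kerrDen_ge (m := m) (r := r) (z := z)
  have hz0 := sq_nonneg z
  have hK : kerrAng m r z ≤ 5 * (r ^ 2 * (r + m) ^ 4) := by
    have h1 : 0 ≤ m ^ 2 * ((r + m) ^ 2 - m ^ 2) := by ring_nf; positivity
    have h2 := mul_le_mul_of_nonneg_left hz h1
    have h3 : r ^ 2 * (3 * (r + m) ^ 4 + (r + m) ^ 2 * m ^ 2)
        + m ^ 2 * ((r + m) ^ 2 - m ^ 2) * r ^ 2 ≤ 5 * (r ^ 2 * (r + m) ^ 4) := by
      rw [← sub_nonneg]; ring_nf; positivity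
    unfold kerrAng; linarith
  have hK0 : 0 ≤ kerrAng m r z := by
    have h1 : 0 ≤ (r + m) ^ 2 - m ^ 2 := by ring_nf; positivity
    unfold kerrAng; positivity
  have hK2 : kerrAng m r z ^ 2 ≤ 25 * (r ^ 4 * (r + m) ^ 8) := by
    calc _ ≤ (5 * (r ^ 2 * (r + m) ^ 4)) ^ 2 := by gcongr
      _ = _ := by ring
  have hq0 : 0 ≤ r ^ 2 - z ^ 2 := by linarith
  have hq1 : r ^ 2 - z ^ 2 ≤ r ^ 2 := by linarith
  have h1 : 4 * m ^ 4 * (r + m) ^ 2 * z ^ 2 * (r ^ 2 - z ^ 2) * r ^ 2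
      ≤ 4 * (r ^ 4 * (r + m) ^ 8) := by
    calc _ ≤ 4 * m ^ 4 * (r + m) ^ 2 * r ^ 2 * r ^ 2 * r ^ 2 := by gcongr
      _ ≤ _ := by rw [← sub_nonneg]; ring_nf; positivity
  have h2 : 4 * m ^ 4 * (r ^ 2 - z ^ 2) *
      (4 * m ^ 4 * (r + m) ^ 2 * z ^ 2 * (r ^ 2 - z ^ 2) * r ^ 2 + kerrAng m r z ^ 2)
      ≤ 4 * m ^ 4 * r ^ 2 * (29 * (r ^ 4 * (r + m) ^ 8)) := by
    have : 4 * m ^ 4 * (r + m) ^ 2 * z ^ 2 * (r ^ 2 - z ^ 2) * r ^ 2 + kerrAng m r z ^ 2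
        ≤ 29 * (r ^ 4 * (r + m) ^ 8) := by linarith
    gcongr
  have hden : r ^ 4 * (r ^ 2 * (r + m) ^ 2) ^ 2 * ((r + m) ^ 4) ^ 2
      ≤ r ^ 4 * kerrDen m r z ^ 2 * kerrNum m r z ^ 2 := by gcongr
  unfold twistSq
  rw [div_le_iff₀ (by positivity)]
  refine h2.trans (le_trans ?_ (mul_le_mul_of_nonneg_left hden (by positivity)))
  rw [show 200 * (m / (r * (r + m))) ^ 2 * (r ^ 4 * (r ^ 2 * (r + m) ^ 2) ^ 2 * ((r + m) ^ 4) ^ 2)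
      = 200 * (m ^ 2 * r ^ 6 * (r + m) ^ 10) by field_simp]
  have : 0 ≤ m ^ 2 * r ^ 6 * (r + m) ^ 8 * (200 * (r + m) ^ 2 - 116 * m ^ 2) := by
    have : 0 ≤ 200 * (r + m) ^ 2 - 116 * m ^ 2 := by ring_nf; positivity
    positivity
  nlinarith

end Bounds

section Decay
variable {J : ℝ}

lemma sq_zed_le (x : E3) : x 2 ^ 2 ≤ ‖x‖ ^ 2 := by
  have := rho_sq_eq x
  nlinarith [sq_nonneg (rho x)]

lemma sigma_le_one_add (x : E3) : sigma x ≤ 1 + ‖x‖ := by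
  refine (abs_le_of_sq_le_sq' ?_ (by positivity)).2
  rw [sigma_sq]
  nlinarith [norm_nonneg x]

/-- This passes to the weight `1 / (r σ)`, which grows like `r⁻¹` at the origin and decays like
`r⁻²` at infinity; its square is integrable on `ℝ³`. -/
lemma le_of_mul_sigma {m : ℝ} (hm : 0 ≤ m) {x : E3} (hx : x ≠ 0) :
    m / (‖x‖ * (‖x‖ + m)) ≤ (1 + m) / (‖x‖ * sigma x) := by
  have hr : 0 < ‖x‖ := norm_pos_iff.2 hx
  have hs := sigma_pos x
  have h1 := sigma_le_one_add x
  rw [div_le_div_iff₀ (by positivity) (by positivity)]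
  have : m * sigma x ≤ (1 + m) * (‖x‖ + m) := by nlinarith
  nlinarith

/-- A constant controlling the decay of the extreme Kerr data. -/
def kerrConst (J : ℝ) : ℝ := 204 * (1 + √|J|)

lemma kerrConst_pos (J : ℝ) : 0 < kerrConst J := by unfold kerrConst; positivity

lemma abs_dRho_kerrV_le {x : E3} (hx : 0 < rho x) :
    |dRho (kerrV J) x| ≤ kerrConst J / (‖x‖ * sigma x) := by
  have hx0 := ne_zero_of_rho_pos hx
  have hm := sqrt_nonneg |J|
  have h1 := abs_gradVx_mul_le hm (norm_pos_iff.2 hx0) (sq_zed_le x)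
  have h2 := le_of_mul_sigma hm hx0
  have hs := sigma_pos x
  rw [dRho_kerrV hx, abs_mul, abs_of_pos hx, kerrConst, mul_div_assoc]
  have h3 := mul_le_mul_of_nonneg_left (rho_le_norm x) (abs_nonneg (gradVx √|J| ‖x‖ (x 2)))
  have : 0 ≤ (1 + √|J|) / (‖x‖ * sigma x) := by positivity
  linarith

lemma abs_dZed_kerrV_le {x : E3} (hx : 0 < rho x) :
    |dZed (kerrV J) x| ≤ kerrConst J / (‖x‖ * sigma x) := by
  have hx0 := ne_zero_of_rho_pos hx
  have hm := sqrt_nonneg |J|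
  have h1 := abs_gradVx_mul_le hm (norm_pos_iff.2 hx0) (sq_zed_le x)
  have h4 := abs_gradVz_le hm (norm_pos_iff.2 hx0) (sq_zed_le x)
  have h2 := le_of_mul_sigma hm hx0
  rw [dZed_kerrV hx, kerrConst, mul_div_assoc]
  refine (abs_add_le _ _).trans ?_
  rw [abs_mul]
  have h3 := mul_le_mul_of_nonneg_left (abs_zed_le_norm x) (abs_nonneg (gradVx √|J| ‖x‖ (x 2)))
  linarith

lemma twistSq_le_sigma {x : E3} (hx : x ≠ 0) :
    twistSq √|J| ‖x‖ (x 2) ≤ (kerrConst J / (‖x‖ * sigma x)) ^ 2 := by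
  have hm := sqrt_nonneg |J|
  have h1 := twistSq_le hm (norm_pos_iff.2 hx) (sq_zed_le x)
  have h2 := le_of_mul_sigma hm hx
  have hs := sigma_pos x
  have h3 : 0 ≤ √|J| / (‖x‖ * (‖x‖ + √|J|)) := by positivity
  refine h1.trans ?_
  rw [kerrConst, mul_div_assoc, mul_pow]
  have := pow_le_pow_left₀ h3 h2 2
  nlinarith [sq_nonneg ((1 + √|J|) / (‖x‖ * sigma x))]

lemma abs_dRho_kerrY_le {x : E3} (hx : 0 < rho x) :
    |dRho (kerrY J) x| ≤ kerrX J x * (kerrConst J / (‖x‖ * sigma x)) := by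
  have hX := kerrX_pos (J := J) hx
  have hC := kerrConst_pos J
  have hr := norm_pos_of_rho_pos hx
  have hs := sigma_pos x
  apply abs_le_of_sq_le_sq _ (by positivity)
  have h1 := partialSq_kerrY (J := J) hx
  have h2 := mul_le_mul_of_nonneg_left (twistSq_le_sigma (J := J) (ne_zero_of_rho_pos hx))
    (sq_nonneg (kerrX J x))
  rw [mul_pow]
  rw [partialSq] at h1
  nlinarith [sq_nonneg (dZed (kerrY J) x)]

lemma abs_dZed_kerrY_le {x : E3} (hx : 0 < rho x) :
    |dZed (kerrY J) x| ≤ kerrX J x * (kerrConst J / (‖x‖ * sigma x)) := by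
  have hX := kerrX_pos (J := J) hx
  have hC := kerrConst_pos J
  have hr := norm_pos_of_rho_pos hx
  have hs := sigma_pos x
  apply abs_le_of_sq_le_sq _ (by positivity)
  have h1 := partialSq_kerrY (J := J) hx
  have h2 := mul_le_mul_of_nonneg_left (twistSq_le_sigma (J := J) (ne_zero_of_rho_pos hx))
    (sq_nonneg (kerrX J x))
  rw [mul_pow]
  rw [partialSq] at h1
  nlinarith [sq_nonneg (dRho (kerrY J) x)]

/-- `ρ⁻⁴ e^{-2 v₀} = X₀⁻²`. -/
lemma rho_zpow_mul_exp {x : E3} (hx : 0 < rho x) :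
    rho x ^ (-4 : ℤ) * exp (-2 * kerrV J x) = (kerrX J x ^ 2)⁻¹ := by
  have hX := kerrX_pos (J := J) hx
  have h1 : exp (-2 * kerrV J x) = (kerrX J x ^ 2)⁻¹ * rho x ^ 4 := by
    rw [kerrV, show -2 * (log (kerrX J x) - 2 * log (rho x))
      = log ((kerrX J x ^ 2)⁻¹) + log (rho x ^ 4) by rw [log_inv, log_pow, log_pow]; push_cast; ring,
      exp_add, exp_log (by positivity), exp_log (by positivity)]
  rw [h1, show (-4 : ℤ) = -(4 : ℕ) by rfl, zpow_neg, zpow_natCast]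
  field_simp

end Decay

/-! ### Logarithmic cutoff functions -/

/-- The bump function used for cutting off. -/
def cutBump : ContDiffBump (0 : ℝ) := ⟨1, 2, one_pos, one_lt_two⟩

/-- A cutoff which is `1` where `|log r| ≤ n + 1` and `0` where `|log r| ≥ 2 (n + 1)`. -/
def logCut (n : ℕ) (x : E3) : ℝ := if x = 0 then 0 else cutBump (log ‖x‖ / (n + 1))

lemma logCut_nonneg (n : ℕ) (x : E3) : 0 ≤ logCut n x := by
  unfold logCut; split_ifs
  exacts [le_rfl, cutBump.nonneg]

lemma logCut_le_one (n : ℕ) (x : E3) : logCut n x ≤ 1 := by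
  unfold logCut; split_ifs
  exacts [zero_le_one, cutBump.le_one]

lemma logCut_eq_one {n : ℕ} {x : E3} (hx : x ≠ 0) (h : |log ‖x‖| ≤ n + 1) : logCut n x = 1 := by
  rw [logCut, if_neg hx]
  apply cutBump.one_of_mem_closedBall
  have hn : (0 : ℝ) < n + 1 := by positivity
  rw [mem_closedBall_zero_iff, norm_eq_abs, abs_div, abs_of_pos hn]
  exact (div_le_one hn).2 h

lemma support_logCut_subset (n : ℕ) :
    Function.support (logCut n) ⊆ {x | exp (-(2 * (n + 1))) ≤ ‖x‖ ∧ ‖x‖ ≤ exp (2 * (n + 1))} := by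
  intro x hx
  have hn : (0 : ℝ) < n + 1 := by positivity
  -- Since `log 0 = 0`, the bump alone would equal `1` at the origin; the value `0` prescribed there
  -- removes that point from the support.
  by_cases hx0 : x = 0
  · simp [logCut, hx0] at hx
  have hr : 0 < ‖x‖ := norm_pos_iff.2 hx0
  have h : log ‖x‖ / (n + 1) ∈ Function.support cutBump := by
    simpa [logCut, hx0] using hx
  rw [cutBump.support_eq, mem_ball_zero_iff, norm_eq_abs, abs_div, abs_of_pos hn,
    div_lt_iff₀ hn] at h
  have h2 : |log ‖x‖| < 2 * (n + 1) := h
  have h3 := abs_lt.1 h2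
  exact ⟨((lt_log_iff_exp_lt hr).1 h3.1).le, ((log_lt_iff_lt_exp hr).1 h3.2).le⟩

lemma isClosed_shell (a b : ℝ) : IsClosed {x : E3 | a ≤ ‖x‖ ∧ ‖x‖ ≤ b} :=
  (isClosed_le continuous_const continuous_norm).inter
    (isClosed_le continuous_norm continuous_const)

lemma tsupport_logCut_subset (n : ℕ) :
    tsupport (logCut n) ⊆ {x | exp (-(2 * (n + 1))) ≤ ‖x‖ ∧ ‖x‖ ≤ exp (2 * (n + 1))} :=
  closure_minimal (support_logCut_subset n) (isClosed_shell _ _)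

lemma tsupport_logCut_subset_compl (n : ℕ) : tsupport (logCut n) ⊆ {0}ᶜ := by
  intro x hx
  have := (exp_pos _).trans_le (tsupport_logCut_subset n hx).1
  exact norm_pos_iff.1 this

lemma hasCompactSupport_logCut (n : ℕ) : HasCompactSupport (logCut n) := by
  refine HasCompactSupport.of_support_subset_isCompact
    (isCompact_closedBall (0 : E3) (exp (2 * (n + 1)))) fun x hx => ?_
  simpa using (support_logCut_subset n hx).2

lemma logCut_eventuallyEq {n : ℕ} {x : E3} (hx : x ≠ 0) :
    logCut n =ᶠ[𝓝 x] fun x => cutBump (log ‖x‖ / (n + 1)) := by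
  filter_upwards [isOpen_ne.mem_nhds hx] with y hy
  simp only [logCut]
  exact if_neg hy

lemma contDiff_logCut (n : ℕ) : ContDiff ℝ 1 (logCut n) := by
  rw [contDiff_iff_contDiffAt]
  intro x
  by_cases hx : x ∈ tsupport (logCut n)
  · have hx0 : x ≠ 0 := tsupport_logCut_subset_compl n hx
    have hb : ContDiff ℝ 1 cutBump := cutBump.contDiff
    have h := (contDiffAt_norm ℝ (n := 1) hx0).log (norm_ne_zero_iff.2 hx0)
    exact (hb.contDiffAt.comp x (h.div_const ((n : ℝ) + 1))).congr_of_eventuallyEq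
      (logCut_eventuallyEq hx0)
  · exact contDiffAt_const.congr_of_eventuallyEq (notMem_tsupport_iff_eventuallyEq.1 hx)

/-- The gradient of the cutoffs is `O(1 / (n r))`. -/
lemma exists_norm_fderiv_logCut_le :
    ∃ M : ℝ, 0 ≤ M ∧ ∀ (n : ℕ) (x : E3), ‖fderiv ℝ (logCut n) x‖ ≤ M / ((n + 1) * ‖x‖) := by
  have hb : ContDiff ℝ 1 cutBump := cutBump.contDiff
  obtain ⟨M, hM⟩ := (cutBump.hasCompactSupport.deriv).exists_bound_of_continuous
    (hb.continuous_deriv le_rfl)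
  have hM0 : 0 ≤ M := (norm_nonneg _).trans (hM 0)
  refine ⟨M, hM0, fun n x => ?_⟩
  by_cases hx : x ∈ tsupport (logCut n)
  · have hx0 : x ≠ 0 := tsupport_logCut_subset_compl n hx
    have hr : 0 < ‖x‖ := norm_pos_iff.2 hx0
    have hnorm : DifferentiableAt ℝ (fun x : E3 => ‖x‖) x :=
      (contDiffAt_norm ℝ (n := 1) hx0).differentiableAt (by simp)
    have h1 : HasFDerivAt (fun x : E3 => log ‖x‖) (‖x‖⁻¹ • fderiv ℝ (fun x : E3 => ‖x‖) x) x :=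
      hnorm.hasFDerivAt.log hr.ne'
    have h2 := h1.mul_const (((n : ℝ) + 1)⁻¹)
    have h3 := ((hb.differentiable (by simp)) (log ‖x‖ * ((n : ℝ) + 1)⁻¹)).hasDerivAt.comp_hasFDerivAt x h2
    have h4 : logCut n =ᶠ[𝓝 x] cutBump ∘ fun x => log ‖x‖ * ((n : ℝ) + 1)⁻¹ :=
      logCut_eventuallyEq hx0
    rw [h4.fderiv_eq, h3.fderiv, norm_smul, norm_smul, norm_smul]
    have h5 : ‖fderiv ℝ (fun x : E3 => ‖x‖) x‖ ≤ 1 := by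
      simpa using norm_fderiv_le_of_lipschitz ℝ (lipschitzWith_one_norm (E := E3)) (x₀ := x)
    rw [norm_inv, norm_inv, norm_norm, norm_eq_abs ((n : ℝ) + 1), abs_of_pos (by positivity)]
    calc _ ≤ M * (((n : ℝ) + 1)⁻¹ * (‖x‖⁻¹ * 1)) := by
          gcongr
          exact hM _
      _ = _ := by field_simp
  · rw [(notMem_tsupport_iff_eventuallyEq.1 hx).fderiv_eq]
    simp
    positivity

lemma norm_eRho_le (x : E3) : ‖eRho x‖ ≤ 1 := by
  rcases (rho_nonneg x).eq_or_lt with h | h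
  · have : eRho x = 0 := by ext i; fin_cases i <;> simp [eRho, ← h]
    simp [this]
  · rw [← abs_norm, ← sq_le_one_iff_abs_le_one, norm_sq_eq]
    simp only [eRho]
    have := rho_sq x
    simp
    rw [div_pow, div_pow, ← add_div, ← this, div_self (by positivity)]

lemma norm_eZed : ‖eZed‖ = 1 := by
  rw [← sq_eq_sq₀ (norm_nonneg _) zero_le_one, norm_sq_eq]
  simp [eZed]

lemma abs_dRho_le (f : E3 → ℝ) (x : E3) : |dRho f x| ≤ ‖fderiv ℝ f x‖ :=
  ((fderiv ℝ f x).le_opNorm _).trans (mul_le_of_le_one_right (norm_nonneg _) (norm_eRho_le x))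

lemma abs_dZed_le (f : E3 → ℝ) (x : E3) : |dZed f x| ≤ ‖fderiv ℝ f x‖ := by
  have := (fderiv ℝ f x).le_opNorm eZed
  rwa [norm_eZed, mul_one] at this

/-- Cutting off an integral of a divergence whose flux decays yields zero in the limit. -/
lemma tendsto_integral_logCut {s P Q : E3 → ℝ} {U : Set E3} (hU : IsOpen U)
    (hs : LocallyLipschitz s) (hsd : ∀ᵐ x, DifferentiableAt ℝ s x)
    (hP : ContDiffOn ℝ 1 P U) (hQ : ContDiffOn ℝ 1 Q U) (hPm : Measurable P) (hQm : Measurable Q)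
    (hsU : ∀ x ∈ tsupport s, x ≠ 0 → x ∈ U) {H : E3 → ℝ} (hH : Integrable H)
    (hb : ∀ᵐ x, |s x| * (|P x * rho x| + |P x * x 2 + Q x|) ≤ H x * ‖x‖) :
    (∀ n, Integrable fun x => logCut n x *
      (P x * fderiv ℝ s x x + Q x * fderiv ℝ s x eZed + s x * fieldDiv P Q x)) ∧
    Tendsto (fun n => ∫ x, logCut n x *
      (P x * fderiv ℝ s x x + Q x * fderiv ℝ s x eZed + s x * fieldDiv P Q x)) atTop (𝓝 0) := by
  obtain ⟨M, hM0, hM⟩ := exists_norm_fderiv_logCut_le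
  have hfield : ∀ n, Integrable (fun x => P x * fderiv ℝ (fun x => logCut n x * s x) x x
        + Q x * fderiv ℝ (fun x => logCut n x * s x) x eZed
        + logCut n x * s x * fieldDiv P Q x) ∧
      ∫ x, (P x * fderiv ℝ (fun x => logCut n x * s x) x x
        + Q x * fderiv ℝ (fun x => logCut n x * s x) x eZed
        + logCut n x * s x * fieldDiv P Q x) = 0 := by
    intro n
    have hg : LocallyLipschitz (fun x => logCut n x * s x) :=
      LocallyLipschitz.mul_real (contDiff_logCut n).locallyLipschitz hs
    have hcs : HasCompactSupport (fun x => logCut n x * s x) :=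
      (hasCompactSupport_logCut n).mul_right
    refine integral_field_eq_zero hU hg hcs (fun x hx => ?_) hP hQ
    have h1 : x ∈ tsupport (logCut n) :=
      tsupport_mul_subset_left (f := logCut n) (g := s) hx
    have h2 : x ∈ tsupport s := tsupport_mul_subset_right (f := logCut n) (g := s) hx
    exact hsU x h2 (tsupport_logCut_subset_compl n h1)
  -- This is the term in which the derivative falls on the cutoff. Since the whole divergence
  -- integrates to zero, the integral to be estimated is minus the integral of `flux n`, which is of
  -- order `1 / n` because the factor `1 / r` in the gradient of the cutoff cancels the `r` allowed
  -- in `hb`.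
  set flux : ℕ → E3 → ℝ := fun n x => s x *
    (P x * fderiv ℝ (logCut n) x x + Q x * fderiv ℝ (logCut n) x eZed) with hflux
  have hae : ∀ n, (fun x => P x * fderiv ℝ (fun x => logCut n x * s x) x x
        + Q x * fderiv ℝ (fun x => logCut n x * s x) x eZed
        + logCut n x * s x * fieldDiv P Q x) =ᵐ[volume] fun x => logCut n x *
      (P x * fderiv ℝ s x x + Q x * fderiv ℝ s x eZed + s x * fieldDiv P Q x) + flux n x := by
    intro n
    filter_upwards [hsd] with x hx
    rw [((((contDiff_logCut n).differentiable (by simp)) x).hasFDerivAt.fun_mul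
      hx.hasFDerivAt).fderiv]
    simp [hflux]
    ring
  have hbound : ∀ n, ∀ᵐ x, ‖flux n x‖ ≤ M / (n + 1) * H x := by
    intro n
    have h0 : ∀ᵐ x : E3, x ≠ 0 := by
      filter_upwards [ae_rho_pos] with x hx using ne_zero_of_rho_pos hx
    filter_upwards [hb, h0] with x hx hx0
    have hr : 0 < ‖x‖ := norm_pos_iff.2 hx0
    have e : flux n x = s x * ((P x * rho x) * dRho (logCut n) x
        + (P x * x 2 + Q x) * dZed (logCut n) x) := by
      simp only [hflux, fderiv_self_eq, dZed]; ring
    have h1 := (abs_dRho_le (logCut n) x).trans (hM n x)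
    have h2 := (abs_dZed_le (logCut n) x).trans (hM n x)
    rw [e, norm_mul, norm_eq_abs, norm_eq_abs]
    calc |s x| * |(P x * rho x) * dRho (logCut n) x + (P x * x 2 + Q x) * dZed (logCut n) x|
        ≤ |s x| * (|P x * rho x| * (M / ((n + 1) * ‖x‖))
          + |P x * x 2 + Q x| * (M / ((n + 1) * ‖x‖))) := by
          refine mul_le_mul_of_nonneg_left ((abs_add_le _ _).trans ?_) (abs_nonneg _)
          rw [abs_mul, abs_mul (P x * x 2 + Q x)]
          gcongr
      _ = |s x| * (|P x * rho x| + |P x * x 2 + Q x|) * (M / ((n + 1) * ‖x‖)) := by ring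
      _ ≤ H x * ‖x‖ * (M / ((n + 1) * ‖x‖)) := by gcongr
      _ = _ := by field_simp
  have hfint : ∀ n, Integrable (flux n) := by
    intro n
    refine (hH.const_mul (M / (n + 1))).mono' ?_ (hbound n)
    have hc : Continuous (fderiv ℝ (logCut n)) := (contDiff_logCut n).continuous_fderiv (by simp)
    have hm1 : Measurable (fun x => fderiv ℝ (logCut n) x x) :=
      (hc.clm_apply continuous_id).measurable
    have hm2 : Measurable (fun x => fderiv ℝ (logCut n) x eZed) :=
      (hc.clm_apply continuous_const).measurable
    exact (hs.continuous.measurable.mul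
      ((hPm.mul hm1).add (hQm.mul hm2))).aestronglyMeasurable
  have hint : ∀ n, Integrable fun x => logCut n x *
      (P x * fderiv ℝ s x x + Q x * fderiv ℝ s x eZed + s x * fieldDiv P Q x) := by
    intro n
    refine (((hfield n).1.congr (hae n)).sub (hfint n)).congr (ae_of_all _ fun x => ?_)
    simp
  refine ⟨hint, ?_⟩
  have hval : ∀ n, ∫ x, logCut n x *
      (P x * fderiv ℝ s x x + Q x * fderiv ℝ s x eZed + s x * fieldDiv P Q x)
      = -∫ x, flux n x := by
    intro n
    have := (hfield n).2
    rw [integral_congr_ae (hae n), integral_add (hint n) (hfint n)] at this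
    linarith
  simp_rw [hval]
  rw [← neg_zero]
  refine Tendsto.neg ?_
  refine squeeze_zero_norm (a := fun n : ℕ => M * (∫ x, H x) * (1 / ((n : ℝ) + 1))) (fun n => ?_) ?_
  · calc ‖∫ x, flux n x‖ ≤ ∫ x, M / (n + 1) * H x :=
        norm_integral_le_of_norm_le (hH.const_mul _) (hbound n)
      _ = _ := by rw [integral_const_mul]; ring
  · simpa using tendsto_one_div_add_atTop_nhds_zero_nat.const_mul (M * ∫ x, H x)

/-! ### Perturbations -/

/-- The tangent vector of the rotations about the axis. -/
def rotField (x : E3) : E3 := !₂[-x 1, x 0, 0]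

/-- Rotating `x` about the axis gives a curve on which `f` is constant. -/
lemma fderiv_rotField_eq_zero {f : E3 → ℝ} (hf : Axisymmetric f) {x : E3}
    (hd : DifferentiableAt ℝ f x) : fderiv ℝ f x (rotField x) = 0 := by
  set γ : ℝ → E3 := fun t =>
    !₂[x 0 * cos t - x 1 * sin t, x 0 * sin t + x 1 * cos t, x 2] with hγdef
  have hγ : HasDerivAt γ (rotField x) 0 := by
    have h1 : HasDerivAt (fun t => x 0 * cos t - x 1 * sin t) (-x 1) 0 := by
      simpa using ((hasDerivAt_cos 0).const_mul (x 0)).fun_sub ((hasDerivAt_sin 0).const_mul (x 1))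
    have h2 : HasDerivAt (fun t => x 0 * sin t + x 1 * cos t) (x 0) 0 := by
      simpa using ((hasDerivAt_sin 0).const_mul (x 0)).fun_add ((hasDerivAt_cos 0).const_mul (x 1))
    have h3 : HasDerivAt (fun t => ![x 0 * cos t - x 1 * sin t, x 0 * sin t + x 1 * cos t, x 2])
        ![-x 1, x 0, 0] 0 := by
      rw [hasDerivAt_pi]
      intro i
      fin_cases i
      · exact h1
      · exact h2
      · exact hasDerivAt_const _ _
    exact ((PiLp.continuousLinearEquiv 2 ℝ (fun _ : Fin 3 => ℝ)).symm : (Fin 3 → ℝ) →L[ℝ] E3).hasFDerivAt.comp_hasDerivAt 0 h3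
  have h0 : γ 0 = x := by ext i; fin_cases i <;> simp [hγdef]
  have hconst : ∀ t, f (γ t) = f x := by
    intro t
    refine hf _ _ ?_ ?_
    · simp only [rho, hγdef]
      congr 1
      simp
      nlinarith [sin_sq_add_cos_sq t]
    · simp [zed, hγdef]
  have hc : HasDerivAt (f ∘ γ) (fderiv ℝ f x (rotField x)) 0 := by
    refine HasFDerivAt.comp_hasDerivAt 0 ?_ hγ
    rw [h0]; exact hd.hasFDerivAt
  have hc2 : f ∘ γ = fun _ => f x := funext hconst
  rw [hc2] at hc
  exact hc.unique (hasDerivAt_const _ _)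

lemma eq_smul_frame {x : E3} (hx : 0 < rho x) (v : E3) :
    v = ((x 0 * v 0 + x 1 * v 1) / rho x) • eRho x
      + ((x 0 * v 1 - x 1 * v 0) / rho x ^ 2) • rotField x + v 2 • eZed := by
  have h := rho_sq x
  ext i; fin_cases i
  · simp [eRho, eZed, rotField]
    field_simp
    rw [h]; ring
  · simp [eRho, eZed, rotField]
    field_simp
    rw [h]; ring
  · simp [eRho, eZed, rotField]

lemma norm_fderiv_le_of_axisymmetric {f : E3 → ℝ} (hf : Axisymmetric f) {x : E3} (hx : 0 < rho x)
    (hd : DifferentiableAt ℝ f x) : ‖fderiv ℝ f x‖ ≤ |dRho f x| + |dZed f x| := by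
  refine ContinuousLinearMap.opNorm_le_bound _ (by positivity) fun v => ?_
  have h := congrArg (fderiv ℝ f x) (eq_smul_frame hx v)
  rw [map_add, map_add, map_smul, map_smul, map_smul, fderiv_rotField_eq_zero hf hd] at h
  have h1 : |(x 0 * v 0 + x 1 * v 1) / rho x| ≤ ‖v‖ := by
    rw [abs_div, abs_of_pos hx, div_le_iff₀ hx]
    apply abs_le_of_sq_le_sq _ (by positivity)
    rw [mul_pow, norm_sq_eq, rho_sq]
    nlinarith [sq_nonneg (x 0 * v 1 - x 1 * v 0), mul_nonneg (sq_nonneg (v 2))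
      (add_nonneg (sq_nonneg (x 0)) (sq_nonneg (x 1)))]
  have h2 := abs_zed_le_norm v
  rw [h, smul_zero, add_zero, smul_eq_mul, smul_eq_mul, norm_eq_abs]
  refine (abs_add_le _ _).trans ?_
  rw [abs_mul, abs_mul]
  change |(x 0 * v 0 + x 1 * v 1) / rho x| * |dRho f x| + |v 2| * |dZed f x| ≤ _
  nlinarith [abs_nonneg (dRho f x), abs_nonneg (dZed f x)]

lemma bounds_of_weightedC1_le {β K : ℝ} {f : E3 → ℝ} {x : E3} (h : weightedC1 β f x ≤ K) :
    |f x| ≤ K * sigma x ^ β ∧ |dRho f x| ≤ K * sigma x ^ (β - 1) ∧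
      |dZed f x| ≤ K * sigma x ^ (β - 1) := by
  have hs := sigma_pos x
  unfold weightedC1 at h
  have h1 : 0 ≤ sigma x ^ (-β) * |f x| := by positivity
  have h2 : 0 ≤ sigma x ^ (-β + 1) * √(partialSq f x) := by positivity
  have e1 : sigma x ^ (-β) * sigma x ^ β = 1 := by rw [← rpow_add hs]; simp
  have e2 : sigma x ^ (-β + 1) * sigma x ^ (β - 1) = 1 := by
    rw [← rpow_add hs, show -β + 1 + (β - 1) = 0 by ring, rpow_zero]
  have h3 : √(partialSq f x) ≤ K * sigma x ^ (β - 1) := by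
    calc √(partialSq f x) = sigma x ^ (-β + 1) * √(partialSq f x) * sigma x ^ (β - 1) := by
          linear_combination (-√(partialSq f x)) * e2
      _ ≤ _ := by gcongr; linarith
  refine ⟨?_, ?_, ?_⟩
  · calc |f x| = sigma x ^ (-β) * |f x| * sigma x ^ β := by linear_combination (-|f x|) * e1
      _ ≤ _ := by gcongr; linarith
  · refine (abs_le_sqrt ?_).trans h3
    unfold partialSq; nlinarith [sq_nonneg (dZed f x)]
  · refine (abs_le_sqrt ?_).trans h3
    unfold partialSq; nlinarith [sq_nonneg (dRho f x)]

lemma rpow_sigma_le_one {γ : ℝ} (hγ : γ ≤ 0) (x : E3) : sigma x ^ γ ≤ 1 :=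
  rpow_le_one_of_one_le_of_nonpos (one_le_sigma x) hγ

lemma mem_compl_cylinder {ρ₀ : ℝ} {x : E3} : x ∈ (cylinder ρ₀)ᶜ ↔ ρ₀ < rho x := by
  simp [cylinder]

section Perturbation
variable {J β ρ₀ : ℝ} {α y : E3 → ℝ}

lemma exists_bound_of_mem_perturbations (h : (α, y) ∈ perturbations β ρ₀) :
    ∃ K : ℝ, 0 < K ∧
      (∀ x, |α x| ≤ K * sigma x ^ β ∧ |dRho α x| ≤ K * sigma x ^ (β - 1) ∧
        |dZed α x| ≤ K * sigma x ^ (β - 1)) ∧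
      (∀ x, ρ₀ < rho x → |y x| ≤ K * sigma x ^ β ∧ |dRho y x| ≤ K * sigma x ^ (β - 1) ∧
        |dZed y x| ≤ K * sigma x ^ (β - 1)) := by
  obtain ⟨-, -, ⟨-, K, hK⟩, -, -, ⟨-, L, hL⟩⟩ := h
  refine ⟨max (max K L) 1, lt_max_of_lt_right one_pos, fun x => ?_, fun x hx => ?_⟩
  · exact bounds_of_weightedC1_le ((hK ⟨x, mem_univ x, rfl⟩).trans
      ((le_max_left _ _).trans (le_max_left _ _)))
  · exact bounds_of_weightedC1_le ((hL ⟨x, mem_compl_cylinder.2 hx, rfl⟩).trans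
      ((le_max_right _ _).trans (le_max_left _ _)))

lemma contDiff_fst_of_mem (h : (α, y) ∈ perturbations β ρ₀) : ContDiff ℝ 1 α :=
  contDiffOn_univ.1 h.2.2.1.1

lemma contDiffAt_snd_of_mem (h : (α, y) ∈ perturbations β ρ₀) {x : E3} (hx : ρ₀ < rho x) :
    ContDiffAt ℝ 1 y x :=
  h.2.2.2.2.2.1.contDiffAt ((isClosed_cylinder ρ₀).isOpen_compl.mem_nhds (mem_compl_cylinder.2 hx))

lemma snd_eq_zero_of_mem (h : (α, y) ∈ perturbations β ρ₀) {x : E3} (hx : rho x ≤ ρ₀) : y x = 0 :=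
  h.2.2.2.2.1 x hx

lemma snd_eventually_eq_zero_of_mem (h : (α, y) ∈ perturbations β ρ₀) {x : E3} (hx : rho x < ρ₀) :
    y =ᶠ[𝓝 x] fun _ => 0 := by
  filter_upwards [(isOpen_lt continuous_rho continuous_const).mem_nhds hx] with z hz
  exact snd_eq_zero_of_mem h (le_of_lt hz)

lemma contDiffAt_snd_of_mem_of_ne (h : (α, y) ∈ perturbations β ρ₀) {x : E3} (hx : rho x ≠ ρ₀) :
    ContDiffAt ℝ 1 y x := by
  rcases hx.lt_or_gt with hx | hx
  · exact contDiffAt_const.congr_of_eventuallyEq (snd_eventually_eq_zero_of_mem h hx)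
  · exact contDiffAt_snd_of_mem h hx

/-- Differentiability of `y` across `ρ = ρ₀` is not available. However, `y` is continuous, and
wherever it is nonzero its full gradient is bounded, by axisymmetry, by the sum of the `ρ` and `z`
derivatives; hence the constant `2 * K`. -/
lemma locallyLipschitz_snd_of_mem (h : (α, y) ∈ perturbations β ρ₀) (hβ : β < 0) (hρ₀ : 0 < ρ₀) :
    LocallyLipschitz y := by
  obtain ⟨K, hK0, -, hK⟩ := exists_bound_of_mem_perturbations h
  refine (lipschitzWith_of_fderiv_bound_off_zeros (L := 2 * K) (by positivity) h.2.2.2.1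
    fun x hx => ?_).locallyLipschitz
  have hx' : ρ₀ < rho x := by
    by_contra hc
    exact hx (snd_eq_zero_of_mem h (not_lt.1 hc))
  have hd := (contDiffAt_snd_of_mem h hx').differentiableAt (by simp)
  refine ⟨hd, (norm_fderiv_le_of_axisymmetric h.2.1 (hρ₀.trans hx') hd).trans ?_⟩
  obtain ⟨-, h1, h2⟩ := hK x hx'
  have := mul_le_mul_of_nonneg_left (rpow_sigma_le_one (γ := β - 1) (by linarith) x) hK0.le
  linarith

lemma tsupport_snd_subset_of_mem (h : (α, y) ∈ perturbations β ρ₀) {f : E3 → ℝ}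
    (hf : ∀ x, y x = 0 → f x = 0) : tsupport f ⊆ {x | ρ₀ ≤ rho x} := by
  refine closure_minimal (fun x hx => ?_) (isClosed_le continuous_const continuous_rho)
  by_contra hc
  exact hx (hf x (snd_eq_zero_of_mem h (not_le.1 hc).le))

lemma contDiffAt_kerrX {x : E3} (hx : 0 < rho x) : ContDiffAt ℝ 1 (kerrX J) x := by
  have hx0 := ne_zero_of_rho_pos hx
  have hD := (kerrDen_pos (z := x 2) (sqrt_nonneg |J|) (norm_pos_iff.2 hx0)).ne'
  have hn := contDiffAt_norm ℝ (n := 1) hx0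
  have hz : ContDiffAt ℝ 1 (fun x : E3 => x 2) x := by fun_prop
  have h : ContDiffAt ℝ 1 (fun x : E3 => kerrNum √|J| ‖x‖ (x 2) * (‖x‖ ^ 2 - x 2 ^ 2)
      / kerrDen √|J| ‖x‖ (x 2)) x :=
    ((contDiffAt_kerrNum hx0).mul ((hn.pow 2).sub (hz.pow 2))).div (contDiffAt_kerrDen hx0) hD
  refine h.congr_of_eventuallyEq ?_
  filter_upwards [isOpen_rho_pos.mem_nhds hx] with z hz
  rw [kerrX_eq (ne_zero_of_rho_pos hz), rho_sq_eq]

/-- The horizontal perturbation `y / X₀` in units of the height. -/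
def scaledTwist (J : ℝ) (y : E3 → ℝ) (x : E3) : ℝ := y x * (kerrX J x)⁻¹

lemma locallyLipschitz_scaledTwist (h : (α, y) ∈ perturbations β ρ₀) (hβ : β < 0) (hρ₀ : 0 < ρ₀) :
    LocallyLipschitz (scaledTwist J y) := by
  refine LipschitzNear.mul_of_tsupport_subset isOpen_rho_pos
    (locallyLipschitz_snd_of_mem h hβ hρ₀) (f := fun x => (kerrX J x)⁻¹) (fun x hx => ?_) ?_
  · exact ((contDiffAt_kerrX hx).inv (kerrX_pos hx).ne').contDiffWithinAt
  · exact (tsupport_snd_subset_of_mem h fun x hx => hx).trans fun x hx => hρ₀.trans_le hx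

lemma locallyLipschitz_comp_two {Φ : ℝ × ℝ → ℝ} (hΦ : LocallyLipschitz Φ) {f g : E3 → ℝ}
    (hf : LocallyLipschitz f) (hg : LocallyLipschitz g) :
    LocallyLipschitz (fun x => Φ (f x, g x)) := hΦ.comp (hf.prodMk hg)

lemma contDiff_coshDist : ContDiff ℝ 1 (fun p : ℝ × ℝ => coshDist p.1 p.2) := by
  unfold coshDist; fun_prop

lemma contDiff_vertDir : ContDiff ℝ 1 (fun p : ℝ × ℝ => vertDir p.1 p.2) := by
  unfold vertDir; fun_prop

lemma locallyLipschitz_arcoshDivSinh_comp {f g : E3 → ℝ}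
    (hf : LocallyLipschitz f) (hg : LocallyLipschitz g) :
    LocallyLipschitz (fun x => arcoshDivSinh (coshDist (f x) (g x))) :=
  lipschitzWith_arcoshDivSinh.locallyLipschitz.comp
    (locallyLipschitz_comp_two contDiff_coshDist.locallyLipschitz hf hg)

lemma locallyLipschitz_vertVel {f g : E3 → ℝ}
    (hf : LocallyLipschitz f) (hg : LocallyLipschitz g) :
    LocallyLipschitz (fun x => f x + vertExcess (f x) (g x)) := by
  have := (locallyLipschitz_arcoshDivSinh_comp hf hg).mul_real
    (locallyLipschitz_comp_two contDiff_vertDir.locallyLipschitz hf hg)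
  simpa [vertExcess] using this

lemma locallyLipschitz_vertExcess {f g : E3 → ℝ}
    (hf : LocallyLipschitz f) (hg : LocallyLipschitz g) :
    LocallyLipschitz (fun x => vertExcess (f x) (g x)) := by
  have h : ContDiff ℝ 1 (fun p : ℝ × ℝ => p.1 - p.2) := by fun_prop
  simpa using locallyLipschitz_comp_two h.locallyLipschitz (locallyLipschitz_vertVel hf hg) hf

/-- The horizontal component of the geodesic velocity, in coordinates. -/
def twistVel (J : ℝ) (α y : E3 → ℝ) (x : E3) : ℝ :=
  arcoshDivSinh (coshDist (α x) (scaledTwist J y x)) * (exp (-α x) * y x)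

lemma locallyLipschitz_twistVel (h : (α, y) ∈ perturbations β ρ₀) (hβ : β < 0) (hρ₀ : 0 < ρ₀) :
    LocallyLipschitz (twistVel J α y) := by
  have hα := (contDiff_fst_of_mem h).locallyLipschitz
  have hy := locallyLipschitz_snd_of_mem h hβ hρ₀
  have he : ContDiff ℝ 1 (fun p : ℝ × ℝ => exp (-p.1) * p.2) := by fun_prop
  exact (locallyLipschitz_arcoshDivSinh_comp hα (locallyLipschitz_scaledTwist h hβ hρ₀)).mul_real
    (locallyLipschitz_comp_two he.locallyLipschitz hα hy)

end Perturbation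

/-! ### Derivatives of the geodesic velocity -/

section OneVariable
variable {α w : ℝ → ℝ} {t a c f : ℝ}

lemma hasDerivAt_coshDist (hα : HasDerivAt α c t) (hw : HasDerivAt w (f - a * w t) t) :
    HasDerivAt (fun s => coshDist (α s) (w s)) (coshDistRate (α t) (w t) a c f) t := by
  refine (hα.cosh.fun_add ((hα.fun_neg.exp.fun_mul (hw.fun_pow 2)).div_const 2)).congr_deriv ?_
  unfold coshDistRate
  push_cast
  ring

lemma hasDerivAt_vertDir (hα : HasDerivAt α c t) (hw : HasDerivAt w (f - a * w t) t) :
    HasDerivAt (fun s => vertDir (α s) (w s)) (vertDirRate (α t) (w t) a c f) t := by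
  refine (hα.sinh.fun_add ((hα.fun_neg.exp.fun_mul (hw.fun_pow 2)).div_const 2)).congr_deriv ?_
  unfold vertDirRate
  push_cast
  ring

lemma hasDerivAt_arcoshDivSinh_coshDist (hα : HasDerivAt α c t)
    (hw : HasDerivAt w (f - a * w t) t) :
    HasDerivAt (fun s => arcoshDivSinh (coshDist (α s) (w s)))
      (arcoshDivSinhSlope (α t) (w t) * coshDistRate (α t) (w t) a c f) t := by
  have h := (hasFDerivAt_arcoshDivSinh_comp (hasDerivAt_coshDist hα hw).hasFDerivAt
    fun s => one_le_coshDist _ _).hasDerivAt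
  refine h.congr_deriv ?_
  simp [arcoshDivSinhSlope]

lemma hasDerivAt_vertExcess (hα : HasDerivAt α c t) (hw : HasDerivAt w (f - a * w t) t) :
    HasDerivAt (fun s => vertExcess (α s) (w s)) (vertExcessRate (α t) (w t) a c f) t :=
  ((hasDerivAt_arcoshDivSinh_coshDist hα hw).fun_mul (hasDerivAt_vertDir hα hw)).fun_sub hα

end OneVariable

lemma _root_.DifferentiableAt.hasDerivAt_line {f : E3 → ℝ} {x : E3} (hf : DifferentiableAt ℝ f x)
    (v : E3) : HasDerivAt (fun t : ℝ => f (x + t • v)) (fderiv ℝ f x v) 0 := by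
  have h1 : HasDerivAt (fun t : ℝ => x + t • v) v 0 := by
    simpa using ((hasDerivAt_id (0 : ℝ)).smul_const v).const_add x
  refine HasFDerivAt.comp_hasDerivAt (0 : ℝ) (f := fun t : ℝ => x + t • v) ?_ h1
  simpa using hf.hasFDerivAt

section Pointwise
variable {J : ℝ} {α y : E3 → ℝ} {x : E3}

/-- The derivative of `log X₀ = v₀ + 2 log ρ`. -/
def logXDeriv (J : ℝ) (x v : E3) : ℝ :=
  fderiv ℝ (kerrV J) x v + 2 * (inner ℝ x v - x 2 * v 2) / rho x ^ 2

lemma kerrX_eq_exp (hx : 0 < rho x) : kerrX J x = exp (kerrV J x) * (‖x‖ ^ 2 - x 2 ^ 2) := by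
  rw [← rho_sq_eq, kerrV, exp_sub, exp_log (kerrX_pos hx), show 2 * log (rho x)
    = log (rho x ^ 2) by rw [log_pow]; push_cast; ring, exp_log (by positivity)]
  field_simp

lemma hasDerivAt_kerrX_line (hx : 0 < rho x) (v : E3) :
    HasDerivAt (fun t : ℝ => kerrX J (x + t • v)) (kerrX J x * logXDeriv J x v) 0 := by
  have hx0 := ne_zero_of_rho_pos hx
  have hr := norm_pos_iff.2 hx0
  have hV := (((contDiffAt_kerrV (J := J) hx).differentiableAt (by simp)).hasDerivAt_line v).exp
  have hq := ((hasDerivAt_norm_line hx0 v).fun_pow 2).fun_sub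
    ((hasDerivAt_coord_line x v 2).fun_pow 2)
  have hev : (fun t : ℝ => kerrX J (x + t • v)) =ᶠ[𝓝 0] fun t => exp (kerrV J (x + t • v))
      * (‖x + t • v‖ ^ 2 - (x + t • v) 2 ^ 2) := by
    have hc : Continuous fun t : ℝ => x + t • v := by fun_prop
    have : ∀ᶠ t : ℝ in 𝓝 0, 0 < rho (x + t • v) :=
      hc.continuousAt.eventually (isOpen_rho_pos.mem_nhds (by simpa using hx))
    filter_upwards [this] with t ht using kerrX_eq_exp ht
  refine ((hV.fun_mul hq).congr_of_eventuallyEq hev).congr_deriv ?_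
  simp only [zero_smul, add_zero]
  rw [logXDeriv, kerrX_eq_exp hx, rho_sq_eq]
  have := (norm_sq_sub_pos hx).ne'
  field_simp
  push_cast
  ring

lemma differentiableAt_scaledTwist (hx : 0 < rho x) (hy : DifferentiableAt ℝ y x) :
    DifferentiableAt ℝ (scaledTwist J y) x :=
  hy.mul (((contDiffAt_kerrX hx).differentiableAt (by simp)).inv (kerrX_pos hx).ne')

/-- Differentiating `X₀⁻¹` produces the term `-a w`, which explains the combination `f - a * w` in
all the rates. The base point is kept as `x + 0 • v` to match the one-variable lemmas at `t = 0`. -/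
lemma hasDerivAt_scaledTwist_line (hx : 0 < rho x) (hy : DifferentiableAt ℝ y x) (v : E3) :
    HasDerivAt (fun t : ℝ => scaledTwist J y (x + t • v))
      (fderiv ℝ y x v / kerrX J x - logXDeriv J x v * scaledTwist J y (x + (0 : ℝ) • v)) 0 := by
  have hX := (kerrX_pos (J := J) hx).ne'
  refine ((hy.hasDerivAt_line v).fun_mul ((hasDerivAt_kerrX_line (J := J) hx v).fun_inv
    (by simpa using hX))).congr_deriv ?_
  simp only [zero_smul, add_zero, scaledTwist]
  field_simp
  ring

lemma differentiableAt_coshDist_comp (hx : 0 < rho x) (hα : DifferentiableAt ℝ α x)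
    (hy : DifferentiableAt ℝ y x) :
    DifferentiableAt ℝ (fun x => coshDist (α x) (scaledTwist J y x)) x := by
  have hw := differentiableAt_scaledTwist (J := J) hx hy
  exact ((contDiff_coshDist.differentiable (by simp)) (α x, scaledTwist J y x)).comp x
    (hα.prodMk hw)

lemma differentiableAt_arcoshDivSinh_comp (hx : 0 < rho x) (hα : DifferentiableAt ℝ α x)
    (hy : DifferentiableAt ℝ y x) :
    DifferentiableAt ℝ (fun x => arcoshDivSinh (coshDist (α x) (scaledTwist J y x))) x :=
  (hasFDerivAt_arcoshDivSinh_comp (differentiableAt_coshDist_comp hx hα hy).hasFDerivAt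
    fun _ => one_le_coshDist _ _).differentiableAt

lemma differentiableAt_vertExcess_comp (hx : 0 < rho x) (hα : DifferentiableAt ℝ α x)
    (hy : DifferentiableAt ℝ y x) :
    DifferentiableAt ℝ (fun x => vertExcess (α x) (scaledTwist J y x)) x := by
  have hw := differentiableAt_scaledTwist (J := J) hx hy
  have : DifferentiableAt ℝ (fun x => vertDir (α x) (scaledTwist J y x)) x :=
    DifferentiableAt.comp x (g := fun p : ℝ × ℝ => vertDir p.1 p.2)
      ((contDiff_vertDir.differentiable (by simp)) (α x, scaledTwist J y x)) (hα.prodMk hw)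
  exact ((differentiableAt_arcoshDivSinh_comp hx hα hy).mul this).sub hα

lemma differentiableAt_twistVel (hx : 0 < rho x) (hα : DifferentiableAt ℝ α x)
    (hy : DifferentiableAt ℝ y x) : DifferentiableAt ℝ (twistVel J α y) x :=
  (differentiableAt_arcoshDivSinh_comp hx hα hy).mul (hα.neg.exp.mul hy)

lemma fderiv_coshDist_comp (hx : 0 < rho x) (hα : DifferentiableAt ℝ α x)
    (hy : DifferentiableAt ℝ y x) (v : E3) :
    fderiv ℝ (fun x => coshDist (α x) (scaledTwist J y x)) x v
      = coshDistRate (α x) (scaledTwist J y x) (logXDeriv J x v) (fderiv ℝ α x v)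
        (fderiv ℝ y x v / kerrX J x) := by
  have h := hasDerivAt_coshDist (hα.hasDerivAt_line v)
    (hasDerivAt_scaledTwist_line (J := J) hx hy v)
  rw [fderiv_eq_of_hasDerivAt_line (differentiableAt_coshDist_comp hx hα hy) h]
  simp

lemma fderiv_vertExcess_comp (hx : 0 < rho x) (hα : DifferentiableAt ℝ α x)
    (hy : DifferentiableAt ℝ y x) (v : E3) :
    fderiv ℝ (fun x => vertExcess (α x) (scaledTwist J y x)) x v
      = vertExcessRate (α x) (scaledTwist J y x) (logXDeriv J x v) (fderiv ℝ α x v)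
        (fderiv ℝ y x v / kerrX J x) := by
  have h := hasDerivAt_vertExcess (hα.hasDerivAt_line v)
    (hasDerivAt_scaledTwist_line (J := J) hx hy v)
  rw [fderiv_eq_of_hasDerivAt_line (differentiableAt_vertExcess_comp hx hα hy) h]
  simp

lemma fderiv_twistVel (hx : 0 < rho x) (hα : DifferentiableAt ℝ α x)
    (hy : DifferentiableAt ℝ y x) (v : E3) :
    fderiv ℝ (twistVel J α y) x v = kerrX J x *
      horizVelRate (α x) (scaledTwist J y x) (logXDeriv J x v) (fderiv ℝ α x v)
        (fderiv ℝ y x v / kerrX J x) := by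
  have hX := (kerrX_pos (J := J) hx).ne'
  have h := (hasDerivAt_arcoshDivSinh_coshDist (hα.hasDerivAt_line v)
    (hasDerivAt_scaledTwist_line (J := J) hx hy v)).fun_mul
    ((hα.hasDerivAt_line v).fun_neg.exp.fun_mul (hy.hasDerivAt_line v))
  rw [fderiv_eq_of_hasDerivAt_line (differentiableAt_twistVel hx hα hy) h]
  simp only [zero_smul, add_zero, horizVelRate]
  have e : y x = kerrX J x * scaledTwist J y x := by
    simp only [scaledTwist]; field_simp
  rw [e]
  field_simp
  ring

end Pointwise

/-! ### The mass density of a perturbation -/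

/-- The part of the mass density difference which remains after subtraction of divergences. -/
def massExcess (J : ℝ) (α y : E3 → ℝ) (x : E3) : ℝ :=
  energyExcess (α x) (scaledTwist J y x) (logXDeriv J x (eRho x)) (dRho (kerrY J) x / kerrX J x)
      (dRho α x) (dRho y x / kerrX J x)
    + energyExcess (α x) (scaledTwist J y x) (logXDeriv J x eZed) (dZed (kerrY J) x / kerrX J x)
      (dZed α x) (dZed y x / kerrX J x)

section Density
variable {J : ℝ} {α y : E3 → ℝ} {x : E3}

lemma massExcess_nonneg : 0 ≤ massExcess J α y x :=
  add_nonneg (energyExcess_ge _ _ _ _ _ _).1 (energyExcess_ge _ _ _ _ _ _).1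

lemma dZed_coshDist_sq_le (hx : 0 < rho x) (hα : DifferentiableAt ℝ α x)
    (hy : DifferentiableAt ℝ y x) :
    dZed (fun x => coshDist (α x) (scaledTwist J y x)) x ^ 2
      ≤ (coshDist (α x) (scaledTwist J y x) ^ 2 - 1) * massExcess J α y x := by
  rw [dZed, fderiv_coshDist_comp hx hα hy]
  refine (energyExcess_ge _ _ _ (dZed (kerrY J) x / kerrX J x) _ _).2.trans ?_
  have h1 : 0 ≤ coshDist (α x) (scaledTwist J y x) ^ 2 - 1 := by
    nlinarith [one_le_coshDist (α x) (scaledTwist J y x)]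
  rw [massExcess, mul_add]
  exact le_add_of_nonneg_left (mul_nonneg h1 (energyExcess_ge _ _ _ _ _ _).1)

lemma massDensity_add (hx : 0 < rho x) (hα : DifferentiableAt ℝ α x)
    (hy : DifferentiableAt ℝ y x) :
    massDensity (kerrData J + (α, y)) x
      = (dRho (kerrV J) x + dRho α x) ^ 2 + (dZed (kerrV J) x + dZed α x) ^ 2
        + (kerrX J x ^ 2)⁻¹ * exp (-α x) ^ 2 *
          ((dRho (kerrY J) x + dRho y x) ^ 2 + (dZed (kerrY J) x + dZed y x) ^ 2) := by
  have hV := (contDiffAt_kerrV (J := J) hx).differentiableAt (by simp)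
  have hY := (contDiffAt_kerrY (J := J) hx).differentiableAt (by simp)
  have e1 : fderiv ℝ (kerrV J + α) x = fderiv ℝ (kerrV J) x + fderiv ℝ α x := fderiv_add hV hα
  have e2 : fderiv ℝ (kerrY J + y) x = fderiv ℝ (kerrY J) x + fderiv ℝ y x := fderiv_add hY hy
  simp only [massDensity, kerrData, Prod.mk_add_mk, partialSq, dRho, dZed, e1, e2,
    add_apply, Pi.add_apply]
  rw [mul_add (-2 : ℝ), exp_add, ← mul_assoc, rho_zpow_mul_exp hx, show -2 * α x = -α x + -α x by ring,
    exp_add, ← sq]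

lemma logXDeriv_eRho (hx : 0 < rho x) :
    logXDeriv J x (eRho x) = dRho (kerrV J) x + 2 / rho x := by
  rw [logXDeriv, inner_eRho hx, eRho_two, dRho]
  field_simp
  ring

lemma logXDeriv_eZed : logXDeriv J x eZed = dZed (kerrV J) x := by
  rw [logXDeriv, inner_eZed, eZed_two, dZed]
  simp

/-- The change of the mass density is a divergence up to the nonnegative `massExcess`. -/
lemma massDensity_sub_eq (hx : 0 < rho x) (hα : DifferentiableAt ℝ α x)
    (hy : DifferentiableAt ℝ y x) :
    massDensity (kerrData J + (α, y)) x - massDensity (kerrData J) x = massExcess J α y x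
      + 2 * (gradVx √|J| ‖x‖ (x 2)
            * fderiv ℝ (fun x => α x + vertExcess (α x) (scaledTwist J y x)) x x
          + gradVz √|J| ‖x‖ (x 2)
            * fderiv ℝ (fun x => α x + vertExcess (α x) (scaledTwist J y x)) x eZed
          + (α x + vertExcess (α x) (scaledTwist J y x))
            * fieldDiv (fun x => gradVx √|J| ‖x‖ (x 2)) (fun x => gradVz √|J| ‖x‖ (x 2)) x)
      + 4 * (1 / (‖x‖ ^ 2 - x 2 ^ 2)
            * fderiv ℝ (fun x => vertExcess (α x) (scaledTwist J y x)) x x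
          + -(x 2 / (‖x‖ ^ 2 - x 2 ^ 2))
            * fderiv ℝ (fun x => vertExcess (α x) (scaledTwist J y x)) x eZed
          + vertExcess (α x) (scaledTwist J y x)
            * fieldDiv (fun x => 1 / (‖x‖ ^ 2 - x 2 ^ 2))
              (fun x => -(x 2 / (‖x‖ ^ 2 - x 2 ^ 2))) x)
      + 2 * (fluxYx J √|J| ‖x‖ (x 2) * fderiv ℝ (twistVel J α y) x x
          + fluxYz J √|J| ‖x‖ (x 2) * fderiv ℝ (twistVel J α y) x eZed
          + twistVel J α y x
            * fieldDiv (fun x => fluxYx J √|J| ‖x‖ (x 2)) (fun x => fluxYz J √|J| ‖x‖ (x 2)) x) := by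
  have hm := sqrt_nonneg |J|
  have hX := (kerrX_pos (J := J) hx).ne'
  have hG := differentiableAt_vertExcess_comp (J := J) hx hα hy
  have h0 : massDensity (kerrData J) x = massDensity (kerrData J + (fun _ => (0 : ℝ), fun _ => (0 : ℝ))) x := by
    congr 1
    simp [kerrData, Prod.ext_iff, funext_iff]
  have hz : ∀ v : E3, fderiv ℝ (fun _ : E3 => (0 : ℝ)) x v = 0 := by simp
  rw [h0, massDensity_add hx hα hy, massDensity_add hx (by simp) (by simp),
    fieldDiv_gradV hm (ne_zero_of_rho_pos hx), fieldDiv_log_rho hx, fieldDiv_fluxY hm hx]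
  have hV1 : ∀ v, fderiv ℝ (fun x => α x + vertExcess (α x) (scaledTwist J y x)) x v
      = fderiv ℝ α x v + fderiv ℝ (fun x => vertExcess (α x) (scaledTwist J y x)) x v := by
    intro v
    rw [fderiv_fun_add hα hG]; rfl
  have hYr := dRho_kerrY (J := J) hx
  have hYz := dZed_kerrY (J := J) hx
  have hVr := dRho_kerrV (J := J) hx
  have hVz := dZed_kerrV (J := J) hx
  have hb : twistSq √|J| ‖x‖ (x 2)
      = (dRho (kerrY J) x / kerrX J x) ^ 2 + (dZed (kerrY J) x / kerrX J x) ^ 2 := by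
    have := partialSq_kerrY (J := J) hx
    rw [partialSq] at this
    field_simp
    linarith
  simp only [fderiv_self_eq]
  simp only [dRho, dZed] at *
  simp only [hV1, fderiv_vertExcess_comp hx hα hy, fderiv_twistVel hx hα hy, hz, ← rho_sq_eq,
    massExcess, dRho, dZed]
  have er : logXDeriv J x (eRho x) = fderiv ℝ (kerrV J) x (eRho x) + 2 / rho x := logXDeriv_eRho hx
  have ez : logXDeriv J x eZed = fderiv ℝ (kerrV J) x eZed := logXDeriv_eZed
  simp only [energyExcess, hb]
  -- The rates of the velocity enter linearly and cancel between `massExcess` and the divergences,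
  -- so they need not be unfolded.
  generalize vertExcessRate (α x) (scaledTwist J y x) (logXDeriv J x (eRho x)) (fderiv ℝ α x (eRho x))
    (fderiv ℝ y x (eRho x) / kerrX J x) = g1
  generalize vertExcessRate (α x) (scaledTwist J y x) (logXDeriv J x eZed) (fderiv ℝ α x eZed)
    (fderiv ℝ y x eZed / kerrX J x) = g2
  generalize horizVelRate (α x) (scaledTwist J y x) (logXDeriv J x (eRho x)) (fderiv ℝ α x (eRho x))
    (fderiv ℝ y x (eRho x) / kerrX J x) = g3
  generalize horizVelRate (α x) (scaledTwist J y x) (logXDeriv J x eZed) (fderiv ℝ α x eZed)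
    (fderiv ℝ y x eZed / kerrX J x) = g4
  rw [er, ez]
  have hex : exp (-(0 : ℝ)) = 1 := by simp
  rw [hYr, hYz, hVr, hVz, hex]
  field_simp
  ring

end Density

/-! ### Measurability -/

lemma measurable_eRho : Measurable eRho := by
  have h : Measurable rho := continuous_rho.measurable
  have h0 : ∀ i : Fin 3, Measurable (fun x : E3 => x i) := fun i =>
    (by fun_prop : Continuous fun x : E3 => x i).measurable
  have : Measurable (fun x : E3 => (![x 0 / rho x, x 1 / rho x, 0] : Fin 3 → ℝ)) := by
    rw [measurable_pi_iff]
    intro i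
    fin_cases i
    · exact (h0 0).div h
    · exact (h0 1).div h
    · exact measurable_const
  exact (MeasurableEquiv.toLp 2 (Fin 3 → ℝ)).measurable.comp this

lemma measurable_dRho (f : E3 → ℝ) : Measurable (dRho f) := by
  have hc : Continuous fun p : (E3 →L[ℝ] ℝ) × E3 => p.1 p.2 := continuous_fst.clm_apply continuous_snd
  exact hc.measurable.comp ((measurable_fderiv ℝ f).prodMk measurable_eRho)

lemma measurable_dZed (f : E3 → ℝ) : Measurable (dZed f) := measurable_fderiv_apply_const ℝ f eZed

lemma measurable_norm_coord {h : ℝ → ℝ → ℝ} (hh : Measurable (Function.uncurry h)) :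
    Measurable (fun x : E3 => h ‖x‖ (x 2)) :=
  hh.comp (measurable_norm.prodMk (by fun_prop : Continuous fun x : E3 => x 2).measurable)

lemma measurable_gradVx (m : ℝ) : Measurable (fun x : E3 => gradVx m ‖x‖ (x 2)) :=
  measurable_norm_coord (by unfold Function.uncurry gradVx kerrNum kerrDen; fun_prop)

lemma measurable_gradVz (m : ℝ) : Measurable (fun x : E3 => gradVz m ‖x‖ (x 2)) :=
  measurable_norm_coord (by unfold Function.uncurry gradVz kerrNum kerrDen; fun_prop)

lemma measurable_fluxYz (J m : ℝ) : Measurable (fun x : E3 => fluxYz J m ‖x‖ (x 2)) :=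
  measurable_norm_coord (by unfold Function.uncurry fluxYz kerrNum kerrAng; fun_prop)

lemma measurable_fluxYx (J m : ℝ) : Measurable (fun x : E3 => fluxYx J m ‖x‖ (x 2)) :=
  measurable_norm_coord (by unfold Function.uncurry fluxYx fluxYz kerrNum kerrAng; fun_prop)

lemma measurable_kerrV (J : ℝ) : Measurable (kerrV J) := by
  have hr : Measurable rho := continuous_rho.measurable
  have hz : Measurable zed := (by fun_prop : Continuous fun x : E3 => x 2).measurable
  have hrad : Measurable rad := by unfold rad; fun_prop
  unfold kerrV kerrX kerrSigma rBL cosTheta sinTheta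
  fun_prop

lemma measurable_massDensity {u : (E3 → ℝ) × (E3 → ℝ)} (hu : Measurable u.1) :
    Measurable (massDensity u) := by
  have hr : Measurable rho := continuous_rho.measurable
  have h1 := measurable_dRho u.1
  have h2 := measurable_dRho u.2
  have h3 := measurable_dZed u.1
  have h4 := measurable_dZed u.2
  unfold massDensity partialSq
  exact ((h1.pow_const 2).add (h3.pow_const 2)).add
    (((hr.pow_const _).mul ((hu.const_mul (-2)).exp)).mul ((h2.pow_const 2).add (h4.pow_const 2)))

/-! ### Integrability of the mass density -/

section Integrability
variable {J β ρ₀ : ℝ} {α y : E3 → ℝ}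

lemma div_norm_mul_sigma_sq (C : ℝ) (x : E3) :
    (C / (‖x‖ * sigma x)) ^ 2 = C ^ 2 * ((‖x‖ ^ 2)⁻¹ * sigma x ^ (-2 : ℝ)) := by
  rw [rpow_neg (sigma_pos x).le, rpow_two, div_pow, mul_pow, div_eq_mul_inv, mul_inv]

lemma sq_mul_rpow_sigma (K : ℝ) (x : E3) :
    (K * sigma x ^ (β - 1)) ^ 2 = K ^ 2 * sigma x ^ (2 * β - 2) := by
  rw [mul_pow, ← rpow_natCast (sigma x ^ (β - 1)), ← rpow_mul (sigma_pos x).le]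
  push_cast
  ring_nf

lemma sq_add_sq_add_le {a b c d A B : ℝ} (ha : |a| ^ 2 ≤ A) (hb : |b| ^ 2 ≤ B) (hc : |c| ^ 2 ≤ A)
    (hd : |d| ^ 2 ≤ B) : (a + b) ^ 2 + (c + d) ^ 2 ≤ 4 * A + 4 * B := by
  rw [sq_abs] at *
  nlinarith [sq_nonneg (a - b), sq_nonneg (c - d)]

/-- The Kerr terms are dominated by `A`, of order `r⁻² σ⁻²`, and the perturbation by `B`, of order
`σ^{2β-2}`. The latter is integrable on `ℝ³` because `2β - 2 < -3`. The quotient `∂y / X₀` is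
harmless since `X₀ ≥ ρ² ≥ ρ₀²` where `y` can be nonzero. -/
lemma integrable_massDensity (hβ : β < -1 / 2) (hρ₀ : 0 < ρ₀)
    (h : (α, y) ∈ perturbations β ρ₀) : Integrable (massDensity (kerrData J + (α, y))) := by
  obtain ⟨K, hK0, hKα, hKy⟩ := exists_bound_of_mem_perturbations h
  have hα := contDiff_fst_of_mem h
  set A : E3 → ℝ := fun x => kerrConst J ^ 2 * ((‖x‖ ^ 2)⁻¹ * sigma x ^ (-2 : ℝ)) with hA
  set B : E3 → ℝ := fun x => K ^ 2 * sigma x ^ (2 * β - 2) with hB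
  have hAi : Integrable A := (integrable_norm_sq_inv_mul_rpow_sigma (by norm_num)).const_mul _
  have hBi : Integrable B := (integrable_rpow_sigma (by linarith)).const_mul _
  have hbd : Integrable fun x => (4 * A x + 4 * B x)
      + exp K ^ 2 * (4 * A x + 4 * ((ρ₀ ^ 4)⁻¹ * B x)) :=
    ((hAi.const_mul 4).add (hBi.const_mul 4)).add
      (((hAi.const_mul 4).add ((hBi.const_mul _).const_mul 4)).const_mul _)
  refine hbd.mono' (measurable_massDensity ?_).aestronglyMeasurable ?_
  · exact (measurable_kerrV J).add hα.continuous.measurable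
  filter_upwards [ae_rho_pos, ae_rho_ne hρ₀] with x hx hne
  have hX := kerrX_pos (J := J) hx
  have hX2 := kerrX_ge (J := J) (ne_zero_of_rho_pos hx)
  have hyd := (contDiffAt_snd_of_mem_of_ne h hne).differentiableAt (by simp)
  have hαd := (hα.differentiable (by simp)) x
  obtain ⟨k1, k2, k3⟩ := hKα x
  have hexp : exp (-α x) ^ 2 ≤ exp K ^ 2 := by
    have h1 := rpow_sigma_le_one (γ := β) (by linarith) x
    have h2 := (abs_le.1 k1).1
    have : -α x ≤ K := by nlinarith
    have := exp_le_exp.2 this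
    gcongr
  have hB' : ∀ t : ℝ, |t| ≤ K * sigma x ^ (β - 1) → |t| ^ 2 ≤ B x := by
    intro t ht
    refine le_of_le_of_eq ?_ (sq_mul_rpow_sigma K x)
    gcongr
  have hA' : ∀ t : ℝ, |t| ≤ kerrConst J / (‖x‖ * sigma x) → |t| ^ 2 ≤ A x := by
    intro t ht
    refine le_of_le_of_eq ?_ (div_norm_mul_sigma_sq _ x)
    gcongr
  have hB0 : 0 ≤ B x := by have := sigma_pos x; rw [hB]; positivity
  have hy' : ∀ t : ℝ, (ρ₀ < rho x → |t| ≤ K * sigma x ^ (β - 1)) → (rho x < ρ₀ → t = 0) →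
      |t / kerrX J x| ^ 2 ≤ (ρ₀ ^ 4)⁻¹ * B x := by
    intro t h1 h2
    rcases hne.lt_or_gt with hlt | hgt
    · rw [h2 hlt]; simp; positivity
    · have hXρ : ρ₀ ^ 2 ≤ kerrX J x := le_trans (by gcongr) hX2
      rw [abs_div, abs_of_pos hX, div_pow, div_eq_inv_mul]
      have := hB' t (h1 hgt)
      have e : (kerrX J x ^ 2)⁻¹ ≤ (ρ₀ ^ 4)⁻¹ := by
        apply inv_anti₀ (by positivity)
        calc ρ₀ ^ 4 = (ρ₀ ^ 2) ^ 2 := by ring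
          _ ≤ _ := by gcongr
      exact mul_le_mul e this (by positivity) (by positivity)
  have hyz : rho x < ρ₀ → fderiv ℝ y x = 0 := by
    intro hlt
    rw [(snd_eventually_eq_zero_of_mem h hlt).fderiv_eq]; simp
  rw [massDensity_add hx hαd hyd]
  have e1 := sq_add_sq_add_le (hA' _ (abs_dRho_kerrV_le (J := J) hx)) (hB' _ k2)
    (hA' _ (abs_dZed_kerrV_le (J := J) hx)) (hB' _ k3)
  have hYX : ∀ t : ℝ, |t| ≤ kerrX J x * (kerrConst J / (‖x‖ * sigma x)) →
      |t / kerrX J x| ≤ kerrConst J / (‖x‖ * sigma x) := by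
    intro t ht
    rw [abs_div, abs_of_pos hX, div_le_iff₀ hX]; linarith
  have e2 := sq_add_sq_add_le (hA' _ (hYX _ (abs_dRho_kerrY_le (J := J) hx)))
    (hy' (dRho y x) (fun hgt => (hKy x hgt).2.1) (fun hlt => by simp [dRho, hyz hlt]))
    (hA' _ (hYX _ (abs_dZed_kerrY_le (J := J) hx)))
    (hy' (dZed y x) (fun hgt => (hKy x hgt).2.2) (fun hlt => by simp [dZed, hyz hlt]))
  have e3 : (kerrX J x ^ 2)⁻¹ * exp (-α x) ^ 2 *
      ((dRho (kerrY J) x + dRho y x) ^ 2 + (dZed (kerrY J) x + dZed y x) ^ 2)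
      = exp (-α x) ^ 2 * ((dRho (kerrY J) x / kerrX J x + dRho y x / kerrX J x) ^ 2
        + (dZed (kerrY J) x / kerrX J x + dZed y x / kerrX J x) ^ 2) := by
    field_simp
  rw [e3, norm_eq_abs, abs_of_nonneg (by positivity)]
  exact add_le_add e1 (mul_le_mul hexp e2 (by positivity) (by positivity))

/-! ### Decay of the geodesic velocity -/

lemma abs_snd_le_of_mem (h : (α, y) ∈ perturbations β ρ₀) {K : ℝ} (hK0 : 0 < K)
    (hK : ∀ x, ρ₀ < rho x → |y x| ≤ K * sigma x ^ β) (x : E3) : |y x| ≤ K * sigma x ^ β := by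
  rcases lt_or_ge ρ₀ (rho x) with hx | hx
  · exact hK x hx
  · rw [snd_eq_zero_of_mem h hx, abs_zero]
    have := sigma_pos x
    positivity

/-- The quadratic estimate for the excess is combined with `|w| ≤ K σ^β ρ⁻²`, which follows from `X₀
≥ ρ²`; the other factors are bounded because `α` and `w` are. -/
lemma exists_vertExcess_bound (hβ : β < 0) (hρ₀ : 0 < ρ₀) (h : (α, y) ∈ perturbations β ρ₀) :
    ∃ C : ℝ, 0 < C ∧ ∀ x, ρ₀ < rho x →
      |vertExcess (α x) (scaledTwist J y x)| ≤ C * (sigma x ^ (2 * β) * (rho x ^ 4)⁻¹) := by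
  obtain ⟨K, hK0, hKα, hKy⟩ := exists_bound_of_mem_perturbations h
  refine ⟨exp K * K ^ 2 * (1 + (exp K + exp K * (K / ρ₀ ^ 2) ^ 2)), by positivity, fun x hx => ?_⟩
  have hxp := hρ₀.trans hx
  have hX2 := kerrX_ge (J := J) (ne_zero_of_rho_pos hxp)
  have hX := kerrX_pos (J := J) hxp
  have hs1 := rpow_sigma_le_one hβ.le x
  have hsp : 0 < sigma x ^ β := rpow_pos_of_pos (sigma_pos x) β
  have hαK : |α x| ≤ K := (hKα x).1.trans (mul_le_of_le_one_right hK0.le hs1)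
  have hw : |scaledTwist J y x| ≤ K * sigma x ^ β * (rho x ^ 2)⁻¹ := by
    rw [scaledTwist, abs_mul, abs_inv, abs_of_pos hX]
    have := (hKy x hx).1
    gcongr
  have hw2 : scaledTwist J y x ^ 2 ≤ K ^ 2 * (sigma x ^ (2 * β) * (rho x ^ 4)⁻¹) := by
    rw [← sq_abs]
    calc |scaledTwist J y x| ^ 2 ≤ (K * sigma x ^ β * (rho x ^ 2)⁻¹) ^ 2 := by gcongr
      _ = _ := by
        rw [mul_comm 2 β, rpow_mul (sigma_pos x).le, rpow_two]
        field_simp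
  have hw3 : scaledTwist J y x ^ 2 ≤ (K / ρ₀ ^ 2) ^ 2 := by
    rw [← sq_abs]
    have : |scaledTwist J y x| ≤ K / ρ₀ ^ 2 := by
      refine hw.trans ?_
      rw [div_eq_mul_inv]
      have : K * sigma x ^ β ≤ K := mul_le_of_le_one_right hK0.le hs1
      gcongr
    gcongr
  have he : exp (-α x) ≤ exp K := exp_le_exp.2 (by linarith [(abs_le.1 hαK).1])
  have he' : exp (α x) ≤ exp K := exp_le_exp.2 (abs_le.1 hαK).2
  have hC : coshDist (α x) (scaledTwist J y x) ≤ exp K + exp K * (K / ρ₀ ^ 2) ^ 2 := by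
    have h1 : exp (-α x) * scaledTwist J y x ^ 2 ≤ exp K * (K / ρ₀ ^ 2) ^ 2 := by gcongr
    have h2 : 0 ≤ exp (-α x) * scaledTwist J y x ^ 2 := by positivity
    rw [coshDist, cosh_eq]
    linarith
  have hC1 := one_le_coshDist (α x) (scaledTwist J y x)
  refine (abs_vertExcess_le _ _).trans ?_
  have h1 : exp (-α x) * scaledTwist J y x ^ 2 / 2
      ≤ exp K * (K ^ 2 * (sigma x ^ (2 * β) * (rho x ^ 4)⁻¹)) := by
    have h1 : exp (-α x) * scaledTwist J y x ^ 2
      ≤ exp K * (K ^ 2 * (sigma x ^ (2 * β) * (rho x ^ 4)⁻¹)) := by gcongr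
    have h2 : 0 ≤ exp (-α x) * scaledTwist J y x ^ 2 := by positivity
    linarith
  have hsp2 : 0 < sigma x ^ (2 * β) := rpow_pos_of_pos (sigma_pos x) _
  calc _ ≤ exp K * (K ^ 2 * (sigma x ^ (2 * β) * (rho x ^ 4)⁻¹))
        * (1 + (exp K + exp K * (K / ρ₀ ^ 2) ^ 2)) := by gcongr
    _ = _ := by ring

lemma scaledTwist_eq_zero (h : (α, y) ∈ perturbations β ρ₀) {x : E3} (hx : rho x ≤ ρ₀) :
    scaledTwist J y x = 0 := by rw [scaledTwist, snd_eq_zero_of_mem h hx, zero_mul]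

lemma vertExcess_eq_zero (h : (α, y) ∈ perturbations β ρ₀) {x : E3} (hx : rho x ≤ ρ₀) :
    vertExcess (α x) (scaledTwist J y x) = 0 := by
  rw [scaledTwist_eq_zero h hx, vertExcess_zero_right]

lemma ae_differentiableAt_snd (hρ₀ : 0 < ρ₀) (h : (α, y) ∈ perturbations β ρ₀) :
    ∀ᵐ x, DifferentiableAt ℝ y x := by
  filter_upwards [ae_rho_ne hρ₀] with x hx
  exact (contDiffAt_snd_of_mem_of_ne h hx).differentiableAt (by simp)

/-! ### The three divergences -/

/-- The field `∇v₀` is regular across the axis, so only the origin has to be removed and the tested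
function may be nonzero on the axis. The flux is `O(r⁻¹ σ^{β-1})`; divided by `r` it is integrable.
-/
lemma tendsto_divergence_gradV (hβ : β < 0) (hρ₀ : 0 < ρ₀) (h : (α, y) ∈ perturbations β ρ₀) :
    (∀ n, Integrable fun x => logCut n x * (gradVx √|J| ‖x‖ (x 2)
            * fderiv ℝ (fun x => α x + vertExcess (α x) (scaledTwist J y x)) x x
          + gradVz √|J| ‖x‖ (x 2)
            * fderiv ℝ (fun x => α x + vertExcess (α x) (scaledTwist J y x)) x eZed
          + (α x + vertExcess (α x) (scaledTwist J y x))
            * fieldDiv (fun x => gradVx √|J| ‖x‖ (x 2)) (fun x => gradVz √|J| ‖x‖ (x 2)) x)) ∧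
    Tendsto (fun n => ∫ x, logCut n x * (gradVx √|J| ‖x‖ (x 2)
            * fderiv ℝ (fun x => α x + vertExcess (α x) (scaledTwist J y x)) x x
          + gradVz √|J| ‖x‖ (x 2)
            * fderiv ℝ (fun x => α x + vertExcess (α x) (scaledTwist J y x)) x eZed
          + (α x + vertExcess (α x) (scaledTwist J y x))
            * fieldDiv (fun x => gradVx √|J| ‖x‖ (x 2)) (fun x => gradVz √|J| ‖x‖ (x 2)) x))
      atTop (𝓝 0) := by
  have hm := sqrt_nonneg |J|
  obtain ⟨K, hK0, hKα, hKy⟩ := exists_bound_of_mem_perturbations h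
  obtain ⟨C, hC0, hC⟩ := exists_vertExcess_bound (J := J) hβ hρ₀ h
  have hα := contDiff_fst_of_mem h
  have hH : Integrable fun x : E3 => (K + C * (ρ₀ ^ 4)⁻¹) * (2 * kerrConst J)
      * ((‖x‖ ^ 2)⁻¹ * sigma x ^ (β - 1)) :=
    (integrable_norm_sq_inv_mul_rpow_sigma (by linarith)).const_mul _
  refine tendsto_integral_logCut (isOpen_compl_singleton (x := (0 : E3)))
    (locallyLipschitz_vertVel hα.locallyLipschitz (locallyLipschitz_scaledTwist h hβ hρ₀)) ?_
    (fun x hx => (contDiffAt_gradVx hm hx).contDiffWithinAt)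
    (fun x hx => (contDiffAt_gradVz hm hx).contDiffWithinAt)
    (measurable_gradVx _) (measurable_gradVz _) (fun x _ hx => hx) hH ?_
  · filter_upwards [ae_rho_pos, ae_differentiableAt_snd hρ₀ h] with x hx hy
    have hαd := (hα.differentiable (by simp)) x
    exact hαd.add (differentiableAt_vertExcess_comp hx hαd hy)
  · filter_upwards [ae_rho_pos] with x hx
    have hr := norm_pos_of_rho_pos hx
    have hs := sigma_pos x
    have hsp : 0 < sigma x ^ β := rpow_pos_of_pos hs β
    have hkc := kerrConst_pos J
    have h1 := abs_dRho_kerrV_le (J := J) hx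
    have h2 := abs_dZed_kerrV_le (J := J) hx
    rw [dRho_kerrV hx] at h1
    rw [dZed_kerrV hx] at h2
    have hG : |vertExcess (α x) (scaledTwist J y x)| ≤ C * (ρ₀ ^ 4)⁻¹ * sigma x ^ β := by
      rcases lt_or_ge ρ₀ (rho x) with hx' | hx'
      · refine (hC x hx').trans ?_
        have : sigma x ^ (2 * β) ≤ sigma x ^ β :=
          rpow_le_rpow_of_exponent_le (one_le_sigma x) (by linarith)
        rw [mul_assoc, mul_comm (ρ₀ ^ 4)⁻¹]
        gcongr
      · rw [vertExcess_eq_zero h hx', abs_zero]; positivity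
    have hV1 : |α x + vertExcess (α x) (scaledTwist J y x)|
        ≤ (K + C * (ρ₀ ^ 4)⁻¹) * sigma x ^ β := by
      refine (abs_add_le _ _).trans ?_
      have := (hKα x).1
      linarith
    calc _ ≤ ((K + C * (ρ₀ ^ 4)⁻¹) * sigma x ^ β) * (kerrConst J / (‖x‖ * sigma x)
          + kerrConst J / (‖x‖ * sigma x)) := by gcongr
      _ = _ := by
        rw [rpow_sub_one hs.ne']
        field_simp
        ring

/-- The weight `ρ⁻⁴ σ⁻²` is integrable off a cylinder. -/
lemma rho_inv_pow_mul_sigma_le (hρ₀ : 0 < ρ₀) {x : E3} (hx : ρ₀ < rho x) :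
    (rho x ^ 4)⁻¹ * (sigma x ^ 2)⁻¹ ≤ (1 + (ρ₀ ^ 2)⁻¹) ^ 2 *
      ((1 + x 0 ^ 2)⁻¹ * (1 + x 1 ^ 2)⁻¹ * (1 + x 2 ^ 2)⁻¹) := by
  have hxp := hρ₀.trans hx
  have h1 : 1 + rho x ^ 2 ≤ (1 + (ρ₀ ^ 2)⁻¹) * rho x ^ 2 := by
    have : 1 ≤ (ρ₀ ^ 2)⁻¹ * rho x ^ 2 := by
      rw [← div_eq_inv_mul, one_le_div (by positivity)]; gcongr
    linarith
  have h2 : (1 + x 0 ^ 2) * (1 + x 1 ^ 2) ≤ (1 + (ρ₀ ^ 2)⁻¹) ^ 2 * rho x ^ 4 := by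
    have e := rho_sq x
    calc (1 + x 0 ^ 2) * (1 + x 1 ^ 2) ≤ (1 + rho x ^ 2) * (1 + rho x ^ 2) := by
          rw [e]; gcongr <;> nlinarith [sq_nonneg (x 0), sq_nonneg (x 1)]
      _ ≤ ((1 + (ρ₀ ^ 2)⁻¹) * rho x ^ 2) * ((1 + (ρ₀ ^ 2)⁻¹) * rho x ^ 2) := by gcongr
      _ = _ := by ring
  have h3 : 1 + x 2 ^ 2 ≤ sigma x ^ 2 := by rw [sigma_sq, norm_sq_eq]; nlinarith [sq_nonneg (x 0), sq_nonneg (x 1)]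
  have hs := sigma_pos x
  rw [← mul_inv, ← mul_inv, ← mul_inv, ← div_eq_mul_inv, inv_eq_one_div,
    div_le_div_iff₀ (by positivity) (by positivity), one_mul]
  calc (1 + x 0 ^ 2) * (1 + x 1 ^ 2) * (1 + x 2 ^ 2)
      ≤ ((1 + (ρ₀ ^ 2)⁻¹) ^ 2 * rho x ^ 4) * sigma x ^ 2 := by gcongr
    _ = _ := by ring

lemma sigma_le_mul_norm (hρ₀ : 0 < ρ₀) {x : E3} (hx : ρ₀ < rho x) :
    sigma x ≤ (1 + ρ₀⁻¹) * ‖x‖ := by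
  have h1 := sigma_le_one_add x
  have h2 := hx.le.trans (rho_le_norm x)
  have : 1 ≤ ρ₀⁻¹ * ‖x‖ := by
    rw [← div_eq_inv_mul, one_le_div hρ₀]; exact h2
  linarith

/-- The singularity on the axis is invisible because the excess vanishes in the cylinder. At
infinity `σ^{2β} ≤ σ⁻¹ = σ⁻² σ`, and outside the cylinder `σ` is bounded by a multiple of `r`, which
supplies the factor `r` required by the cutoffs and leaves the integrable weight `ρ⁻⁴ σ⁻²`. -/
lemma tendsto_divergence_log_rho (hβ : β < -1 / 2) (hρ₀ : 0 < ρ₀)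
    (h : (α, y) ∈ perturbations β ρ₀) :
    (∀ n, Integrable fun x : E3 => logCut n x * (1 / (‖x‖ ^ 2 - x 2 ^ 2)
            * fderiv ℝ (fun x => vertExcess (α x) (scaledTwist J y x)) x x
          + -(x 2 / (‖x‖ ^ 2 - x 2 ^ 2))
            * fderiv ℝ (fun x => vertExcess (α x) (scaledTwist J y x)) x eZed
          + vertExcess (α x) (scaledTwist J y x)
            * fieldDiv (fun x => 1 / (‖x‖ ^ 2 - x 2 ^ 2))
              (fun x => -(x 2 / (‖x‖ ^ 2 - x 2 ^ 2))) x)) ∧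
    Tendsto (fun n => ∫ x : E3, logCut n x * (1 / (‖x‖ ^ 2 - x 2 ^ 2)
            * fderiv ℝ (fun x => vertExcess (α x) (scaledTwist J y x)) x x
          + -(x 2 / (‖x‖ ^ 2 - x 2 ^ 2))
            * fderiv ℝ (fun x => vertExcess (α x) (scaledTwist J y x)) x eZed
          + vertExcess (α x) (scaledTwist J y x)
            * fieldDiv (fun x => 1 / (‖x‖ ^ 2 - x 2 ^ 2))
              (fun x => -(x 2 / (‖x‖ ^ 2 - x 2 ^ 2))) x)) atTop (𝓝 0) := by
  have hβ' : β < 0 := by linarith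
  obtain ⟨C, hC0, hC⟩ := exists_vertExcess_bound (J := J) hβ' hρ₀ h
  have hα := contDiff_fst_of_mem h
  have hH : Integrable fun x : E3 => C * ρ₀⁻¹ * (1 + ρ₀⁻¹) * ((1 + (ρ₀ ^ 2)⁻¹) ^ 2 *
      ((1 + x 0 ^ 2)⁻¹ * (1 + x 1 ^ 2)⁻¹ * (1 + x 2 ^ 2)⁻¹)) :=
    (integrable_prod_inv_one_add_sq.const_mul _).const_mul _
  refine tendsto_integral_logCut isOpen_rho_pos
    (locallyLipschitz_vertExcess hα.locallyLipschitz (locallyLipschitz_scaledTwist h hβ' hρ₀)) ?_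
    (fun x hx => (contDiffAt_rho_sq_inv hx).contDiffWithinAt)
    (fun x hx => (contDiffAt_zed_div_rho_sq hx).contDiffWithinAt)
    (measurable_norm_coord (h := fun r z => 1 / (r ^ 2 - z ^ 2))
      (by unfold Function.uncurry; fun_prop))
    (measurable_norm_coord (h := fun r z => -(z / (r ^ 2 - z ^ 2)))
      (by unfold Function.uncurry; fun_prop))
    (fun x hx _ => ?_) hH ?_
  · filter_upwards [ae_rho_pos, ae_differentiableAt_snd hρ₀ h] with x hx hy
    exact differentiableAt_vertExcess_comp hx ((hα.differentiable (by simp)) x) hy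
  · refine hρ₀.trans_le (tsupport_snd_subset_of_mem h (fun x hx => ?_) hx)
    simp [scaledTwist, hx, vertExcess_zero_right]
  · filter_upwards [ae_rho_pos] with x hx
    have hr := norm_pos_of_rho_pos hx
    have hs := sigma_pos x
    rw [← rho_sq_eq]
    rcases lt_or_ge ρ₀ (rho x) with hx' | hx'
    · have e1 : 1 / rho x ^ 2 * x 2 + -(x 2 / rho x ^ 2) = 0 := by ring
      have e2 : |1 / rho x ^ 2 * rho x| = (rho x)⁻¹ := by
        rw [abs_of_pos (by positivity)]; field_simp
      rw [e1, e2, abs_zero, add_zero]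
      have h1 := hC x hx'
      have h2 : sigma x ^ (2 * β) ≤ (sigma x ^ 2)⁻¹ * sigma x := by
        rw [show (sigma x ^ 2)⁻¹ * sigma x = sigma x ^ (-1 : ℝ) by
          rw [rpow_neg_one]; field_simp]
        exact rpow_le_rpow_of_exponent_le (one_le_sigma x) (by linarith)
      have h3 := rho_inv_pow_mul_sigma_le hρ₀ hx'
      have h4 := sigma_le_mul_norm hρ₀ hx'
      have hsp2 : 0 < sigma x ^ (2 * β) := rpow_pos_of_pos (sigma_pos x) _
      calc _ ≤ C * (sigma x ^ (2 * β) * (rho x ^ 4)⁻¹) * ρ₀⁻¹ := by gcongr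
        _ ≤ C * (((sigma x ^ 2)⁻¹ * ((1 + ρ₀⁻¹) * ‖x‖)) * (rho x ^ 4)⁻¹) * ρ₀⁻¹ := by
          gcongr
          refine h2.trans ?_
          gcongr
        _ = C * ρ₀⁻¹ * (1 + ρ₀⁻¹) * ((rho x ^ 4)⁻¹ * (sigma x ^ 2)⁻¹) * ‖x‖ := by ring
        _ ≤ _ := by gcongr
    · rw [vertExcess_eq_zero h hx', abs_zero, zero_mul]
      positivity

/-- The flux `X₀⁻² ∇Y₀` is singular on the axis, but the horizontal velocity vanishes with `y` in
the cylinder. Outside, `|X₀⁻¹ ∇Y₀|` decays like `∇v₀`, and the remaining `X₀⁻¹` is at most `ρ₀⁻²`.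
-/
lemma tendsto_divergence_fluxY (hβ : β < 0) (hρ₀ : 0 < ρ₀) (h : (α, y) ∈ perturbations β ρ₀) :
    (∀ n, Integrable fun x => logCut n x *
        (fluxYx J √|J| ‖x‖ (x 2) * fderiv ℝ (twistVel J α y) x x
          + fluxYz J √|J| ‖x‖ (x 2) * fderiv ℝ (twistVel J α y) x eZed
          + twistVel J α y x
            * fieldDiv (fun x => fluxYx J √|J| ‖x‖ (x 2)) (fun x => fluxYz J √|J| ‖x‖ (x 2)) x)) ∧
    Tendsto (fun n => ∫ x, logCut n x *
        (fluxYx J √|J| ‖x‖ (x 2) * fderiv ℝ (twistVel J α y) x x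
          + fluxYz J √|J| ‖x‖ (x 2) * fderiv ℝ (twistVel J α y) x eZed
          + twistVel J α y x
            * fieldDiv (fun x => fluxYx J √|J| ‖x‖ (x 2)) (fun x => fluxYz J √|J| ‖x‖ (x 2)) x))
      atTop (𝓝 0) := by
  have hm := sqrt_nonneg |J|
  obtain ⟨K, hK0, hKα, hKy⟩ := exists_bound_of_mem_perturbations h
  have hα := contDiff_fst_of_mem h
  have hH : Integrable fun x : E3 => exp K * K * (2 * kerrConst J * (ρ₀ ^ 2)⁻¹)
      * ((‖x‖ ^ 2)⁻¹ * sigma x ^ (β - 1)) :=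
    (integrable_norm_sq_inv_mul_rpow_sigma (by linarith)).const_mul _
  refine tendsto_integral_logCut isOpen_rho_pos (locallyLipschitz_twistVel h hβ hρ₀) ?_
    (fun x hx => (contDiffAt_fluxYx hm hx).contDiffWithinAt)
    (fun x hx => (contDiffAt_fluxYz hm hx).contDiffWithinAt)
    (measurable_fluxYx _ _) (measurable_fluxYz _ _) (fun x hx _ => ?_) hH ?_
  · filter_upwards [ae_rho_pos, ae_differentiableAt_snd hρ₀ h] with x hx hy
    exact differentiableAt_twistVel hx ((hα.differentiable (by simp)) x) hy
  · refine hρ₀.trans_le (tsupport_snd_subset_of_mem h (fun x hx => ?_) hx)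
    simp [twistVel, hx]
  · filter_upwards [ae_rho_pos] with x hx
    have hr := norm_pos_of_rho_pos hx
    have hs := sigma_pos x
    have hsp : 0 < sigma x ^ β := rpow_pos_of_pos hs β
    have hkc := kerrConst_pos J
    rcases lt_or_ge ρ₀ (rho x) with hx' | hx'
    · have hX := kerrX_pos (J := J) hx
      have hX2 := kerrX_ge (J := J) (ne_zero_of_rho_pos hx)
      have hflux : ∀ t : ℝ, |kerrX J x ^ 2 * t| ≤ kerrX J x * (kerrConst J / (‖x‖ * sigma x)) →
          |t| ≤ (ρ₀ ^ 2)⁻¹ * (kerrConst J / (‖x‖ * sigma x)) := by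
        intro t ht
        rw [abs_mul, abs_of_pos (by positivity)] at ht
        have h3 : |t| ≤ (kerrX J x)⁻¹ * (kerrConst J / (‖x‖ * sigma x)) := by
          rw [inv_mul_eq_div, le_div_iff₀ hX]
          refine le_of_mul_le_mul_left ?_ hX
          linarith
        refine h3.trans ?_
        have : ρ₀ ^ 2 ≤ kerrX J x := le_trans (by gcongr) hX2
        gcongr
      have h1 := abs_dRho_kerrY_le (J := J) hx
      have h2 := abs_dZed_kerrY_le (J := J) hx
      rw [dRho_kerrY hx] at h1
      rw [dZed_kerrY hx] at h2
      have h1 := hflux _ h1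
      have h2 := hflux _ h2
      have hs1 := rpow_sigma_le_one hβ.le x
      have hαK : |α x| ≤ K := (hKα x).1.trans (mul_le_of_le_one_right hK0.le hs1)
      have hv : |twistVel J α y x| ≤ exp K * (K * sigma x ^ β) := by
        have hF := (arcoshDivSinh_mem (one_le_coshDist (α x) (scaledTwist J y x))).2
        have hF0 := (arcoshDivSinh_pos (one_le_coshDist (α x) (scaledTwist J y x))).le
        have he : exp (-α x) ≤ exp K := exp_le_exp.2 (by linarith [(abs_le.1 hαK).1])
        have hy := (hKy x hx').1
        rw [twistVel, abs_mul, abs_mul, abs_of_nonneg hF0, abs_of_pos (exp_pos _)]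
        calc _ ≤ 1 * (exp K * (K * sigma x ^ β)) := by gcongr
          _ = _ := one_mul _
      calc _ ≤ exp K * (K * sigma x ^ β) * ((ρ₀ ^ 2)⁻¹ * (kerrConst J / (‖x‖ * sigma x))
            + (ρ₀ ^ 2)⁻¹ * (kerrConst J / (‖x‖ * sigma x))) := by gcongr
        _ = _ := by
          rw [rpow_sub_one hs.ne']
          field_simp
          ring
    · rw [twistVel, snd_eq_zero_of_mem h hx']
      simp
      positivity

end Integrability

/-! ### Rigidity -/

section Rigidity
variable {J β ρ₀ : ℝ} {α y : E3 → ℝ}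

lemma rho_add_smul_eZed (x : E3) (t : ℝ) : rho (x + t • eZed) = rho x := by
  simp [rho, eZed]

lemma tendsto_sigma_line (x : E3) : Tendsto (fun t : ℝ => sigma (x + t • eZed)) atTop atTop := by
  have h : ∀ t : ℝ, x 2 + t ≤ sigma (x + t • eZed) := by
    intro t
    have h1 := (le_abs_self _).trans ((abs_zed_le_norm (x + t • eZed)).trans (norm_le_sigma _))
    simpa [eZed] using h1
  exact tendsto_atTop_mono h (tendsto_atTop_add_const_left _ _ tendsto_id)

lemma tendsto_line_zero {f : E3 → ℝ} {K β : ℝ} (hβ : β < 0) (hf : ∀ x, |f x| ≤ K * sigma x ^ β)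
    (x : E3) : Tendsto (fun t : ℝ => f (x + t • eZed)) atTop (𝓝 0) := by
  have h1 : Tendsto (fun t : ℝ => K * sigma (x + t • eZed) ^ β) atTop (𝓝 0) := by
    have := (tendsto_rpow_neg_atTop (y := -β) (by linarith)).comp (tendsto_sigma_line x)
    simpa [Function.comp_def] using this.const_mul K
  exact squeeze_zero_norm (fun t => hf _) h1

/-- On a vertical line `ρ` is fixed and positive, so `X₀ ≥ ρ²` is bounded below and `w` tends to
zero together with `y`. -/
lemma tendsto_coshDist_line (hβ : β < 0) (h : (α, y) ∈ perturbations β ρ₀)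
    {x : E3} (hx : 0 < rho x) :
    Tendsto (fun t : ℝ => coshDist (α (x + t • eZed)) (scaledTwist J y (x + t • eZed))) atTop
      (𝓝 1) := by
  obtain ⟨K, hK0, hKα, hKy⟩ := exists_bound_of_mem_perturbations h
  have hα := tendsto_line_zero hβ (fun x => (hKα x).1) x
  have hy := tendsto_line_zero hβ (abs_snd_le_of_mem h hK0 fun x hx => (hKy x hx).1) x
  have hw : Tendsto (fun t : ℝ => scaledTwist J y (x + t • eZed)) atTop (𝓝 0) := by
    refine squeeze_zero_norm (a := fun t : ℝ => |y (x + t • eZed)| * (rho x ^ 2)⁻¹) (fun t => ?_) ?_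
    · have hx' : 0 < rho (x + t • eZed) := by rwa [rho_add_smul_eZed]
      have hX := kerrX_pos (J := J) hx'
      have hX2 := kerrX_ge (J := J) (ne_zero_of_rho_pos hx')
      rw [rho_add_smul_eZed] at hX2
      rw [scaledTwist, norm_mul, norm_inv, norm_eq_abs, norm_eq_abs, abs_of_pos hX]
      gcongr
    · simpa using hy.abs.mul_const (rho x ^ 2)⁻¹
  have h0 : coshDist 0 0 = 1 := by simp [coshDist]
  have hc := (contDiff_coshDist.continuous.tendsto ((0 : ℝ), (0 : ℝ))).comp (hα.prodMk_nhds hw)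
  simp only [h0] at hc
  exact hc

/-- If the remaining part of the mass density vanishes, so does the perturbation. -/
lemma eq_zero_of_massExcess_ae_eq_zero (hβ : β < 0) (hρ₀ : 0 < ρ₀)
    (h : (α, y) ∈ perturbations β ρ₀) (h0 : ∀ᵐ x, massExcess J α y x = 0) : α = 0 ∧ y = 0 := by
  have hα := contDiff_fst_of_mem h
  set C : E3 → ℝ := fun x => coshDist (α x) (scaledTwist J y x) with hCdef
  set U : Set E3 := {x | 0 < rho x ∧ rho x ≠ ρ₀} with hUdef
  have hU : IsOpen U := isOpen_rho_pos.inter (isOpen_ne_fun continuous_rho continuous_const)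
  have hCd : ∀ x ∈ U, ContDiffAt ℝ 1 C x := by
    intro x hx
    have hw : ContDiffAt ℝ 1 (scaledTwist J y) x :=
      (contDiffAt_snd_of_mem_of_ne h hx.2).mul
        ((contDiffAt_kerrX hx.1).inv (kerrX_pos hx.1).ne')
    exact ContDiffAt.comp x (g := fun p : ℝ × ℝ => coshDist p.1 p.2)
      contDiff_coshDist.contDiffAt (hα.contDiffAt.prodMk hw)
  have hC0 : ∀ x ∈ U, fderiv ℝ C x eZed = 0 := by
    have hcont : ContinuousOn (fun x => fderiv ℝ C x eZed) U :=
      ((ContDiffOn.continuousOn_fderiv_of_isOpen (n := 1) (fun x hx => (hCd x hx).contDiffWithinAt) hU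
        (by simp))).clm_apply continuousOn_const
    -- The excess bounds the squared `z` derivative of `cosh d` almost everywhere; continuity of
    -- that derivative on `U` makes it vanish at every point of `U`.
    refine Measure.eqOn_open_of_ae_eq (μ := volume) (g := fun _ => (0 : ℝ)) ?_ hU hcont
      continuousOn_const
    refine ae_restrict_of_ae ?_
    filter_upwards [h0, ae_rho_pos, ae_differentiableAt_snd hρ₀ h] with x hx hxp hy
    have := dZed_coshDist_sq_le (J := J) hxp ((hα.differentiable (by simp)) x) hy
    rw [hx, mul_zero] at this
    exact pow_eq_zero_iff two_ne_zero |>.1 (le_antisymm this (sq_nonneg _))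
  have hC1 : ∀ x ∈ U, C x = 1 := by
    intro x hx
    -- Only the `z` derivative is used: vertical lines never meet the axis or the surface `ρ = ρ₀`
    -- once they start in `U`.
    have hline : ∀ t : ℝ, x + t • eZed ∈ U := by
      intro t
      simpa [hUdef, rho_add_smul_eZed] using hx
    have hder : ∀ t : ℝ, HasDerivAt (fun t : ℝ => C (x + t • eZed)) 0 t := by
      intro t
      have h1 : HasDerivAt (fun t : ℝ => x + t • eZed) eZed t := by
        simpa using ((hasDerivAt_id t).smul_const eZed).const_add x
      have h2 := ((hCd _ (hline t)).differentiableAt (by simp)).hasFDerivAt.comp_hasDerivAt t h1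
      rw [hC0 _ (hline t)] at h2
      exact h2
    have hconst : ∀ t : ℝ, C (x + t • eZed) = C x := by
      intro t
      have := is_const_of_deriv_eq_zero (fun t => (hder t).differentiableAt)
        (fun t => (hder t).deriv) t 0
      simpa using this
    have hlim := tendsto_coshDist_line (J := J) hβ h hx.1
    have hlim2 : Tendsto (fun t : ℝ => C (x + t • eZed)) atTop (𝓝 (C x)) := by
      simp_rw [hconst]; exact tendsto_const_nhds
    exact tendsto_nhds_unique hlim2 hlim
  have hae : ∀ᵐ x, α x = 0 ∧ y x = 0 := by
    filter_upwards [ae_rho_pos, ae_rho_ne hρ₀] with x hx hne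
    obtain ⟨h1, h2⟩ := coshDist_eq_one (hC1 x ⟨hx, hne⟩)
    refine ⟨h1, ?_⟩
    rcases mul_eq_zero.1 h2 with h2 | h2
    · exact h2
    · exact absurd (inv_eq_zero.1 h2) (kerrX_pos hx).ne'
  exact ⟨Measure.eq_of_ae_eq (hae.mono fun x hx => hx.1) hα.continuous continuous_const,
    Measure.eq_of_ae_eq (hae.mono fun x hx => hx.2) h.2.2.2.1 continuous_const⟩

end Rigidity

/-! ### Minimality -/

section Minimality
variable {J β ρ₀ : ℝ} {α y : E3 → ℝ}

lemma zero_mem_perturbations (β ρ₀ : ℝ) : (0 : (E3 → ℝ) × (E3 → ℝ)) ∈ perturbations β ρ₀ := by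
  have h : ∀ Ω : Set E3, MemC1 β Ω (0 : E3 → ℝ) := by
    refine fun Ω => ⟨contDiffOn_const, 0, ?_⟩
    rintro _ ⟨x, -, rfl⟩
    simp [weightedC1, partialSq, dRho, dZed]
  exact ⟨fun _ _ _ _ => rfl, fun _ _ _ _ => rfl, h _, continuous_const, fun _ _ => rfl, h _⟩

lemma integrable_massDensity_kerr (hβ : β < -1 / 2) (hρ₀ : 0 < ρ₀) :
    Integrable (massDensity (kerrData J)) := by
  have h := integrable_massDensity (J := J) (α := 0) (y := 0) hβ hρ₀ (zero_mem_perturbations β ρ₀)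
  rwa [show ((0 : E3 → ℝ), (0 : E3 → ℝ)) = 0 from rfl, add_zero] at h

lemma logCut_mul_integrable {f : E3 → ℝ} (hf : Integrable f) (n : ℕ) :
    Integrable fun x => logCut n x * f x := by
  refine hf.bdd_mul (c := 1) (contDiff_logCut n).continuous.aestronglyMeasurable
    (ae_of_all _ fun x => ?_)
  rw [norm_eq_abs, abs_of_nonneg (logCut_nonneg n x)]
  exact logCut_le_one n x

lemma logCut_eventually_eq_one {x : E3} (hx : x ≠ 0) : ∀ᶠ n in atTop, logCut n x = 1 := by
  obtain ⟨k, hk⟩ := exists_nat_ge |log ‖x‖|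
  filter_upwards [eventually_ge_atTop k] with n hn
  refine logCut_eq_one hx ?_
  have : (k : ℝ) ≤ n := by exact_mod_cast hn
  linarith

lemma tendsto_integral_logCut_mul {f : E3 → ℝ} (hf : Integrable f) :
    Tendsto (fun n => ∫ x, logCut n x * f x) atTop (𝓝 (∫ x, f x)) := by
  refine tendsto_integral_of_dominated_convergence (fun x => ‖f x‖)
    (fun n => (logCut_mul_integrable hf n).aestronglyMeasurable) hf.norm (fun n => ?_) ?_
  · refine ae_of_all _ fun x => ?_
    rw [norm_mul, norm_eq_abs (logCut n x), abs_of_nonneg (logCut_nonneg n x)]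
    exact mul_le_of_le_one_left (norm_nonneg _) (logCut_le_one n x)
  · filter_upwards [ae_rho_pos] with x hx
    refine tendsto_const_nhds.congr' ?_
    filter_upwards [logCut_eventually_eq_one (ne_zero_of_rho_pos hx)] with n hn
    rw [hn, one_mul]

/-- The later cutoff is already `1` on the support of the earlier one, where `|log r| ≤ 2 (k + 1) ≤
n`. The cutoffs need not increase one step at a time. -/
lemma logCut_le_logCut {k n : ℕ} (hn : 2 * (k + 1) ≤ n) (x : E3) : logCut k x ≤ logCut n x := by
  by_cases hx : logCut k x = 0
  · rw [hx]; exact logCut_nonneg n x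
  have h := support_logCut_subset k hx
  have hr := (exp_pos _).trans_le h.1
  rw [logCut_eq_one (n := n) (norm_pos_iff.1 hr)]
  · exact logCut_le_one k x
  · have h1 := (le_log_iff_exp_le hr).2 h.1
    have h2 := (log_le_iff_le_exp hr).2 h.2
    have h3 : (2 * (k + 1) : ℝ) ≤ n := by exact_mod_cast hn
    rw [abs_le]
    constructor <;> linarith

/-- Integrability of `massExcess` itself is not claimed: the three divergences are controlled only
through their cut-off integrals, which tend to zero. -/
lemma integral_massExcess (hβ : β < -1 / 2) (hρ₀ : 0 < ρ₀) (h : (α, y) ∈ perturbations β ρ₀) :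
    (∀ n, Integrable fun x => logCut n x * massExcess J α y x) ∧
    Tendsto (fun n => ∫ x, logCut n x * massExcess J α y x) atTop
      (𝓝 (∫ x, (massDensity (kerrData J + (α, y)) x - massDensity (kerrData J) x))) := by
  have hβ' : β < 0 := by linarith
  have hα := contDiff_fst_of_mem h
  have hD := (integrable_massDensity (J := J) hβ hρ₀ h).sub
    (integrable_massDensity_kerr (J := J) hβ hρ₀)
  obtain ⟨i1, t1⟩ := tendsto_divergence_gradV (J := J) hβ' hρ₀ h
  obtain ⟨i2, t2⟩ := tendsto_divergence_log_rho (J := J) hβ hρ₀ h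
  obtain ⟨i3, t3⟩ := tendsto_divergence_fluxY (J := J) hβ' hρ₀ h
  have i0 := logCut_mul_integrable hD
  have t0 := tendsto_integral_logCut_mul hD
  have hae := fun n => ((ae_rho_pos.and (ae_differentiableAt_snd hρ₀ h)).mono fun x hx => by
    have e := massDensity_sub_eq (J := J) hx.1 ((hα.differentiable (by simp)) x) hx.2
    exact (show logCut n x * massExcess J α y x = _ by
      rw [eq_sub_of_add_eq (eq_sub_of_add_eq (eq_sub_of_add_eq e.symm)), mul_sub, mul_sub, mul_sub,
        mul_left_comm (logCut n x) 2, mul_left_comm (logCut n x) 4, mul_left_comm (logCut n x) 2]))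
  have hI := fun n => (((i0 n).sub ((i3 n).const_mul 2)).sub ((i2 n).const_mul 4)).sub
    ((i1 n).const_mul 2)
  have hint : ∀ n, Integrable fun x => logCut n x * massExcess J α y x := fun n =>
    (hI n).congr ((hae n).mono fun x hx => hx.symm)
  refine ⟨hint, ?_⟩
  have hlim := (((t0.sub (t3.const_mul 2)).sub (t2.const_mul 4)).sub (t1.const_mul 2))
  simp only [mul_zero, sub_zero] at hlim
  refine hlim.congr fun n => ?_
  rw [integral_congr_ae (hae n), integral_sub, integral_sub, integral_sub, integral_const_mul,
    integral_const_mul, integral_const_mul]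
  · rfl
  · exact i0 n
  · exact (i3 n).const_mul 2
  · exact (i0 n).sub ((i3 n).const_mul 2)
  · exact (i2 n).const_mul 4
  · exact ((i0 n).sub ((i3 n).const_mul 2)).sub ((i2 n).const_mul 4)
  · exact (i1 n).const_mul 2

/-- Extreme Kerr is a strict global minimum of the mass among the perturbations. -/
theorem mass_lt_mass_add (hβ : β < -1 / 2) (hρ₀ : 0 < ρ₀) {φ : (E3 → ℝ) × (E3 → ℝ)}
    (h : φ ∈ perturbations β ρ₀) (hφ : φ ≠ 0) : mass (kerrData J) < mass (kerrData J + φ) := by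
  obtain ⟨α, y⟩ := φ
  obtain ⟨hi, ht⟩ := integral_massExcess (J := J) hβ hρ₀ h
  have hpos : 0 < ∫ x, (massDensity (kerrData J + (α, y)) x - massDensity (kerrData J) x) := by
    by_contra hneg
    push Not at hneg
    have hzero : ∀ k, ∀ᵐ x, logCut k x * massExcess J α y x = 0 := by
      intro k
      have hnn : ∀ n x, 0 ≤ logCut n x * massExcess J α y x := fun n x =>
        mul_nonneg (logCut_nonneg n x) massExcess_nonneg
      -- A fixed cut-off integral is dominated by all sufficiently late ones, hence by their limit,
      -- the assumed nonpositive difference.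
      have hle : ∫ x, logCut k x * massExcess J α y x ≤ 0 := by
        refine (ge_of_tendsto ht ?_).trans hneg
        filter_upwards [eventually_ge_atTop (2 * (k + 1))] with n hn
        exact integral_mono (hi k) (hi n) fun x =>
          mul_le_mul_of_nonneg_right (logCut_le_logCut hn x) massExcess_nonneg
      have h0 : ∫ x, logCut k x * massExcess J α y x = 0 :=
        le_antisymm hle (integral_nonneg (hnn k))
      exact (integral_eq_zero_iff_of_nonneg (hnn k) (hi k)).1 h0
    have hE : ∀ᵐ x, massExcess J α y x = 0 := by
      filter_upwards [ae_all_iff.2 hzero, ae_rho_pos] with x hx hxp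
      obtain ⟨n, hn⟩ := (logCut_eventually_eq_one (ne_zero_of_rho_pos hxp)).exists
      simpa [hn] using hx n
    obtain ⟨h1, h2⟩ := eq_zero_of_massExcess_ae_eq_zero (by linarith) hρ₀ h hE
    exact hφ (by rw [h1, h2]; rfl)
  rw [integral_sub (integrable_massDensity hβ hρ₀ h) (integrable_massDensity_kerr hβ hρ₀)] at hpos
  unfold mass
  have : 0 < 1 / (32 * π) := by positivity
  exact mul_lt_mul_of_pos_left (by linarith) this

end Minimality

end KerrMass

end

theorem theorem1 (J β ρ₀ : ℝ) (hβ : β < -1 / 2) (hρ₀ : 0 < ρ₀) :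
    (∀ φ ∈ KerrMass.perturbations β ρ₀,
      MeasureTheory.Integrable (KerrMass.massDensity (KerrMass.kerrData J + φ))) ∧
    ∃ ε : ℝ, 0 < ε ∧ ∀ φ ∈ KerrMass.perturbations β ρ₀,
      KerrMass.bNorm β ρ₀ φ < ε → φ ≠ 0 →
        KerrMass.mass (KerrMass.kerrData J) < KerrMass.mass (KerrMass.kerrData J + φ) :=
  ⟨fun _ h => KerrMass.integrable_massDensity hβ hρ₀ h,
    -- Minimality holds for every nonzero perturbation, so the radius is arbitrary.
    1, one_pos, fun _ h _ hφ => KerrMass.mass_lt_mass_add hβ hρ₀ h hφ⟩
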